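/- A PROP is a symmetric strict monoidal category whose objects are the natural numbers, with monoidal product $\oplus$ given on objects by addition; morphisms of PROPs are identity-on-objects strict symmetric monoidal functors. A signature $\Sigma$ is a set of generators $o\colon n\to m$ with arity $n$ and coarity $m$ ($n,m\in\mathbb N$); it may be infinite. The PROP presented by a signature and a set $E$ of equations between terms of equal type has as arrows $n\to m$ the terms $n \to m$ built from generators, identities and symmetries with composition $;$ and $\oplus$, modulo the laws of symmetric strict monoidal categories and the congruence generated by $E$. Let $\mathbf S_\Sigma$ be the PROP presented by $\Sigma$ and no equations. Let $\mathbf{Frob}$ be the PROP presented by $\mu\colon 2\to1$, $\eta\colon0\to1$, $\delta\colon1\to2$, $\epsilon\colon1\to0$ and the equations $E_F$ of special Frobenius monoids: $(\mu,\eta)$ is a commutative monoid, $(\delta,\epsilon)$ is a cocommutative comonoid, $(\delta\oplus id_1);(id_1\oplus\mu)=\mu;\delta=(id_1\oplus\delta);(\mu\oplus id_1)$, and $\delta;\mu=id_1$. A $\Sigma$-hypergraph consists of a finite set of nodes and a finite set of hyperedges, each hyperedge labelled by a generator $o\colon k\to l$ in $\Sigma$ and equipped with an ordered list of $k$ source nodes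 and an ordered list of $l$ target nodes; morphisms are maps on nodes and on hyperedges that preserve labels, sources and targets. It is discrete if it has no hyperedges; a natural number $n$ is identified with the discrete hypergraph with nodes $0,\dots,n-1$. The PROP $\mathbf{FTerm}_\Sigma$ has as arrows $n\to m$ the isomorphism classes of cospans $n\to G\leftarrow m$ of $\Sigma$-hypergraphs; composition is by pushout, $\oplus$ is by coproduct, and the symmetries are the cospans given by the block-swapping bijections. **Theorem.** For every signature $\Sigma$, the PROP $\mathbf{FTerm}_\Sigma$ is isomorphic to the coproduct $\mathbf S_\Sigma+\mathbf{Frob}$ in the category of PROPs. More precisely: 1. There are morphisms of PROPs $\varphi\colon\mathbf S_\Sigma\to\mathbf{FTerm}_\Sigma$ and $\psi\colon\mathbf{Frob}\to\mathbf{FTerm}_\Sigma$ that exhibit $\mathbf{FTerm}_\Sigma$ as a coproduct of $\mathbf S_\Sigma$ and $\mathbf{Frob}$. Here $\varphi$ sends each generator $o\colon n\to m$ to the cospan $n\to G_o\leftarrow m$, where $G_o$ has $n+m$ nodes and a single hyperedge, labelled $o$, whose sources are the first $n$ nodes and whose targets are the last $m$ nodes, in order, the two legs of the cospan being the inclusions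 of the first $n$ and of the last $m$ nodes; and $\psi$ sends $\mu,\eta,\delta,\epsilon$ to the cospans of discrete hypergraphs $2\to1\leftarrow1$, $0\to1\leftarrow1$, $1\to1\leftarrow2$, $1\to1\leftarrow0$, respectively. 2. $\mathbf{FTerm}_\Sigma$ is presented by $\Sigma$ together with a special Frobenius structure: there is an isomorphism to $\mathbf{FTerm}_\Sigma$ from the PROP presented by the signature $\Sigma+\{\mu,\eta,\delta,\epsilon\}$ and the equations $E_F$, and it sends the generators to the cospans described in 1. -/

import Mathlib

open CategoryTheory CategoryTheory.Limits

universe u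

/-! ### PROPs -/

/-- The data of a PROP: arrows between natural numbers with identities, composition (written in
diagrammatic order), a monoidal product that is addition on objects, and symmetries. -/
structure PROPData where
  Hom : ℕ → ℕ → Type u
  id (n : ℕ) : Hom n n
  comp {a b c : ℕ} : Hom a b → Hom b c → Hom a c
  tensor {a b c d : ℕ} : Hom a b → Hom c d → Hom (a + c) (b + d)
  symm (n m : ℕ) : Hom (n + m) (m + n)

/-- The identity arrow, seen as an arrow `n ⟶ m` along an equality `n = m` of natural numbers. -/
def PROPData.eqHom (X : PROPData.{u}) {n m : ℕ} (h : n = m) : X.Hom n m := h ▸ X.id n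

/-- A PROP: a symmetric strict monoidal category with objects the natural numbers, the monoidal
product on objects being addition. The arrows `eqHom` only express that the two sides of a strict
law have the same type up to an equality of natural numbers. -/
structure PROP extends PROPData.{u} where
  id_comp {a b : ℕ} (f : Hom a b) : comp (id a) f = f
  comp_id {a b : ℕ} (f : Hom a b) : comp f (id b) = f
  comp_assoc {a b c d : ℕ} (f : Hom a b) (g : Hom b c) (h : Hom c d) :
    comp (comp f g) h = comp f (comp g h)
  tensor_id (n m : ℕ) : tensor (id n) (id m) = id (n + m)
  tensor_comp {a b c a' b' c' : ℕ} (f : Hom a b) (g : Hom b c) (f' : Hom a' b') (g' : Hom b' c') :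
    tensor (comp f g) (comp f' g') = comp (tensor f f') (tensor g g')
  tensor_assoc {a b a' b' a'' b'' : ℕ} (f : Hom a b) (g : Hom a' b') (h : Hom a'' b'') :
    comp (tensor (tensor f g) h) (toPROPData.eqHom (Nat.add_assoc b b' b'')) =
      comp (toPROPData.eqHom (Nat.add_assoc a a' a'')) (tensor f (tensor g h))
  id_zero_tensor {a b : ℕ} (f : Hom a b) :
    comp (tensor (id 0) f) (toPROPData.eqHom (Nat.zero_add b)) =
      comp (toPROPData.eqHom (Nat.zero_add a)) f
  tensor_id_zero {a b : ℕ} (f : Hom a b) : tensor f (id 0) = f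
  symm_symm (n m : ℕ) : comp (symm n m) (symm m n) = id (n + m)
  symm_naturality {a b c d : ℕ} (f : Hom a b) (g : Hom c d) :
    comp (tensor f g) (symm b d) = comp (symm a c) (tensor g f)
  symm_add (n m k : ℕ) :
    symm (n + m) k =
      comp (toPROPData.eqHom (Nat.add_assoc n m k)) (comp (tensor (id n) (symm m k))
        (comp (toPROPData.eqHom (Nat.add_assoc n k m).symm) (comp (tensor (symm n k) (id m))
          (toPROPData.eqHom (Nat.add_assoc k n m)))))

/-- Morphisms of PROPs: identity-on-objects strict symmetric monoidal functors. -/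
@[ext]
structure PROPHom (X Y : PROP.{u}) where
  map {n m : ℕ} : X.Hom n m → Y.Hom n m
  map_id (n : ℕ) : map (X.id n) = Y.id n
  map_comp {a b c : ℕ} (f : X.Hom a b) (g : X.Hom b c) :
    map (X.comp f g) = Y.comp (map f) (map g)
  map_tensor {a b c d : ℕ} (f : X.Hom a b) (g : X.Hom c d) :
    map (X.tensor f g) = Y.tensor (map f) (map g)
  map_symm (n m : ℕ) : map (X.symm n m) = Y.symm n m

/-- The category of PROPs. -/
instance : Category PROP.{u} where
  Hom X Y := PROPHom X Y
  id X := ⟨fun f => f, fun _ => rfl, fun _ _ => rfl, fun _ _ => rfl, fun _ _ => rfl⟩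
  comp F G := ⟨fun f => G.map (F.map f), fun n => by rw [F.map_id, G.map_id],
    fun f g => by rw [F.map_comp, G.map_comp], fun f g => by rw [F.map_tensor, G.map_tensor],
    fun n m => by rw [F.map_symm, G.map_symm]⟩

/-! ### Symmetric monoidal theories and the PROPs they present -/

/-- A (one-sorted, monoidal) signature: a set of generators of each arity and coarity. -/
abbrev Signature := ℕ → ℕ → Type u

/-- The terms over a signature. -/
inductive Term (S : Signature.{u}) : ℕ → ℕ → Type u
  | gen {n m : ℕ} (o : S n m) : Term S n m
  | id (n : ℕ) : Term S n n
  | symm (n m : ℕ) : Term S (n + m) (m + n)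
  | comp {a b c : ℕ} (f : Term S a b) (g : Term S b c) : Term S a c
  | tensor {a b c d : ℕ} (f : Term S a b) (g : Term S c d) : Term S (a + c) (b + d)

namespace Term

variable {S : Signature.{u}}

/-- The identity term, seen as a term `n ⟶ m` along an equality `n = m`. -/
def eqHom {n m : ℕ} (h : n = m) : Term S n m := h ▸ Term.id n

/-- The smallest congruence on terms that contains the laws of symmetric strict monoidal categories
and the equations `E`. -/
inductive Rel (E : ∀ n m : ℕ, Term S n m → Term S n m → Prop) :
    ∀ {n m : ℕ}, Term S n m → Term S n m → Prop
  | of_eqn {n m : ℕ} {s t : Term S n m} : E n m s t → Rel E s t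
  | refl {n m : ℕ} (t : Term S n m) : Rel E t t
  | symmetric {n m : ℕ} {s t : Term S n m} : Rel E s t → Rel E t s
  | trans {n m : ℕ} {s t r : Term S n m} : Rel E s t → Rel E t r → Rel E s r
  | comp_congr {a b c : ℕ} {f f' : Term S a b} {g g' : Term S b c} :
      Rel E f f' → Rel E g g' → Rel E (comp f g) (comp f' g')
  | tensor_congr {a b c d : ℕ} {f f' : Term S a b} {g g' : Term S c d} :
      Rel E f f' → Rel E g g' → Rel E (tensor f g) (tensor f' g')
  | id_comp {a b : ℕ} (f : Term S a b) : Rel E (comp (id a) f) f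
  | comp_id {a b : ℕ} (f : Term S a b) : Rel E (comp f (id b)) f
  | comp_assoc {a b c d : ℕ} (f : Term S a b) (g : Term S b c) (h : Term S c d) :
      Rel E (comp (comp f g) h) (comp f (comp g h))
  | tensor_id (n m : ℕ) : Rel E (tensor (id n) (id m)) (id (n + m))
  | tensor_comp {a b c a' b' c' : ℕ} (f : Term S a b) (g : Term S b c) (f' : Term S a' b')
      (g' : Term S b' c') :
      Rel E (tensor (comp f g) (comp f' g')) (comp (tensor f f') (tensor g g'))
  | tensor_assoc {a b a' b' a'' b'' : ℕ} (f : Term S a b) (g : Term S a' b')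
      (h : Term S a'' b'') :
      Rel E (comp (tensor (tensor f g) h) (eqHom (Nat.add_assoc b b' b'')))
        (comp (eqHom (Nat.add_assoc a a' a'')) (tensor f (tensor g h)))
  | id_zero_tensor {a b : ℕ} (f : Term S a b) :
      Rel E (comp (tensor (id 0) f) (eqHom (Nat.zero_add b)))
        (comp (eqHom (Nat.zero_add a)) f)
  | tensor_id_zero {a b : ℕ} (f : Term S a b) : Rel E (n := a) (m := b) (tensor f (id 0)) f
  | symm_symm (n m : ℕ) : Rel E (comp (symm n m) (symm m n)) (id (n + m))
  | symm_naturality {a b c d : ℕ} (f : Term S a b) (g : Term S c d) :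
      Rel E (comp (tensor f g) (symm b d)) (comp (symm a c) (tensor g f))
  | symm_add (n m k : ℕ) :
      Rel E (symm (n + m) k)
        (comp (eqHom (Nat.add_assoc n m k)) (comp (tensor (id n) (symm m k))
          (comp (eqHom (Nat.add_assoc n k m).symm) (comp (tensor (symm n k) (id m))
            (eqHom (Nat.add_assoc k n m))))))

end Term

/-- The data of the PROP presented by `(S, E)`: terms modulo the congruence `Term.Rel E`. -/
def presentedData (S : Signature.{u}) (E : ∀ n m : ℕ, Term S n m → Term S n m → Prop) :
    PROPData.{u} where
  Hom n m := Quot (Term.Rel E (n := n) (m := m))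
  id n := Quot.mk _ (Term.id n)
  comp := Quot.map₂ Term.comp (fun f _ _ h => .comp_congr (.refl f) h)
    (fun _ _ g h => .comp_congr h (.refl g))
  tensor := Quot.map₂ Term.tensor (fun f _ _ h => .tensor_congr (.refl f) h)
    (fun _ _ g h => .tensor_congr h (.refl g))
  symm n m := Quot.mk _ (Term.symm n m)

theorem presentedData_eqHom (S : Signature.{u}) (E : ∀ n m : ℕ, Term S n m → Term S n m → Prop)
    {n m : ℕ} (h : n = m) : (presentedData S E).eqHom h = Quot.mk _ (Term.eqHom h) := by
  subst h; rfl

/-- The PROP freely generated (presented) by the symmetric monoidal theory `(S, E)`. -/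
def presentedPROP (S : Signature.{u}) (E : ∀ n m : ℕ, Term S n m → Term S n m → Prop) :
    PROP.{u} where
  toPROPData := presentedData S E
  id_comp := by rintro a b ⟨f⟩; exact Quot.sound (.id_comp f)
  comp_id := by rintro a b ⟨f⟩; exact Quot.sound (.comp_id f)
  comp_assoc := by rintro a b c d ⟨f⟩ ⟨g⟩ ⟨h⟩; exact Quot.sound (.comp_assoc f g h)
  tensor_id n m := Quot.sound (.tensor_id n m)
  tensor_comp := by
    rintro a b c a' b' c' ⟨f⟩ ⟨g⟩ ⟨f'⟩ ⟨g'⟩; exact Quot.sound (.tensor_comp f g f' g')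
  tensor_assoc := by
    rintro a b a' b' a'' b'' ⟨f⟩ ⟨g⟩ ⟨h⟩
    rw [presentedData_eqHom, presentedData_eqHom]
    exact Quot.sound (.tensor_assoc f g h)
  id_zero_tensor := by
    rintro a b ⟨f⟩
    rw [presentedData_eqHom, presentedData_eqHom]
    exact Quot.sound (.id_zero_tensor f)
  tensor_id_zero := by rintro a b ⟨f⟩; exact Quot.sound (.tensor_id_zero f)
  symm_symm n m := Quot.sound (.symm_symm n m)
  symm_naturality := by
    rintro a b c d ⟨f⟩ ⟨g⟩; exact Quot.sound (.symm_naturality f g)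
  symm_add n m k := by
    rw [presentedData_eqHom, presentedData_eqHom, presentedData_eqHom]
    exact Quot.sound (.symm_add n m k)

/-- The arrow of the presented PROP that is given by a generator. -/
def presentedPROP.gen {S : Signature.{u}} (E : ∀ n m : ℕ, Term S n m → Term S n m → Prop)
    {n m : ℕ} (o : S n m) : (presentedPROP S E).Hom n m := Quot.mk _ (Term.gen o)

/-- The theory over `S` without equations. -/
def noEqn (S : Signature.{u}) : ∀ n m : ℕ, Term S n m → Term S n m → Prop :=
  fun _ _ _ _ => False

/-- The PROP freely generated by the signature `S`, without equations. -/
def syntaxPROP (S : Signature.{u}) : PROP.{u} := presentedPROP S (noEqn S)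

/-- The signature of special Frobenius monoids. -/
inductive FrobGen : ℕ → ℕ → Type u
  | mult : FrobGen 2 1
  | unit : FrobGen 0 1
  | comult : FrobGen 1 2
  | counit : FrobGen 1 0

/-- The equations saying that the terms `mu`, `eta`, `delta`, `eps` form a special Frobenius monoid:
a commutative monoid and a cocommutative comonoid, subject to the Frobenius law and to the special
law. -/
inductive FrobEqn {S : Signature.{u}} (mu : Term S 2 1) (eta : Term S 0 1) (delta : Term S 1 2)
    (eps : Term S 1 0) : ∀ n m : ℕ, Term S n m → Term S n m → Prop
  | comm : FrobEqn mu eta delta eps 2 1 (.comp (.symm 1 1) mu) mu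
  | assoc : FrobEqn mu eta delta eps 3 1
      (.comp (.tensor mu (.id 1)) mu) (.comp (.tensor (.id 1) mu) mu)
  | unit_left : FrobEqn mu eta delta eps 1 1 (.comp (.tensor eta (.id 1)) mu) (.id 1)
  | unit_right : FrobEqn mu eta delta eps 1 1 (.comp (.tensor (.id 1) eta) mu) (.id 1)
  | cocomm : FrobEqn mu eta delta eps 1 2 (.comp delta (.symm 1 1)) delta
  | coassoc : FrobEqn mu eta delta eps 1 3
      (.comp delta (.tensor delta (.id 1))) (.comp delta (.tensor (.id 1) delta))
  | counit_left : FrobEqn mu eta delta eps 1 1 (.comp delta (.tensor eps (.id 1))) (.id 1)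
  | counit_right : FrobEqn mu eta delta eps 1 1 (.comp delta (.tensor (.id 1) eps)) (.id 1)
  | frob_left : FrobEqn mu eta delta eps 2 2
      (.comp (.tensor delta (.id 1)) (.tensor (.id 1) mu)) (.comp mu delta)
  | frob_right : FrobEqn mu eta delta eps 2 2
      (.comp (.tensor (.id 1) delta) (.tensor mu (.id 1))) (.comp mu delta)
  | special : FrobEqn mu eta delta eps 1 1 (.comp delta mu) (.id 1)

/-- The equations of special Frobenius monoids, over their signature. -/
def frobTheory : ∀ n m : ℕ, Term FrobGen.{u} n m → Term FrobGen.{u} n m → Prop :=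
  FrobEqn (.gen .mult) (.gen .unit) (.gen .comult) (.gen .counit)

/-- The PROP of special Frobenius monoids. -/
def Frob : PROP.{u} := presentedPROP FrobGen.{u} frobTheory

/-- The disjoint union of a signature with the signature of special Frobenius monoids. -/
def withFrobGen (S : Signature.{u}) : Signature.{u} := fun n m => S n m ⊕ FrobGen.{u} n m

/-- The equations of special Frobenius monoids, over the signature `S + FrobGen`. -/
def withFrobTheory (S : Signature.{u}) :
    ∀ n m : ℕ, Term (withFrobGen S) n m → Term (withFrobGen S) n m → Prop :=
  FrobEqn (.gen (.inr .mult)) (.gen (.inr .unit)) (.gen (.inr .comult)) (.gen (.inr .counit))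

/-! ### Typed hypergraphs -/

/-- The generators of a signature of all arities and coarities together. -/
structure Label (S : Signature.{u}) where
  arity : ℕ
  coarity : ℕ
  gen : S arity coarity

/-- Finite directed hypergraphs typed over `S`: a finite ordinal of nodes, a finite ordinal of
hyperedges, each labelled with a generator and equipped with an ordered list of source nodes and an
ordered list of target nodes whose lengths are the arity and the coarity of the label. The labelling is the typing morphism to `S`, where
`S` is regarded as the hypergraph with a single node and the generators as its hyperedges. -/
structure TypedHypergraph (S : Signature.{u}) where
  V : ℕ
  E : ℕ
  label : Fin E → Label S
  source : Fin E → List (Fin V)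
  target : Fin E → List (Fin V)
  source_length (e : Fin E) : (source e).length = (label e).arity
  target_length (e : Fin E) : (target e).length = (label e).coarity

namespace TypedHypergraph

variable {S : Signature.{u}}

/-- Morphisms of typed hypergraphs: maps on nodes and on hyperedges that preserve labels (this is
commutation with the typing morphisms), sources and targets. -/
@[ext]
structure Hom (G H : TypedHypergraph S) where
  onV : Fin G.V → Fin H.V
  onE : Fin G.E → Fin H.E
  label_onE (e : Fin G.E) : H.label (onE e) = G.label e
  source_onE (e : Fin G.E) : H.source (onE e) = (G.source e).map onV
  target_onE (e : Fin G.E) : H.target (onE e) = (G.target e).map onV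

/-- The category of finite hypergraphs typed over `S`. -/
instance : Category (TypedHypergraph S) where
  Hom G H := Hom G H
  id G := ⟨fun v => v, fun e => e, fun _ => rfl, fun _ => by simp, fun _ => by simp⟩
  comp f g := ⟨fun v => g.onV (f.onV v), fun e => g.onE (f.onE e),
    fun e => by rw [g.label_onE, f.label_onE],
    fun e => by rw [g.source_onE, f.source_onE, List.map_map]; rfl,
    fun e => by rw [g.target_onE, f.target_onE, List.map_map]; rfl⟩

theorem hom_ext {G H : TypedHypergraph S} {f g : G ⟶ H} (hV : ∀ v, f.onV v = g.onV v)
    (hE : ∀ e, f.onE e = g.onE e) : f = g := Hom.ext (funext hV) (funext hE)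

@[simp] theorem id_onV (G : TypedHypergraph S) (v : Fin G.V) : Hom.onV (𝟙 G) v = v := rfl
@[simp] theorem id_onE (G : TypedHypergraph S) (e : Fin G.E) : Hom.onE (𝟙 G) e = e := rfl
@[simp] theorem comp_onV {G H K : TypedHypergraph S} (f : G ⟶ H) (g : H ⟶ K) (v : Fin G.V) :
    Hom.onV (f ≫ g) v = g.onV (f.onV v) := rfl
@[simp] theorem comp_onE {G H K : TypedHypergraph S} (f : G ⟶ H) (g : H ⟶ K) (e : Fin G.E) :
    Hom.onE (f ≫ g) e = g.onE (f.onE e) := rfl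

/-! Pushouts of hypergraphs, computed separately on nodes and on hyperedges. -/

section Pushout

variable {Z G H : TypedHypergraph S} (a : Z ⟶ G) (b : Z ⟶ H)

/-- The relation on nodes whose quotient is the pushout. -/
inductive PushoutRelV : Fin G.V ⊕ Fin H.V → Fin G.V ⊕ Fin H.V → Prop
  | glue (z : Fin Z.V) : PushoutRelV (.inl (a.onV z)) (.inr (b.onV z))

/-- The relation on hyperedges whose quotient is the pushout. -/
inductive PushoutRelE : Fin G.E ⊕ Fin H.E → Fin G.E ⊕ Fin H.E → Prop
  | glue (z : Fin Z.E) : PushoutRelE (.inl (a.onE z)) (.inr (b.onE z))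

/-- The nodes of the pushout. -/
abbrev PushoutV := Quot (PushoutRelV a b)

/-- The hyperedges of the pushout. -/
abbrev PushoutE := Quot (PushoutRelE a b)

instance : Finite (PushoutV a b) := Quot.finite _
instance : Finite (PushoutE a b) := Quot.finite _

/-- A numbering of the nodes of the pushout. -/
noncomputable def numV : PushoutV a b ≃ Fin (Nat.card (PushoutV a b)) := Finite.equivFin _

/-- A numbering of the hyperedges of the pushout. -/
noncomputable def numE : PushoutE a b ≃ Fin (Nat.card (PushoutE a b)) := Finite.equivFin _

/-- The label of a hyperedge of the pushout. -/
def pushoutLabel : PushoutE a b → Label S :=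
  Quot.lift (Sum.elim G.label H.label) (by
    rintro _ _ ⟨z⟩
    change G.label _ = H.label _
    rw [a.label_onE, b.label_onE])

/-- The node of the pushout that a node of the first hypergraph is sent to. -/
noncomputable def pushoutInlV (v : Fin G.V) : Fin (Nat.card (PushoutV a b)) :=
  numV a b (Quot.mk _ (.inl v))

/-- The node of the pushout that a node of the second hypergraph is sent to. -/
noncomputable def pushoutInrV (v : Fin H.V) : Fin (Nat.card (PushoutV a b)) :=
  numV a b (Quot.mk _ (.inr v))

theorem pushoutInlV_glue (l : List (Fin Z.V)) :
    (l.map a.onV).map (pushoutInlV a b) = (l.map b.onV).map (pushoutInrV a b) := by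
  rw [List.map_map, List.map_map]
  congr 1
  funext z
  exact congrArg (numV a b) (Quot.sound (.glue z))

/-- The sources of a hyperedge of the pushout. -/
noncomputable def pushoutSource : PushoutE a b → List (Fin (Nat.card (PushoutV a b))) :=
  Quot.lift (Sum.elim (fun e => (G.source e).map (pushoutInlV a b))
    (fun e => (H.source e).map (pushoutInrV a b))) (by
    rintro _ _ ⟨z⟩
    change (G.source _).map _ = (H.source _).map _
    rw [a.source_onE, b.source_onE, pushoutInlV_glue])

/-- The targets of a hyperedge of the pushout. -/
noncomputable def pushoutTarget : PushoutE a b → List (Fin (Nat.card (PushoutV a b))) :=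
  Quot.lift (Sum.elim (fun e => (G.target e).map (pushoutInlV a b))
    (fun e => (H.target e).map (pushoutInrV a b))) (by
    rintro _ _ ⟨z⟩
    change (G.target _).map _ = (H.target _).map _
    rw [a.target_onE, b.target_onE, pushoutInlV_glue])

/-- The pushout of hypergraphs. -/
noncomputable def pushoutObj : TypedHypergraph S where
  V := Nat.card (PushoutV a b)
  E := Nat.card (PushoutE a b)
  label e := pushoutLabel a b ((numE a b).symm e)
  source e := pushoutSource a b ((numE a b).symm e)
  target e := pushoutTarget a b ((numE a b).symm e)
  source_length e := by
    rcases (numE a b).symm e with ⟨e | e⟩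
    · exact (List.length_map _).trans (G.source_length e)
    · exact (List.length_map _).trans (H.source_length e)
  target_length e := by
    rcases (numE a b).symm e with ⟨e | e⟩
    · exact (List.length_map _).trans (G.target_length e)
    · exact (List.length_map _).trans (H.target_length e)

/-- The first morphism into the pushout. -/
noncomputable def pushoutInl : G ⟶ pushoutObj a b where
  onV := pushoutInlV a b
  onE e := numE a b (Quot.mk _ (.inl e))
  label_onE e := by simp [pushoutObj, pushoutLabel]
  source_onE e := by simp [pushoutObj, pushoutSource]
  target_onE e := by simp [pushoutObj, pushoutTarget]

/-- The second morphism into the pushout. -/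
noncomputable def pushoutInr : H ⟶ pushoutObj a b where
  onV := pushoutInrV a b
  onE e := numE a b (Quot.mk _ (.inr e))
  label_onE e := by simp [pushoutObj, pushoutLabel]
  source_onE e := by simp [pushoutObj, pushoutSource]
  target_onE e := by simp [pushoutObj, pushoutTarget]

theorem pushout_condition : a ≫ pushoutInl a b = b ≫ pushoutInr a b :=
  hom_ext (fun z => congrArg (numV a b) (Quot.sound (.glue z)))
    (fun z => congrArg (numE a b) (Quot.sound (.glue z)))

variable {a b}

/-- The morphism out of the pushout that is induced by a commutative square. -/
noncomputable def pushoutDesc {K : TypedHypergraph S} (f : G ⟶ K) (g : H ⟶ K) (w : a ≫ f = b ≫ g) :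
    pushoutObj a b ⟶ K where
  onV v := Quot.lift (Sum.elim f.onV g.onV)
    (by rintro _ _ ⟨z⟩; exact congrArg (fun h => Hom.onV h z) w) ((numV a b).symm v)
  onE e := Quot.lift (Sum.elim f.onE g.onE)
    (by rintro _ _ ⟨z⟩; exact congrArg (fun h => Hom.onE h z) w) ((numE a b).symm e)
  label_onE e := by
    obtain ⟨e, rfl⟩ := (numE a b).surjective e
    rcases e with ⟨e | e⟩
    · simpa [pushoutObj, pushoutLabel] using f.label_onE e
    · simpa [pushoutObj, pushoutLabel] using g.label_onE e
  source_onE e := by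
    obtain ⟨e, rfl⟩ := (numE a b).surjective e
    rcases e with ⟨e | e⟩
    · simpa [pushoutObj, pushoutSource, pushoutInlV, Function.comp_def] using f.source_onE e
    · simpa [pushoutObj, pushoutSource, pushoutInrV, Function.comp_def] using g.source_onE e
  target_onE e := by
    obtain ⟨e, rfl⟩ := (numE a b).surjective e
    rcases e with ⟨e | e⟩
    · simpa [pushoutObj, pushoutTarget, pushoutInlV, Function.comp_def] using f.target_onE e
    · simpa [pushoutObj, pushoutTarget, pushoutInrV, Function.comp_def] using g.target_onE e

theorem pushoutInl_desc {K : TypedHypergraph S} (f : G ⟶ K) (g : H ⟶ K) (w : a ≫ f = b ≫ g) :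
    pushoutInl a b ≫ pushoutDesc f g w = f :=
  hom_ext (fun v => by simp [pushoutInl, pushoutDesc, pushoutInlV])
    (fun e => by simp [pushoutInl, pushoutDesc])

theorem pushoutInr_desc {K : TypedHypergraph S} (f : G ⟶ K) (g : H ⟶ K) (w : a ≫ f = b ≫ g) :
    pushoutInr a b ≫ pushoutDesc f g w = g :=
  hom_ext (fun v => by simp [pushoutInr, pushoutDesc, pushoutInrV])
    (fun e => by simp [pushoutInr, pushoutDesc])

theorem pushout_hom_ext {K : TypedHypergraph S} {h k : pushoutObj a b ⟶ K}
    (hl : pushoutInl a b ≫ h = pushoutInl a b ≫ k)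
    (hr : pushoutInr a b ≫ h = pushoutInr a b ≫ k) : h = k := by
  refine hom_ext (fun v => ?_) (fun e => ?_)
  · obtain ⟨v, rfl⟩ := (numV a b).surjective v
    rcases v with ⟨v | v⟩
    · exact congrArg (fun h => Hom.onV h v) hl
    · exact congrArg (fun h => Hom.onV h v) hr
  · obtain ⟨e, rfl⟩ := (numE a b).surjective e
    rcases e with ⟨e | e⟩
    · exact congrArg (fun h => Hom.onE h e) hl
    · exact congrArg (fun h => Hom.onE h e) hr

variable (a b)

theorem isPushout_pushoutObj : IsPushout a b (pushoutInl a b) (pushoutInr a b) :=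
  ⟨⟨pushout_condition a b⟩, ⟨PushoutCocone.IsColimit.mk _
    (fun s => pushoutDesc s.inl s.inr s.condition) (fun _ => pushoutInl_desc _ _ _)
    (fun _ => pushoutInr_desc _ _ _) (fun _ _ hl hr => pushout_hom_ext
      (hl.trans (pushoutInl_desc _ _ _).symm) (hr.trans (pushoutInr_desc _ _ _).symm))⟩⟩

end Pushout

instance : HasPushouts (TypedHypergraph S) :=
  @hasPushouts_of_hasColimit_span _ _ (fun {_ _ _ f g} => (isPushout_pushoutObj f g).hasPushout)

/-! Discrete hypergraphs. -/

/-- The discrete hypergraph with `n` nodes: it has no hyperedges. -/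
def disc (n : ℕ) : TypedHypergraph S where
  V := n
  E := 0
  label := Fin.elim0
  source := Fin.elim0
  target := Fin.elim0
  source_length e := e.elim0
  target_length e := e.elim0

/-- The morphism out of a discrete hypergraph that is given by a map on nodes. -/
def discHom {n : ℕ} {G : TypedHypergraph S} (f : Fin n → Fin G.V) : disc n ⟶ G where
  onV := f
  onE := Fin.elim0
  label_onE e := e.elim0
  source_onE e := e.elim0
  target_onE e := e.elim0

@[simp] theorem discHom_onV {n : ℕ} {G : TypedHypergraph S} (f : Fin n → Fin G.V) :
    Hom.onV (discHom f : disc n ⟶ G) = f := rfl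

theorem disc_ext {n : ℕ} {G : TypedHypergraph S} {f g : disc n ⟶ G}
    (h : ∀ v : Fin n, f.onV v = g.onV v) : f = g := hom_ext h (fun e => Fin.elim0 e)

/-- The discrete hypergraph without nodes is initial. -/
def isInitialDiscZero : IsInitial (disc 0 : TypedHypergraph S) :=
  IsInitial.ofUniqueHom (fun _ => discHom Fin.elim0) (fun _ _ => disc_ext (fun v => Fin.elim0 v))

instance : HasInitial (TypedHypergraph S) := isInitialDiscZero.hasInitial

instance : HasBinaryCoproducts (TypedHypergraph S) :=
  hasBinaryCoproducts_of_hasInitial_and_pushouts _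

/-- The inclusion of the first `n` of `n + m` nodes. -/
def discInl (n m : ℕ) : (disc n : TypedHypergraph S) ⟶ disc (n + m) :=
  discHom (G := disc (n + m)) (Fin.castAdd m)

/-- The inclusion of the last `m` of `n + m` nodes. -/
def discInr (n m : ℕ) : (disc m : TypedHypergraph S) ⟶ disc (n + m) :=
  discHom (G := disc (n + m)) (Fin.natAdd n)

/-- The copairing of two morphisms out of discrete hypergraphs: it is the first one on the first `n`
nodes and the second one on the last `m` nodes. -/
def copair {n m : ℕ} {G : TypedHypergraph S} (f : disc n ⟶ G) (g : disc m ⟶ G) : disc (n + m) ⟶ G :=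
  discHom (Fin.append f.onV g.onV)

@[simp]
theorem discInl_copair {n m : ℕ} {G : TypedHypergraph S} (f : disc n ⟶ G) (g : disc m ⟶ G) :
    discInl n m ≫ copair f g = f := disc_ext (fun v => Fin.append_left f.onV g.onV v)

@[simp]
theorem discInr_copair {n m : ℕ} {G : TypedHypergraph S} (f : disc n ⟶ G) (g : disc m ⟶ G) :
    discInr n m ≫ copair f g = g := disc_ext (fun v => Fin.append_right f.onV g.onV v)

theorem disc_add_ext {n m : ℕ} {G : TypedHypergraph S} {f g : disc (n + m) ⟶ G}
    (hl : discInl n m ≫ f = discInl n m ≫ g) (hr : discInr n m ≫ f = discInr n m ≫ g) :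
    f = g :=
  disc_ext (fun v => Fin.addCases (fun i => congrFun (congrArg Hom.onV hl) i)
    (fun i => congrFun (congrArg Hom.onV hr) i) v)

end TypedHypergraph

/-! ### Frobenius termgraphs -/

section FTermgraphs

open TypedHypergraph

/-- A cospan `n → G ← m` of typed hypergraphs between the discrete hypergraphs with `n` and with `m`
nodes. -/
structure DiscCospan (S : Signature.{u}) (n m : ℕ) where
  apex : TypedHypergraph S
  left : disc n ⟶ apex
  right : disc m ⟶ apex

namespace DiscCospan

variable {S : Signature.{u}}

/-- Two cospans are identified when there is an isomorphism of their apices that commutes with the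
legs. -/
def IsoRel {n m : ℕ} (c d : DiscCospan S n m) : Prop :=
  ∃ i : c.apex ≅ d.apex, c.left ≫ i.hom = d.left ∧ c.right ≫ i.hom = d.right

/-- Isomorphism of cospans is an equivalence relation. -/
instance setoid (n m : ℕ) : Setoid (DiscCospan S n m) where
  r := IsoRel
  iseqv :=
    ⟨fun c => ⟨Iso.refl _, by simp, by simp⟩,
     fun ⟨i, h₁, h₂⟩ => ⟨i.symm, by simp [← h₁], by simp [← h₂]⟩,
     fun ⟨i, h₁, h₂⟩ ⟨j, k₁, k₂⟩ => ⟨i ≪≫ j, by simp [← k₁, ← h₁], by simp [← k₂, ← h₂]⟩⟩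

/-- The cospan `n → m ← m` given by a morphism of discrete hypergraphs and an identity. -/
def ofHom {n m : ℕ} (f : (disc n : TypedHypergraph S) ⟶ disc m) : DiscCospan S n m :=
  ⟨disc m, f, 𝟙 _⟩

/-- The composite of two cospans, by pushout in the category of typed hypergraphs. -/
noncomputable def comp {a b c : ℕ} (f : DiscCospan S a b) (g : DiscCospan S b c) :
    DiscCospan S a c :=
  ⟨pushout f.right g.left, f.left ≫ pushout.inl _ _, g.right ≫ pushout.inr _ _⟩

/-- The monoidal product of two cospans, by coproduct of the apices and of the legs. -/
noncomputable def tensor {a b c d : ℕ} (f : DiscCospan S a b) (g : DiscCospan S c d) :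
    DiscCospan S (a + c) (b + d) :=
  ⟨f.apex ⨿ g.apex, copair (f.left ≫ coprod.inl) (g.left ≫ coprod.inr),
    copair (f.right ≫ coprod.inl) (g.right ≫ coprod.inr)⟩

/-- The bijection that exchanges a block of `n` nodes and a block of `m` nodes. -/
def swap (n m : ℕ) : (disc (n + m) : TypedHypergraph S) ⟶ disc (m + n) :=
  copair (discInr m n) (discInl m n)

theorem copair_comp {n m : ℕ} {G H : TypedHypergraph S} (f : disc n ⟶ G) (g : disc m ⟶ G)
    (h : G ⟶ H) : copair f g ≫ h = copair (f ≫ h) (g ≫ h) :=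
  disc_add_ext (by rw [← Category.assoc]; simp) (by rw [← Category.assoc]; simp)

theorem comp_equiv {a b c : ℕ} (f : DiscCospan S a b) (g : DiscCospan S b c)
    {K : TypedHypergraph S} {i : f.apex ⟶ K} {j : g.apex ⟶ K}
    (h : IsPushout f.right g.left i j) :
    comp f g ≈ ⟨K, f.left ≫ i, g.right ≫ j⟩ :=
  ⟨(IsPushout.of_hasPushout f.right g.left).isoIsPushout _ _ h, by simp [comp], by simp [comp]⟩

theorem comp_congr {a b c : ℕ} {f f' : DiscCospan S a b} {g g' : DiscCospan S b c}
    (hf : f ≈ f') (hg : g ≈ g') : comp f g ≈ comp f' g' := by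
  obtain ⟨i, hi₁, hi₂⟩ := hf
  obtain ⟨j, hj₁, hj₂⟩ := hg
  have h : IsPushout f.right g.left (i.hom ≫ pushout.inl f'.right g'.left)
      (j.hom ≫ pushout.inr f'.right g'.left) :=
    (IsPushout.of_hasPushout f'.right g'.left).of_iso (Iso.refl _) i.symm j.symm (Iso.refl _)
      (by simp [← hi₂]) (by simp [← hj₁]) (by simp) (by simp)
  have h' := comp_equiv f g h
  rw [← Category.assoc, ← Category.assoc, hi₁, hj₂] at h'
  exact h'

theorem tensor_congr {a b c d : ℕ} {f f' : DiscCospan S a b} {g g' : DiscCospan S c d}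
    (hf : f ≈ f') (hg : g ≈ g') : tensor f g ≈ tensor f' g' := by
  obtain ⟨i, hi₁, hi₂⟩ := hf
  obtain ⟨j, hj₁, hj₂⟩ := hg
  exact ⟨coprod.mapIso i j, by simp [tensor, copair_comp, ← hi₁, ← hj₁],
    by simp [tensor, copair_comp, ← hi₂, ← hj₂]⟩

theorem comp_assoc {a b c d : ℕ} (f : DiscCospan S a b) (g : DiscCospan S b c)
    (h : DiscCospan S c d) : comp (comp f g) h ≈ comp f (comp g h) := by
  have p := IsPushout.of_hasPushout f.right g.left
  have q := IsPushout.of_hasPushout g.right h.left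
  have r := IsPushout.of_hasPushout (pushout.inr f.right g.left) (pushout.inl g.right h.left)
  have h₁ := comp_equiv (comp f g) h (q.paste_horiz r)
  have h₂ := comp_equiv f (comp g h) (p.paste_vert r)
  simp only [comp, Category.assoc] at h₁ h₂
  exact Setoid.trans h₁ (Setoid.symm h₂)

theorem comp_ofHom_left {a b c : ℕ} (f : (disc a : TypedHypergraph S) ⟶ disc b)
    (g : DiscCospan S b c) : comp (ofHom f) g ≈ ⟨g.apex, f ≫ g.left, g.right⟩ := by
  have h := comp_equiv (ofHom f) g (i := g.left) (j := 𝟙 _)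
    (IsPushout.of_horiz_isIso (f := 𝟙 (disc b)) ⟨by simp⟩)
  rwa [Category.comp_id] at h

theorem comp_ofHom_right {a b c : ℕ} (f : DiscCospan S a b)
    (g : (disc b : TypedHypergraph S) ≅ disc c) :
    comp f (ofHom g.hom) ≈ ⟨f.apex, f.left, g.inv ≫ f.right⟩ := by
  have h := comp_equiv f (ofHom g.hom) (i := 𝟙 _) (j := g.inv ≫ f.right)
    (IsPushout.of_vert_isIso (g := g.hom) ⟨by simp [ofHom]⟩)
  simp only [ofHom, Category.comp_id, Category.id_comp] at h
  exact h

theorem comp_ofHom_ofHom {a b c : ℕ} (f : (disc a : TypedHypergraph S) ⟶ disc b)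
    (g : (disc b : TypedHypergraph S) ⟶ disc c) : comp (ofHom f) (ofHom g) ≈ ofHom (f ≫ g) :=
  comp_ofHom_left f (ofHom g)

/-- The discrete hypergraph with `n + m` nodes is a coproduct. -/
noncomputable def discAddIso (n m : ℕ) :
    (disc n ⨿ disc m : TypedHypergraph S) ≅ disc (n + m) where
  hom := coprod.desc (discInl n m) (discInr n m)
  inv := copair coprod.inl coprod.inr
  hom_inv_id := coprod.hom_ext (by rw [coprod.inl_desc_assoc]; simp)
    (by rw [coprod.inr_desc_assoc]; simp)
  inv_hom_id := by
    rw [copair_comp, coprod.inl_desc, coprod.inr_desc]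
    exact disc_add_ext (by simp) (by simp)

theorem tensor_ofHom {a b c d : ℕ} (f : (disc a : TypedHypergraph S) ⟶ disc b)
    (g : (disc c : TypedHypergraph S) ⟶ disc d) :
    tensor (ofHom f) (ofHom g) ≈ ofHom (copair (f ≫ discInl b d) (g ≫ discInr b d)) := by
  refine ⟨discAddIso b d, ?_, ?_⟩
  · simp [tensor, ofHom, copair_comp, discAddIso, coprod.inl_desc, coprod.inr_desc]
  · exact disc_add_ext
      (by simp [tensor, ofHom, copair_comp, discAddIso, coprod.inl_desc])
      (by simp [tensor, ofHom, copair_comp, discAddIso, coprod.inr_desc])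

theorem isPushout_coprod {a b : ℕ} {X Y P X' Y' P' : TypedHypergraph S} {f : disc a ⟶ X}
    {g : disc a ⟶ Y} {i : X ⟶ P} {j : Y ⟶ P} {f' : disc b ⟶ X'} {g' : disc b ⟶ Y'} {i' : X' ⟶ P'}
    {j' : Y' ⟶ P'} (h : IsPushout f g i j) (h' : IsPushout f' g' i' j') :
    IsPushout (copair (f ≫ coprod.inl) (f' ≫ coprod.inr) : _ ⟶ X ⨿ X')
      (copair (g ≫ coprod.inl) (g' ≫ coprod.inr) : _ ⟶ Y ⨿ Y') (coprod.map i i')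
      (coprod.map j j') := by
  have key : ∀ s : PushoutCocone (copair (f ≫ coprod.inl) (f' ≫ coprod.inr) : _ ⟶ X ⨿ X')
      (copair (g ≫ coprod.inl) (g' ≫ coprod.inr) : _ ⟶ Y ⨿ Y'),
      f ≫ coprod.inl ≫ s.inl = g ≫ coprod.inl ≫ s.inr ∧
        f' ≫ coprod.inr ≫ s.inl = g' ≫ coprod.inr ≫ s.inr := by
    intro s
    have w := s.condition
    rw [copair_comp, copair_comp] at w
    have w₁ := congrArg (fun k => discInl a b ≫ k) w
    have w₂ := congrArg (fun k => discInr a b ≫ k) w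
    simp only [discInl_copair, discInr_copair, Category.assoc] at w₁ w₂
    exact ⟨w₁, w₂⟩
  refine ⟨⟨?_⟩, ⟨PushoutCocone.IsColimit.mk _
    (fun s => coprod.desc (h.desc _ _ (key s).1) (h'.desc _ _ (key s).2)) ?_ ?_ ?_⟩⟩
  · simp [copair_comp, h.w_assoc, h'.w_assoc]
  · intro s; exact coprod.hom_ext (by simp [coprod.inl_desc]) (by simp [coprod.inr_desc])
  · intro s; exact coprod.hom_ext (by simp [coprod.inl_desc]) (by simp [coprod.inr_desc])
  · intro s m hl hr
    refine coprod.hom_ext (h.hom_ext ?_ ?_) (h'.hom_ext ?_ ?_)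
    · simp [← hl, coprod.inl_desc]
    · simp [← hr, coprod.inl_desc]
    · simp [← hl, coprod.inr_desc]
    · simp [← hr, coprod.inr_desc]

theorem tensor_comp {a b c a' b' c' : ℕ} (f : DiscCospan S a b) (g : DiscCospan S b c)
    (f' : DiscCospan S a' b') (g' : DiscCospan S b' c') :
    tensor (comp f g) (comp f' g') ≈ comp (tensor f f') (tensor g g') := by
  have h := comp_equiv (tensor f f') (tensor g g') (isPushout_coprod
    (IsPushout.of_hasPushout f.right g.left) (IsPushout.of_hasPushout f'.right g'.left))
  refine Setoid.trans ?_ (Setoid.symm h)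
  exact ⟨Iso.refl _, by simp [tensor, comp, copair_comp], by simp [tensor, comp, copair_comp]⟩

/-- The identity map between discrete hypergraphs with equal numbers of nodes. -/
def castIso {n m : ℕ} (h : n = m) : (disc n : TypedHypergraph S) ≅ disc m where
  hom := discHom (G := disc m) (Fin.cast h)
  inv := discHom (G := disc n) (Fin.cast h.symm)
  hom_inv_id := disc_ext (fun _ => rfl)
  inv_hom_id := disc_ext (fun _ => rfl)

theorem castIso_assoc {a b c : ℕ} {G : TypedHypergraph S} (f : disc a ⟶ G) (g : disc b ⟶ G)
    (h : disc c ⟶ G) :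
    (castIso (Nat.add_assoc a b c)).hom ≫ copair f (copair g h) = copair (copair f g) h :=
  disc_ext fun v => (congrFun (Fin.append_assoc f.onV g.onV h.onV) v).symm

theorem tensor_assoc {a b a' b' a'' b'' : ℕ} (f : DiscCospan S a b) (g : DiscCospan S a' b')
    (h : DiscCospan S a'' b'') :
    comp (tensor (tensor f g) h) (ofHom (castIso (Nat.add_assoc b b' b'')).hom) ≈
      comp (ofHom (castIso (Nat.add_assoc a a' a'')).hom) (tensor f (tensor g h)) := by
  refine Setoid.trans (comp_ofHom_right _ _)
    (Setoid.trans ?_ (Setoid.symm (comp_ofHom_left _ _)))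
  refine ⟨coprod.associator _ _ _, ?_, ?_⟩
  · simp [tensor, castIso_assoc, copair_comp, coprod.inl_desc, coprod.inr_desc]
  · simp [tensor, Iso.inv_comp_eq, castIso_assoc, copair_comp, coprod.inl_desc, coprod.inr_desc]

theorem castIso_zero_add {n : ℕ} {G : TypedHypergraph S} (f : disc 0 ⟶ G) (g : disc n ⟶ G) :
    (castIso (Nat.zero_add n)).hom ≫ g = copair f g := by
  refine disc_add_ext (disc_ext fun v => v.elim0) ?_
  rw [discInr_copair]
  exact disc_ext fun v => congrArg g.onV (Fin.ext (Nat.zero_add _))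

theorem copair_zero {n : ℕ} {G : TypedHypergraph S} (f : disc n ⟶ G) (g : disc 0 ⟶ G) :
    copair f g = f :=
  disc_ext fun v => Fin.append_left f.onV g.onV v

/-- The coproduct with the empty hypergraph, on the left. -/
noncomputable def discZeroCoprodIso (G : TypedHypergraph S) : disc 0 ⨿ G ≅ G where
  hom := coprod.desc (isInitialDiscZero.to _) (𝟙 _)
  inv := coprod.inr
  hom_inv_id := coprod.hom_ext (isInitialDiscZero.hom_ext _ _)
    (by rw [coprod.inr_desc_assoc]; simp)
  inv_hom_id := coprod.inr_desc _ _

/-- The coproduct with the empty hypergraph, on the right. -/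
noncomputable def coprodDiscZeroIso (G : TypedHypergraph S) : G ⨿ disc 0 ≅ G where
  hom := coprod.desc (𝟙 _) (isInitialDiscZero.to _)
  inv := coprod.inl
  hom_inv_id := coprod.hom_ext (by rw [coprod.inl_desc_assoc]; simp)
    (isInitialDiscZero.hom_ext _ _)
  inv_hom_id := coprod.inl_desc _ _

theorem copair_inl_inr_discZero {n : ℕ} {G : TypedHypergraph S} (z : disc 0 ⟶ disc 0)
    (g : disc n ⟶ G) :
    copair (z ≫ coprod.inl) (g ≫ coprod.inr) ≫ (discZeroCoprodIso G).hom =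
      (castIso (Nat.zero_add n)).hom ≫ g := by
  rw [copair_comp, castIso_zero_add (isInitialDiscZero.to _)]
  congr 1
  · exact isInitialDiscZero.hom_ext _ _
  · simp [discZeroCoprodIso, coprod.inr_desc]

theorem copair_inl_discZero_inr {n : ℕ} {G : TypedHypergraph S} (z : disc 0 ⟶ disc 0)
    (g : disc n ⟶ G) :
    copair (g ≫ coprod.inl) (z ≫ coprod.inr) ≫ (coprodDiscZeroIso G).hom = g := by
  rw [copair_comp]
  refine (copair_zero _ _).trans ?_
  simp [coprodDiscZeroIso, coprod.inl_desc]

theorem id_zero_tensor {a b : ℕ} (f : DiscCospan S a b) :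
    comp (tensor (ofHom (𝟙 (disc 0))) f) (ofHom (castIso (Nat.zero_add b)).hom) ≈
      comp (ofHom (castIso (Nat.zero_add a)).hom) f := by
  refine Setoid.trans (comp_ofHom_right _ _)
    (Setoid.trans ?_ (Setoid.symm (comp_ofHom_left _ _)))
  refine ⟨discZeroCoprodIso f.apex, copair_inl_inr_discZero _ f.left, ?_⟩
  refine (Category.assoc _ _ _).trans ?_
  rw [Iso.inv_comp_eq]
  exact copair_inl_inr_discZero _ f.right

theorem tensor_id_zero {a b : ℕ} (f : DiscCospan S a b) :
    tensor f (ofHom (𝟙 (disc 0))) ≈ f :=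
  ⟨coprodDiscZeroIso f.apex, copair_inl_discZero_inr _ f.left, copair_inl_discZero_inr _ f.right⟩

theorem swap_comp_copair {n m : ℕ} {G : TypedHypergraph S} (f : disc n ⟶ G) (g : disc m ⟶ G) :
    swap n m ≫ copair g f = copair f g := by
  rw [swap, copair_comp, discInl_copair, discInr_copair]

theorem copair_discInl_discInr (n m : ℕ) :
    copair (discInl n m) (discInr n m) = 𝟙 (disc (n + m) : TypedHypergraph S) :=
  disc_add_ext (by simp) (by simp)

theorem swap_swap (n m : ℕ) : swap n m ≫ swap m n = 𝟙 (disc (n + m) : TypedHypergraph S) :=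
  (swap_comp_copair _ _).trans (copair_discInl_discInr n m)

/-- The exchange of two blocks of nodes, as an isomorphism. -/
def swapIso (n m : ℕ) : (disc (n + m) : TypedHypergraph S) ≅ disc (m + n) :=
  ⟨swap n m, swap m n, swap_swap n m, swap_swap m n⟩

theorem symm_naturality {a b c d : ℕ} (f : DiscCospan S a b) (g : DiscCospan S c d) :
    comp (tensor f g) (ofHom (swap b d)) ≈ comp (ofHom (swap a c)) (tensor g f) := by
  refine Setoid.trans (comp_ofHom_right _ (swapIso b d))
    (Setoid.trans ?_ (Setoid.symm (comp_ofHom_left _ _)))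
  refine ⟨coprod.braiding _ _, ?_, ?_⟩
  · simp [tensor, swap_comp_copair, copair_comp, coprod.inl_desc, coprod.inr_desc]
  · simp [tensor, swapIso, swap_comp_copair, copair_comp, coprod.inl_desc, coprod.inr_desc]

theorem copair_val {n m k : ℕ} (f : (disc n : TypedHypergraph S) ⟶ disc k)
    (g : (disc m : TypedHypergraph S) ⟶ disc k) (F : ℕ → ℕ) (G : ℕ → ℕ)
    (hf : ∀ v : Fin n, (f.onV v : Fin k).val = F v) (hg : ∀ v : Fin m, (g.onV v : Fin k).val = G v)
    (v : Fin (n + m)) :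
    ((copair f g).onV v : Fin k).val = if v.val < n then F v else G (v - n) := by
  refine Fin.addCases (fun i => ?_) (fun i => ?_) v
  · rw [if_pos (by simp)]
    exact (congrArg Fin.val (Fin.append_left f.onV g.onV i)).trans (hf i)
  · rw [if_neg (by simp)]
    refine (congrArg Fin.val (Fin.append_right f.onV g.onV i)).trans ((hg i).trans ?_)
    simp

theorem swap_val (n m : ℕ) (v : Fin (n + m)) :
    ((swap (S := S) n m).onV v : Fin (m + n)).val = if v.val < n then m + v else v - n :=
  copair_val (discInr m n) (discInl m n) (fun i => m + i) (fun i => i) (fun _ => rfl)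
    (fun _ => rfl) v

theorem symm_add (n m k : ℕ) :
    ofHom (swap (n + m) k) ≈
      comp (ofHom (castIso (S := S) (Nat.add_assoc n m k)).hom)
        (comp (tensor (ofHom (𝟙 (disc n))) (ofHom (swap m k)))
          (comp (ofHom (castIso (Nat.add_assoc n k m).symm).hom)
            (comp (tensor (ofHom (swap n k)) (ofHom (𝟙 (disc m))))
              (ofHom (castIso (Nat.add_assoc k n m)).hom)))) := by
  refine Setoid.symm (Setoid.trans (comp_congr (Setoid.refl _) (Setoid.trans
    (comp_congr (tensor_ofHom _ _) (Setoid.trans (comp_congr (Setoid.refl _) (Setoid.trans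
      (comp_congr (tensor_ofHom _ _) (Setoid.refl _)) (comp_ofHom_ofHom _ _)))
        (comp_ofHom_ofHom _ _))) (comp_ofHom_ofHom _ _))) ?_)
  refine Setoid.trans (comp_ofHom_ofHom _ _) ?_
  have key : ∀ f g : (disc (n + m + k) : TypedHypergraph S) ⟶ disc (k + (n + m)), f = g →
      ofHom f ≈ ofHom g := by rintro f _ rfl; exact Setoid.refl _
  refine key _ _ (disc_ext fun v => Fin.ext ?_)
  rw [swap_val]
  have h₁ := copair_val (k := k + n + m) (swap (S := S) n k ≫ discInl (k + n) m)
    (𝟙 (disc m) ≫ discInr (k + n) m) (fun i => if i < n then k + i else i - n)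
    (fun i => k + n + i) (fun i => swap_val n k i) (fun _ => rfl)
  have h₂ := copair_val (k := n + (k + m)) (𝟙 (disc n) ≫ discInl (S := S) n (k + m))
    (swap m k ≫ discInr n (k + m)) (fun i => i) (fun i => n + if i < m then k + i else i - m)
    (fun _ => rfl) (fun i => congrArg (n + ·) (swap_val m k i))
  obtain ⟨x, hx, hx'⟩ : ∃ x : Fin (n + (k + m)),
      (copair (G := disc (n + (k + m))) (𝟙 (disc n) ≫ discInl (S := S) n (k + m))
        (swap m k ≫ discInr n (k + m))).onV (Fin.cast (Nat.add_assoc n m k) v) = x ∧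
      x.val = if v.val < n then v.val else
        n + if v.val - n < m then k + (v.val - n) else v.val - n - m :=
    ⟨_, rfl, h₂ (Fin.cast (Nat.add_assoc n m k) v)⟩
  refine Eq.trans (congrArg (fun y : Fin (n + (k + m)) =>
    ((copair (G := disc (k + n + m)) (swap (S := S) n k ≫ discInl (k + n) m)
      (𝟙 (disc m) ≫ discInr (k + n) m)).onV (Fin.cast (Nat.add_assoc n k m).symm y) :
        Fin (k + n + m)).val) hx) ?_
  refine (h₁ (Fin.cast (Nat.add_assoc n k m).symm x)).trans ?_
  have h₄ := v.isLt
  rw [Fin.val_cast, hx']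
  split_ifs <;> omega

end DiscCospan

open DiscCospan

/-- The data of the PROP of Frobenius termgraphs: isomorphism classes of cospans of typed
hypergraphs between discrete hypergraphs. -/
noncomputable def FTermData (S : Signature.{u}) : PROPData.{u} where
  Hom n m := Quotient (DiscCospan.setoid (S := S) n m)
  id n := ⟦ofHom (𝟙 (disc n))⟧
  comp := Quotient.map₂ DiscCospan.comp (fun _ _ h _ _ h' => DiscCospan.comp_congr h h')
  tensor := Quotient.map₂ DiscCospan.tensor (fun _ _ h _ _ h' => DiscCospan.tensor_congr h h')
  symm n m := ⟦ofHom (swap n m)⟧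

theorem FTermData_eqHom (S : Signature.{u}) {n m : ℕ} (h : n = m) :
    (FTermData S).eqHom h = ⟦ofHom (castIso h).hom⟧ := by
  subst h
  exact congrArg (fun f => Quotient.mk _ (ofHom f)) (disc_ext fun _ => rfl)

/-- The PROP of Frobenius termgraphs over `S`. -/
noncomputable def FTerm (S : Signature.{u}) : PROP.{u} where
  toPROPData := FTermData S
  id_comp := by
    rintro a b ⟨f⟩
    refine Quotient.sound (Setoid.trans (comp_ofHom_left _ _) ?_)
    rw [Category.id_comp]
  comp_id := by
    rintro a b ⟨f⟩
    refine Quotient.sound (Setoid.trans (comp_ofHom_right _ (Iso.refl _)) ?_)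
    rw [Iso.refl_inv, Category.id_comp]
  comp_assoc := by
    rintro a b c d ⟨f⟩ ⟨g⟩ ⟨h⟩; exact Quotient.sound (DiscCospan.comp_assoc f g h)
  tensor_id n m := by
    refine Quotient.sound (Setoid.trans (tensor_ofHom _ _) ?_)
    rw [Category.id_comp, Category.id_comp, copair_discInl_discInr]
  tensor_comp := by
    rintro a b c a' b' c' ⟨f⟩ ⟨g⟩ ⟨f'⟩ ⟨g'⟩
    exact Quotient.sound (DiscCospan.tensor_comp f g f' g')
  tensor_assoc := by
    rintro a b a' b' a'' b'' ⟨f⟩ ⟨g⟩ ⟨h⟩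
    rw [FTermData_eqHom, FTermData_eqHom]
    exact Quotient.sound (DiscCospan.tensor_assoc f g h)
  id_zero_tensor := by
    rintro a b ⟨f⟩
    rw [FTermData_eqHom, FTermData_eqHom]
    exact Quotient.sound (DiscCospan.id_zero_tensor f)
  tensor_id_zero := by rintro a b ⟨f⟩; exact Quotient.sound (DiscCospan.tensor_id_zero f)
  symm_symm n m := by
    refine Quotient.sound (Setoid.trans (comp_ofHom_ofHom _ _) ?_)
    rw [swap_swap]
  symm_naturality := by
    rintro a b c d ⟨f⟩ ⟨g⟩; exact Quotient.sound (DiscCospan.symm_naturality f g)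
  symm_add n m k := by
    rw [FTermData_eqHom, FTermData_eqHom, FTermData_eqHom]
    exact Quotient.sound (DiscCospan.symm_add n m k)

/-- The arrow of `FTerm S` given by a cospan. -/
def FTerm.mk {S : Signature.{u}} {n m : ℕ} (c : DiscCospan S n m) : (FTerm S).Hom n m :=
  Quotient.mk (DiscCospan.setoid n m) c

/-- The arrow `n → N ← m` of `FTerm S` given by two functions between finite ordinals, regarded as
maps of discrete hypergraphs. -/
def FTerm.ofFun {S : Signature.{u}} {n m N : ℕ} (f : Fin n → Fin N) (g : Fin m → Fin N) :
    (FTerm S).Hom n m :=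
  FTerm.mk ⟨disc N, discHom (G := disc N) f, discHom (G := disc N) g⟩

/-- The hypergraph with `n + m` nodes and a single hyperedge, labelled with the generator `o`, with
the first `n` nodes as its sources and the last `m` nodes as its targets, in order. -/
def genHypergraph {S : Signature.{u}} {n m : ℕ} (o : S n m) : TypedHypergraph S where
  V := n + m
  E := 1
  label _ := ⟨n, m, o⟩
  source _ := List.ofFn (Fin.castAdd m)
  target _ := List.ofFn (Fin.natAdd n)
  source_length _ := List.length_ofFn
  target_length _ := List.length_ofFn

/-- The arrow of `FTerm S` given by a generator `o : n ⟶ m`: the cospan that consists of a single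
hyperedge labelled with `o`, whose sources are the left interface and whose targets are the right
interface. -/
def FTerm.gen {S : Signature.{u}} {n m : ℕ} (o : S n m) : (FTerm S).Hom n m :=
  FTerm.mk ⟨genHypergraph o, discHom (G := genHypergraph o) (Fin.castAdd m),
    discHom (G := genHypergraph o) (Fin.natAdd n)⟩

end FTermgraphs

/-! ### The symmetric monoidal category of a PROP -/

namespace PROP

variable (P : PROP.{u})

/-! A special Frobenius monoid on the object `1` of a PROP `P` turns a function `h : a → b` between
finite ordinals into two arrows: `push h : a ⟶ b`, built from multiplication and unit, and `pull h :
b ⟶ a`, built from comultiplication and counit. A cospan with apex `G` and legs `f`, `g` is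
evaluated as `push f`, then multiplication by a state `edges G : 0 ⟶ G.V`, then `pull g`. The state
is the product over all hyperedges of the interpretation of the label, bent into an arrow out of `0`
and pushed along the sources and targets. This is a morphism of PROPs (`eval`) with the prescribed
values on generators, and the arrows of `FTerm S` are generated by single hyperedges and the
Frobenius structure (`FTerm.hom_induction`). Existence and uniqueness in both universal properties,
coproduct and presentation, follow.

Functoriality of `push` holds because `n` is the `n`-fold coproduct of `1` among commutative monoid
objects, so that homomorphisms are determined on elements. `pull` is `push` in the opposite PROP.

The core is compatibility with composition. A pushout over a discrete hypergraph is a pushout on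
nodes and a disjoint union on hyperedges, so what is needed is the Beck-Chevalley property `pull g ;
push f = push i ; pull j` for pushout squares of functions (`pull_push`). It rests on the projection
formula `h^*(y · h_* x) = h^* y · x` (`push_fold_comp_pull`), which reduces to the Frobenius laws on
the generating function `2 → 1`. The formula shows that `push h ; pull h` is multiplication by the
state `h^*(1)`. When `h` is a coequalizer of pairs of elements, `h^*(1)` is the product of the
states linking these pairs (`unitState_pull_of_coequalizer`): pairs are merged one at a time, and
the special law makes redundant pairs harmless. For the copairing of `i` and `j` this state consists
of the links between `g z` and `f z`; the projection formula and a triangle identity then give the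
claim. -/

theorem eqHom_rfl (n : ℕ) (h : n = n) : P.eqHom h = P.id n := rfl

theorem eqHom_comp {a b c : ℕ} (h : a = b) (h' : b = c) :
    P.comp (P.eqHom h) (P.eqHom h') = P.eqHom (h.trans h') := by
  subst h h'; exact P.id_comp _

theorem tensor_eqHom {a b c d : ℕ} (h : a = b) (h' : c = d) :
    P.tensor (P.eqHom h) (P.eqHom h') = P.eqHom (by rw [h, h']) := by
  subst h h'; exact P.tensor_id _ _

/-- The objects of a PROP, as the objects of a category. -/
structure Obj (P : PROP.{u}) where
  val : ℕ

variable {P}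

instance : Category (Obj P) where
  Hom X Y := P.Hom X.val Y.val
  id X := P.id X.val
  comp f g := P.comp f g
  id_comp := P.id_comp
  comp_id := P.comp_id
  assoc := P.comp_assoc

/-- The isomorphism along an equality of natural numbers. -/
def eqIso {X Y : Obj P} (h : X.val = Y.val) : X ≅ Y where
  hom := P.eqHom h
  inv := P.eqHom h.symm
  hom_inv_id := P.eqHom_comp h h.symm
  inv_hom_id := P.eqHom_comp h.symm h

/-- All coherence arrows are `eqHom`s. Since `n + 0` and `n + (m + 1)` unfold, right unitors, and
associators whose last factor is `⟨0⟩` or `⟨1⟩`, are identities by computation. Later arguments rely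
on this. -/
instance : MonoidalCategoryStruct (Obj P) where
  tensorObj X Y := ⟨X.val + Y.val⟩
  tensorUnit := ⟨0⟩
  tensorHom f g := P.tensor f g
  whiskerLeft X _ _ f := P.tensor (P.id X.val) f
  whiskerRight f Y := P.tensor f (P.id Y.val)
  associator X Y Z := eqIso (Nat.add_assoc X.val Y.val Z.val)
  leftUnitor X := eqIso (Nat.zero_add X.val)
  rightUnitor X := eqIso (Nat.add_zero X.val)

instance : MonoidalCategory (Obj P) := .ofTensorHom
  (id_tensorHom_id := fun X Y => P.tensor_id X.val Y.val)
  (id_tensorHom := fun _ _ _ _ => rfl)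
  (tensorHom_id := fun _ _ => rfl)
  (tensorHom_comp_tensorHom := fun f g f' g' => (P.tensor_comp f f' g g').symm)
  (associator_naturality := fun f g h => P.tensor_assoc f g h)
  (leftUnitor_naturality := fun f => P.id_zero_tensor f)
  (rightUnitor_naturality := fun {X Y} f => by
    refine (P.comp_id (P.tensor f (P.id 0))).trans ?_
    exact (P.tensor_id_zero f).trans (P.id_comp f).symm)
  (pentagon := fun W X Y Z => by
    change P.comp (P.tensor (P.eqHom _) (P.eqHom rfl)) (P.comp (P.eqHom _)
      (P.tensor (P.eqHom rfl) (P.eqHom _))) = P.comp (P.eqHom _) (P.eqHom _)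
    simp only [tensor_eqHom, eqHom_comp])
  (triangle := fun X Y => by
    change P.comp (P.eqHom _) (P.tensor (P.eqHom rfl) (P.eqHom _)) =
      P.tensor (P.eqHom rfl) (P.eqHom rfl)
    simp only [tensor_eqHom, eqHom_comp])

/-- The symmetry as an isomorphism. -/
def symmIso (X Y : Obj P) : MonoidalCategory.tensorObj X Y ≅ MonoidalCategory.tensorObj Y X where
  hom := P.symm X.val Y.val
  inv := P.symm Y.val X.val
  hom_inv_id := P.symm_symm _ _
  inv_hom_id := P.symm_symm _ _

-- Cancelling the outer associators in `symm_add` leaves the reverse hexagon.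
open MonoidalCategory in
theorem hexagon (X Y Z : Obj P) :
    (α_ X Y Z).inv ≫ (symmIso (X ⊗ Y) Z).hom ≫ (α_ Z X Y).inv =
      X ◁ (symmIso Y Z).hom ≫ (α_ X Z Y).inv ≫ (symmIso X Z).hom ▷ Y := by
  have h : (symmIso (X ⊗ Y) Z).hom = (α_ X Y Z).hom ≫ X ◁ (symmIso Y Z).hom ≫
      (α_ X Z Y).inv ≫ (symmIso X Z).hom ▷ Y ≫ (α_ Z X Y).hom :=
    P.symm_add X.val Y.val Z.val
  rw [h]
  simp

instance : BraidedCategory (Obj P) where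
  braiding := symmIso
  braiding_naturality_right X _ _ f := P.symm_naturality (P.id X.val) f
  braiding_naturality_left f Z := P.symm_naturality f (P.id Z.val)
  hexagon_reverse := hexagon
  hexagon_forward X Y Z := by
    -- The reverse hexagon for `Y, Z, X` is read as an equality of isomorphisms and inverted:
    -- inverting a symmetry exchanges its arguments, which gives the forward hexagon.
    have h := congrArg (fun i => Iso.inv i) (Iso.ext (α := _ ) (β := _)
      (by simpa using hexagon Y Z X :
        ((MonoidalCategory.associator Y Z X).symm ≪≫ symmIso (MonoidalCategory.tensorObj Y Z) X ≪≫
          (MonoidalCategory.associator X Y Z).symm).hom =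
        (MonoidalCategory.whiskerLeftIso Y (symmIso Z X) ≪≫
          (MonoidalCategory.associator Y X Z).symm ≪≫
          MonoidalCategory.whiskerRightIso (symmIso Y X) Z).hom))
    simp only [Iso.trans_inv, Iso.symm_inv, Category.assoc, MonoidalCategory.whiskerLeftIso_inv,
      MonoidalCategory.whiskerRightIso_inv] at h
    exact h

instance : SymmetricCategory (Obj P) where
  symmetry X Y := P.symm_symm X.val Y.val

end PROP

/-! ### Coproducts of commutative monoid objects -/

section CommMonoidObjects

open MonoidalCategory MonObj

attribute [local instance] MonObj.tensorObj.instTensorObj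

variable {C : Type*} [Category* C] [MonoidalCategory C]

variable {X Y Z : C}

/-- The inclusion of the left factor of a tensor product of monoid objects. -/
def MonObj.inl (X Y : C) [MonObj Y] : X ⟶ X ⊗ Y := (ρ_ X).inv ≫ X ◁ η[Y]

/-- The inclusion of the right factor of a tensor product of monoid objects. -/
def MonObj.inr (X Y : C) [MonObj X] : Y ⟶ X ⊗ Y := (λ_ Y).inv ≫ η[X] ▷ Y

/-- The copairing of two arrows into a monoid object. -/
def MonObj.copair [MonObj Z] (f : X ⟶ Z) (g : Y ⟶ Z) : X ⊗ Y ⟶ Z := (f ⊗ₘ g) ≫ μ[Z]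

/-- `g` carries the unit of `Y` to that of `Z`, so on the left factor only the right unit law of `Z`
remains. -/
theorem MonObj.inl_copair [MonObj Y] [MonObj Z] (f : X ⟶ Z) (g : Y ⟶ Z) [IsMonHom g] :
    MonObj.inl X Y ≫ MonObj.copair f g = f := by
  have h : X ◁ η[Y] ≫ (f ⊗ₘ g) = f ▷ 𝟙_ C ≫ Z ◁ η[Z] := by
    rw [← id_tensorHom, ← tensorHom_id, ← id_tensorHom, tensorHom_comp_tensorHom,
      tensorHom_comp_tensorHom, IsMonHom.one_hom]
    simp
  rw [MonObj.inl, MonObj.copair, Category.assoc, reassoc_of% h, mul_one]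
  simp

theorem MonObj.inr_copair [MonObj X] [MonObj Z] (f : X ⟶ Z) (g : Y ⟶ Z) [IsMonHom f] :
    MonObj.inr X Y ≫ MonObj.copair f g = g := by
  have h : η[X] ▷ Y ≫ (f ⊗ₘ g) = 𝟙_ C ◁ g ≫ η[Z] ▷ Z := by
    rw [← id_tensorHom, ← tensorHom_id, ← tensorHom_id, tensorHom_comp_tensorHom,
      tensorHom_comp_tensorHom, IsMonHom.one_hom]
    simp
  rw [MonObj.inr, MonObj.copair, Category.assoc, reassoc_of% h, one_mul]
  simp

theorem MonObj.copair_comp {W : C} [MonObj Z] [MonObj W] (f : X ⟶ Z) (g : Y ⟶ Z) (h : Z ⟶ W)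
    [IsMonHom h] : MonObj.copair f g ≫ h = MonObj.copair (f ≫ h) (g ≫ h) := by
  rw [MonObj.copair, MonObj.copair, Category.assoc, IsMonHom.mul_hom,
    tensorHom_comp_tensorHom_assoc]

variable [SymmetricCategory C]

/-- The multiplication of a commutative monoid object is a homomorphism. -/
theorem MonObj.isMonHom_mul (M : C) [MonObj M] [IsCommMonObj M] : IsMonHom μ[M] where
  one_hom := by simp [MonObj.tensorObj.one_def, ← unitors_equal]
  mul_hom := by simp [MonObj.tensorObj.mul_def]

/-- The unit of a monoid object is a homomorphism. -/
theorem MonObj.isMonHom_one (M : C) [MonObj M] : IsMonHom η[M] where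
  mul_hom := by
    rw [MonoidalCategory.tensorHom_def, Category.assoc, mul_one]
    simp [← unitors_equal]

instance [MonObj X] [MonObj Y] : IsMonHom (MonObj.inl X Y) := by
  have := MonObj.isMonHom_one Y
  unfold MonObj.inl
  infer_instance

instance [MonObj X] [MonObj Y] : IsMonHom (MonObj.inr X Y) := by
  have := MonObj.isMonHom_one X
  unfold MonObj.inr
  infer_instance

/-- Commutativity of `Z` is what makes its multiplication `Z ⊗ Z ⟶ Z` a homomorphism. -/
instance [MonObj X] [MonObj Y] [MonObj Z] [IsCommMonObj Z] (f : X ⟶ Z) (g : Y ⟶ Z) [IsMonHom f]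
    [IsMonHom g] : IsMonHom (MonObj.copair f g) := by
  have := MonObj.isMonHom_mul Z
  unfold MonObj.copair
  infer_instance

/-- After the interchange of the middle factors each factor is multiplied by a unit. Composing with
this identity yields uniqueness of homomorphisms out of `X ⊗ Y`, which is thus a coproduct among
commutative monoids. -/
theorem MonObj.copair_inl_inr [MonObj X] [MonObj Y] :
    MonObj.copair (MonObj.inl X Y) (MonObj.inr X Y) = 𝟙 (X ⊗ Y) := by
  rw [MonObj.copair, MonObj.inl, MonObj.inr, MonObj.tensorObj.mul_def, ← id_tensorHom,
    ← tensorHom_id, ← tensorHom_comp_tensorHom, Category.assoc,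
    tensorμ_natural_assoc, tensorHom_comp_tensorHom, id_tensorHom, tensorHom_id, mul_one, one_mul]
  simp only [tensorμ, braiding_tensorUnit_left]
  monoidal

instance MonObj.isCommMonObj_tensorObj [MonObj X] [MonObj Y] [IsCommMonObj X] [IsCommMonObj Y] :
    IsCommMonObj (X ⊗ Y) where
  mul_comm := @IsCommMonObj.mul_comm _ _ _ _ (X ⊗ Y) (Mon.instMonObjTensorObj (M := X) (N := Y)) _

theorem MonObj.isMonHom_braiding [MonObj X] [MonObj Y] : IsMonHom (β_ X Y).hom where
  one_hom := one_braiding X Y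
  mul_hom := mul_braiding X Y

/-- Homomorphisms out of a tensor product of monoid objects are determined by their restrictions
to the factors. -/
theorem MonObj.tensor_hom_ext [MonObj X] [MonObj Y] [MonObj Z] {f g : X ⊗ Y ⟶ Z} [IsMonHom f]
    [IsMonHom g] (hl : MonObj.inl X Y ≫ f = MonObj.inl X Y ≫ g)
    (hr : MonObj.inr X Y ≫ f = MonObj.inr X Y ≫ g) : f = g := by
  rw [← Category.id_comp f, ← Category.id_comp g, ← MonObj.copair_inl_inr, MonObj.copair_comp,
    MonObj.copair_comp, hl, hr]

end CommMonoidObjects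

/-! ### Commutative monoids in PROPs -/

/-- A commutative monoid in a PROP, with underlying object `1`. -/
structure PROP.CommMonoidStr (P : PROP.{u}) where
  mul : P.Hom 2 1
  one : P.Hom 0 1
  one_mul : P.comp (P.tensor one (P.id 1)) mul = P.id 1
  mul_one : P.comp (P.tensor (P.id 1) one) mul = P.id 1
  mul_assoc : P.comp (P.tensor mul (P.id 1)) mul = P.comp (P.tensor (P.id 1) mul) mul
  mul_comm : P.comp (P.symm 1 1) mul = mul

namespace PROP.CommMonoidStr

open MonoidalCategory MonObj

variable {P : PROP.{u}} (A : P.CommMonoidStr)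

/-- The monoid object given by a commutative monoid in a PROP. -/
abbrev monObj : MonObj (⟨1⟩ : P.Obj) where
  one := A.one
  mul := A.mul
  one_mul := A.one_mul
  mul_one := A.mul_one
  mul_assoc := A.mul_assoc.trans (P.id_comp _).symm

theorem isCommMonObj : letI := A.monObj; IsCommMonObj (⟨1⟩ : P.Obj) :=
  letI := A.monObj
  ⟨A.mul_comm⟩

/-- The monoid structure on a tensor product, given by structures on the factors. -/
abbrev _root_.MonObj.tensor {C : Type*} [Category* C] [MonoidalCategory C] [SymmetricCategory C]
    {X Y : C} (a : MonObj X) (b : MonObj Y) : MonObj (X ⊗ Y) :=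
  MonObj.tensorObj.instTensorObj (M := X) (N := Y)

/-- The monoid structure on the object `n` of a PROP that contains a commutative monoid. -/
@[reducible] def pow : (n : ℕ) → MonObj (⟨n⟩ : P.Obj)
  | 0 => inferInstanceAs (MonObj (𝟙_ P.Obj))
  | n + 1 => MonObj.tensor (pow n) A.monObj

attribute [local instance] MonObj.tensorObj.instTensorObj

theorem isCommMonObj_pow (n : ℕ) : letI := A.pow n; IsCommMonObj (⟨n⟩ : P.Obj) := by
  induction n with
  | zero => exact inferInstanceAs (IsCommMonObj (𝟙_ P.Obj))
  | succ n ih =>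
    exact @MonObj.isCommMonObj_tensorObj P.Obj _ _ ⟨n⟩ ⟨1⟩ _ (A.pow n) A.monObj ih A.isCommMonObj

/-- Turns a coherence isomorphism that happens to be an identity arrow into an equality of monoid
structures. -/
theorem _root_.MonObj.eq_of_isMonHom_id {C : Type*} [Category* C] [MonoidalCategory C] {X : C}
    {m m' : MonObj X} (h : @IsMonHom _ _ _ _ _ m m' (𝟙 X)) : m = m' := by
  refine MonObj.ext _ _ ?_
  have := h.mul_hom
  simpa using this

/-- The right unitor and the associator are monoid homomorphisms. Their underlying arrows are
identities in the cases `n + 0` and `n + (m + 1)`, so the structures that they compare coincide. -/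
theorem pow_add (n m : ℕ) :
    A.pow (n + m) = MonObj.tensor (X := (⟨n⟩ : P.Obj)) (Y := ⟨m⟩) (A.pow n) (A.pow m) := by
  induction m with
  | zero =>
    exact (MonObj.eq_of_isMonHom_id (X := (⟨n⟩ : P.Obj))
      (@IsMonHom.mk P.Obj _ _ _ _ (MonObj.tensor (A.pow n) (A.pow 0)) (A.pow n)
      (ρ_ (⟨n⟩ : P.Obj)).hom (@one_rightUnitor P.Obj _ _ ⟨n⟩ (A.pow n))
      (@mul_rightUnitor P.Obj _ _ _ ⟨n⟩ (A.pow n)))).symm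
  | succ m ih =>
    let _ := A.pow n
    let _ := A.pow m
    let _ := A.monObj
    have h : IsMonHom (α_ (⟨n⟩ : P.Obj) ⟨m⟩ ⟨1⟩).hom := inferInstance
    refine Eq.trans ?_ (MonObj.eq_of_isMonHom_id (X := (⟨n + m + 1⟩ : P.Obj)) h)
    exact congrArg (fun a => MonObj.tensor (X := (⟨n + m⟩ : P.Obj)) (Y := ⟨1⟩) a A.monObj) ih

end PROP.CommMonoidStr

/-! ### Naturality and coherence of the coproduct inclusions -/

section CommMonoidObjects

open MonoidalCategory MonObj

attribute [local instance] MonObj.tensorObj.instTensorObj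

variable {C : Type*} [Category* C] [MonoidalCategory C]

theorem MonObj.inl_tensorHom {X Y X' Y' : C} [MonObj Y] [MonObj Y'] (f : X ⟶ X') (g : Y ⟶ Y')
    [IsMonHom g] : MonObj.inl X Y ≫ (f ⊗ₘ g) = f ≫ MonObj.inl X' Y' := by
  rw [MonObj.inl, MonObj.inl, Category.assoc, ← id_tensorHom, tensorHom_comp_tensorHom,
    IsMonHom.one_hom, Category.id_comp, MonoidalCategory.tensorHom_def]
  simp

theorem MonObj.inr_tensorHom {X Y X' Y' : C} [MonObj X] [MonObj X'] (f : X ⟶ X') (g : Y ⟶ Y')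
    [IsMonHom f] : MonObj.inr X Y ≫ (f ⊗ₘ g) = g ≫ MonObj.inr X' Y' := by
  rw [MonObj.inr, MonObj.inr, Category.assoc, ← tensorHom_id, tensorHom_comp_tensorHom,
    IsMonHom.one_hom, Category.id_comp, MonoidalCategory.tensorHom_def']
  simp

variable (X Y Z : C)

theorem MonObj.inr_inl_associator [MonObj X] [MonObj Z] :
    MonObj.inr X Y ≫ MonObj.inl (X ⊗ Y) Z ≫ (α_ X Y Z).hom =
      MonObj.inl Y Z ≫ MonObj.inr X (Y ⊗ Z) := by
  simp only [MonObj.inl, MonObj.inr, Category.assoc]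
  rw [rightUnitor_inv_naturality_assoc, ← whisker_exchange_assoc]
  monoidal

variable [SymmetricCategory C]

theorem MonObj.inl_inl_associator [MonObj Y] [MonObj Z] :
    MonObj.inl X Y ≫ MonObj.inl (X ⊗ Y) Z ≫ (α_ X Y Z).hom = MonObj.inl X (Y ⊗ Z) := by
  simp only [MonObj.inl, MonObj.tensorObj.one_def, MonoidalCategory.tensorHom_def]
  monoidal

theorem MonObj.inr_associator [MonObj X] [MonObj Y] :
    MonObj.inr (X ⊗ Y) Z ≫ (α_ X Y Z).hom = MonObj.inr Y Z ≫ MonObj.inr X (Y ⊗ Z) := by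
  simp only [MonObj.inr, MonObj.tensorObj.one_def, Category.assoc]
  rw [leftUnitor_inv_naturality_assoc, MonoidalCategory.tensorHom_def']
  monoidal

theorem MonObj.inl_braiding [MonObj Y] :
    MonObj.inl X Y ≫ (β_ X Y).hom = MonObj.inr Y X := by
  simp [MonObj.inl, MonObj.inr]

theorem MonObj.inr_braiding [MonObj X] :
    MonObj.inr X Y ≫ (β_ X Y).hom = MonObj.inl Y X := by
  simp [MonObj.inl, MonObj.inr]

end CommMonoidObjects

/-! ### The arrows given by functions between finite ordinals -/

/-- The function `a + c → b + d` that is `h` on the first block and `k` on the second block. -/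
def Fin.sumMap {a b c d : ℕ} (h : Fin a → Fin b) (k : Fin c → Fin d) : Fin (a + c) → Fin (b + d) :=
  Fin.append (fun i => Fin.castAdd d (h i)) (fun i => Fin.natAdd b (k i))

@[simp] theorem Fin.sumMap_castAdd {a b c d : ℕ} (h : Fin a → Fin b) (k : Fin c → Fin d)
    (i : Fin a) : Fin.sumMap h k (Fin.castAdd c i) = Fin.castAdd d (h i) := Fin.append_left _ _ _

@[simp] theorem Fin.sumMap_natAdd {a b c d : ℕ} (h : Fin a → Fin b) (k : Fin c → Fin d)
    (i : Fin c) : Fin.sumMap h k (Fin.natAdd a i) = Fin.natAdd b (k i) := Fin.append_right _ _ _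

/-- The function that exchanges two blocks. -/
def Fin.blockSwap (a b : ℕ) : Fin (a + b) → Fin (b + a) :=
  Fin.append (Fin.natAdd b) (Fin.castAdd a)

@[simp] theorem Fin.blockSwap_castAdd {a b : ℕ} (i : Fin a) :
    Fin.blockSwap a b (Fin.castAdd b i) = Fin.natAdd b i := Fin.append_left _ _ _

@[simp] theorem Fin.blockSwap_natAdd {a b : ℕ} (i : Fin b) :
    Fin.blockSwap a b (Fin.natAdd a i) = Fin.castAdd a i := Fin.append_right _ _ _

namespace PROP.CommMonoidStr

open MonoidalCategory MonObj

attribute [local instance] MonObj.tensorObj.instTensorObj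

variable {P : PROP.{u}} (A : P.CommMonoidStr)

theorem pow_one : A.pow 1 = A.monObj :=
  MonObj.eq_of_isMonHom_id (X := (⟨1⟩ : P.Obj))
    (@IsMonHom.mk P.Obj _ _ _ _ (MonObj.tensor (A.pow 0) A.monObj) A.monObj
      (λ_ (⟨1⟩ : P.Obj)).hom (@one_leftUnitor P.Obj _ _ ⟨1⟩ A.monObj)
      (@mul_leftUnitor P.Obj _ _ _ ⟨1⟩ A.monObj))

/-- The object `n` of the PROP, equipped with the power of the commutative monoid. -/
def obj (_ : P.CommMonoidStr) (n : ℕ) : P.Obj := ⟨n⟩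

instance (n : ℕ) : MonObj (A.obj n) := A.pow n

instance (n : ℕ) : IsCommMonObj (A.obj n) := A.isCommMonObj_pow n

/-- `pow_add` is only a propositional equality of structures on one object. This lemma and the next
two carry the homomorphism property along it. -/
theorem isMonHom_of_tensor {n m : ℕ} {Z : P.Obj} [i : MonObj Z] {f : A.obj n ⊗ A.obj m ⟶ Z}
    (h : IsMonHom f) : IsMonHom (M := A.obj (n + m)) f := by
  have e := A.pow_add n m
  change @IsMonHom P.Obj _ _ ⟨n + m⟩ Z (A.pow (n + m)) i f
  rw [e]
  exact h

theorem isMonHom_to_tensor {n m : ℕ} {Z : P.Obj} [i : MonObj Z] {f : Z ⟶ A.obj n ⊗ A.obj m}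
    (h : IsMonHom f) : IsMonHom (N := A.obj (n + m)) f := by
  have e := A.pow_add n m
  change @IsMonHom P.Obj _ _ Z ⟨n + m⟩ i (A.pow (n + m)) f
  rw [e]
  exact h

theorem isMonHom_tensor_of {n m : ℕ} {Z : P.Obj} [i : MonObj Z] {f : A.obj (n + m) ⟶ Z}
    (h : IsMonHom f) : IsMonHom (M := A.obj n ⊗ A.obj m) f := by
  have e := A.pow_add n m
  change @IsMonHom P.Obj _ _ ⟨n + m⟩ Z (A.pow (n + m)) i f at h
  rw [e] at h
  exact h

/-- The inclusion of the first block. -/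
def inl (n m : ℕ) : A.obj n ⟶ A.obj (n + m) := MonObj.inl (A.obj n) (A.obj m)

/-- The inclusion of the second block. -/
def inr (n m : ℕ) : A.obj m ⟶ A.obj (n + m) := MonObj.inr (A.obj n) (A.obj m)

instance (n m : ℕ) : IsMonHom (A.inl n m) :=
  A.isMonHom_to_tensor (inferInstanceAs (IsMonHom (MonObj.inl (A.obj n) (A.obj m))))

instance (n m : ℕ) : IsMonHom (A.inr n m) :=
  A.isMonHom_to_tensor (inferInstanceAs (IsMonHom (MonObj.inr (A.obj n) (A.obj m))))

theorem hom_ext_add {n m k : ℕ} {f g : A.obj (n + m) ⟶ A.obj k} (hf : IsMonHom f)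
    (hg : IsMonHom g) (hl : A.inl n m ≫ f = A.inl n m ≫ g) (hr : A.inr n m ≫ f = A.inr n m ≫ g) :
    f = g :=
  @MonObj.tensor_hom_ext P.Obj _ _ (A.obj n) (A.obj m) (A.obj k) _ _ _ _ f g
    (A.isMonHom_tensor_of hf) (A.isMonHom_tensor_of hg) hl hr

/-- The arrow `1 ⟶ n` given by an element of `n`. -/
def elem : {n : ℕ} → Fin n → (A.obj 1 ⟶ A.obj n)
  | 0, i => i.elim0
  | n + 1, i => Fin.lastCases (motive := fun _ => A.obj 1 ⟶ A.obj (n + 1)) (A.inr n 1)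
      (fun j => elem j ≫ A.inl n 1) i

theorem elem_last (n : ℕ) : A.elem (Fin.last n) = A.inr n 1 := by
  rw [elem]; exact Fin.lastCases_last ..

theorem elem_castSucc {n : ℕ} (i : Fin n) : A.elem i.castSucc = A.elem i ≫ A.inl n 1 := by
  rw [elem]; exact Fin.lastCases_castSucc ..

/-- The arrow `a ⟶ b` given by a function between finite ordinals. -/
def pushObj : {a b : ℕ} → (Fin a → Fin b) → (A.obj a ⟶ A.obj b)
  | 0, b, _ => η[A.obj b]
  | a + 1, _, h => MonObj.copair (X := A.obj a) (Y := A.obj 1) (pushObj fun i => h i.castSucc)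
      (A.elem (h (Fin.last a)))

instance isMonHom_elem {n : ℕ} (i : Fin n) : IsMonHom (A.elem i) := by
  induction n with
  | zero => exact i.elim0
  | succ n ih =>
    refine Fin.lastCases ?_ (fun j => ?_) i
    · rw [elem_last]; infer_instance
    · rw [elem_castSucc]; have := ih j; infer_instance

instance isMonHom_pushObj {a b : ℕ} (h : Fin a → Fin b) : IsMonHom (A.pushObj h) := by
  induction a with
  | zero => exact MonObj.isMonHom_one (A.obj b)
  | succ a ih =>
    have := ih (fun i => h i.castSucc)
    exact A.isMonHom_of_tensor (inferInstanceAs (IsMonHom (MonObj.copair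
      (A.pushObj fun i => h i.castSucc) (A.elem (h (Fin.last a))))))

theorem elem_pushObj {a b : ℕ} (h : Fin a → Fin b) (i : Fin a) :
    A.elem i ≫ A.pushObj h = A.elem (h i) := by
  induction a with
  | zero => exact i.elim0
  | succ a ih =>
    refine Fin.lastCases ?_ (fun j => ?_) i
    · rw [elem_last]
      exact MonObj.inr_copair (A.pushObj fun i => h i.castSucc) (A.elem (h (Fin.last a)))
    · rw [elem_castSucc, Category.assoc, ← ih (fun i => h i.castSucc)]
      exact congrArg _ (MonObj.inl_copair (A.pushObj fun i => h i.castSucc)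
        (A.elem (h (Fin.last a))))

/-- The object `n` is an `n`-fold coproduct of `1` among commutative monoids, with the arrows `elem
i` as coprojections. The laws of `push` are checked on these. -/
theorem hom_ext {a b : ℕ} {f g : A.obj a ⟶ A.obj b} (hf : IsMonHom f) (hg : IsMonHom g)
    (h : ∀ i, A.elem i ≫ f = A.elem i ≫ g) : f = g := by
  induction a with
  | zero =>
    have h₁ := hf.one_hom
    rw [← hg.one_hom] at h₁
    exact (Category.id_comp f).symm.trans (h₁.trans (Category.id_comp g))
  | succ a ih =>
    refine A.hom_ext_add hf hg (ih inferInstance inferInstance fun i => ?_) ?_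
    · simpa only [elem_castSucc, Category.assoc] using h i.castSucc
    · simpa only [elem_last] using h (Fin.last a)

theorem inl_zero (n : ℕ) : A.inl n 0 = 𝟙 (A.obj n) := by
  refine (Category.id_comp _).trans ?_
  exact P.tensor_id n 0

theorem one_add (n m : ℕ) : η[A.obj (n + m)] = η[A.obj n ⊗ A.obj m] :=
  congrArg (fun i => @MonObj.one P.Obj _ _ _ i) (A.pow_add n m)

theorem comp_associator {n m : ℕ} {Z : P.Obj} (f : Z ⟶ (A.obj n ⊗ A.obj m) ⊗ A.obj 1) :
    f ≫ (α_ (A.obj n) (A.obj m) (A.obj 1)).hom = f :=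
  P.comp_id f

theorem inl_inl (n m : ℕ) : A.inl n m ≫ A.inl (n + m) 1 = A.inl n (m + 1) := by
  have h := MonObj.inl_inl_associator (A.obj n) (A.obj m) (A.obj 1)
  rw [show MonObj.inl (A.obj n) (A.obj m ⊗ A.obj 1) = A.inl n (m + 1) from
    congrArg (fun e : 𝟙_ P.Obj ⟶ A.obj m ⊗ A.obj 1 => (ρ_ (A.obj n)).inv ≫ A.obj n ◁ e)
      (A.one_add m 1).symm] at h
  refine Eq.trans ?_ h
  rw [comp_associator]
  rfl

theorem inr_inl (n m : ℕ) : A.inr n m ≫ A.inl (n + m) 1 = A.inl m 1 ≫ A.inr n (m + 1) := by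
  have h := MonObj.inr_inl_associator (A.obj n) (A.obj m) (A.obj 1)
  refine Eq.trans ?_ h
  rw [comp_associator]
  rfl

theorem inr_add (n m : ℕ) : A.inr (n + m) 1 = A.inr m 1 ≫ A.inr n (m + 1) := by
  have h := MonObj.inr_associator (A.obj n) (A.obj m) (A.obj 1)
  rw [show MonObj.inr (A.obj n ⊗ A.obj m) (A.obj 1) = A.inr (n + m) 1 from
    congrArg (fun e : 𝟙_ P.Obj ⟶ A.obj n ⊗ A.obj m => (λ_ (A.obj 1)).inv ≫ e ▷ A.obj 1)
      (A.one_add n m).symm] at h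
  exact (A.comp_associator (A.inr (n + m) 1)).symm.trans h

theorem elem_castAdd {n : ℕ} (m : ℕ) (i : Fin n) :
    A.elem (Fin.castAdd m i) = A.elem i ≫ A.inl n m := by
  induction m with
  | zero => rw [inl_zero, Category.comp_id]; rfl
  | succ m ih =>
    refine (A.elem_castSucc (Fin.castAdd m i)).trans ?_
    rw [ih, Category.assoc, inl_inl]

theorem elem_natAdd (n : ℕ) {m : ℕ} (i : Fin m) :
    A.elem (Fin.natAdd n i) = A.elem i ≫ A.inr n m := by
  induction m with
  | zero => exact i.elim0
  | succ m ih =>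
    refine Fin.lastCases ?_ (fun j => ?_) i
    · rw [elem_last, ← inr_add]
      exact A.elem_last (n + m)
    · rw [elem_castSucc, Category.assoc, ← inr_inl, ← Category.assoc, ← ih]
      exact A.elem_castSucc (Fin.natAdd n j)

/-- The arrow `a ⟶ b` of a PROP with a commutative monoid that is given by a function between
finite ordinals. -/
def push {a b : ℕ} (h : Fin a → Fin b) : P.Hom a b := A.pushObj h

theorem push_id (n : ℕ) : A.push (fun i : Fin n => i) = P.id n :=
  A.hom_ext (a := n) (b := n) (A.isMonHom_pushObj _) (inferInstanceAs (IsMonHom (𝟙 (A.obj n))))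
    fun i => (A.elem_pushObj _ i).trans (Category.comp_id _).symm

theorem push_comp {a b c : ℕ} (h : Fin a → Fin b) (k : Fin b → Fin c) :
    P.comp (A.push h) (A.push k) = A.push (fun i => k (h i)) :=
  A.hom_ext (a := a) (b := c) (inferInstanceAs (IsMonHom (A.pushObj h ≫ A.pushObj k)))
    (A.isMonHom_pushObj _) fun i => by
      have h₁ := A.elem_pushObj (fun i => k (h i)) i
      rw [← A.elem_pushObj k, ← A.elem_pushObj h, Category.assoc] at h₁
      exact h₁.symm

theorem tensor_push {a b c d : ℕ} (h : Fin a → Fin b) (k : Fin c → Fin d) :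
    P.tensor (A.push h) (A.push k) = A.push (Fin.sumMap h k) := by
  refine A.hom_ext (a := a + c) (b := b + d) (A.isMonHom_of_tensor (A.isMonHom_to_tensor
    (inferInstanceAs (IsMonHom (A.pushObj h ⊗ₘ A.pushObj k))))) (A.isMonHom_pushObj _) fun i => ?_
  refine ((?_ : _ = A.elem (Fin.sumMap h k i))).trans (A.elem_pushObj (Fin.sumMap h k) i).symm
  refine Fin.addCases (fun i => ?_) (fun i => ?_) i
  · rw [Fin.sumMap_castAdd, elem_castAdd, elem_castAdd, ← A.elem_pushObj, Category.assoc]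
    exact (Category.assoc (A.elem i) (A.inl a c) (A.pushObj h ⊗ₘ A.pushObj k)).trans
      (congrArg _ (MonObj.inl_tensorHom (A.pushObj h) (A.pushObj k)))
  · rw [Fin.sumMap_natAdd, elem_natAdd, elem_natAdd, ← A.elem_pushObj, Category.assoc]
    exact (Category.assoc (A.elem i) (A.inr a c) (A.pushObj h ⊗ₘ A.pushObj k)).trans
      (congrArg _ (MonObj.inr_tensorHom (A.pushObj h) (A.pushObj k)))

theorem push_blockSwap (a b : ℕ) : A.push (Fin.blockSwap a b) = P.symm a b := by
  refine A.hom_ext (a := a + b) (b := b + a) (A.isMonHom_pushObj _) (A.isMonHom_of_tensor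
    (A.isMonHom_to_tensor (MonObj.isMonHom_braiding (X := A.obj a) (Y := A.obj b)))) fun i => ?_
  refine (A.elem_pushObj (Fin.blockSwap a b) i).trans ?_
  refine Fin.addCases (fun i => ?_) (fun i => ?_) i
  · rw [Fin.blockSwap_castAdd, elem_castAdd, elem_natAdd]
    exact ((Category.assoc (A.elem i) (A.inl a b) (β_ (A.obj a) (A.obj b)).hom).trans
      (congrArg _ (MonObj.inl_braiding (A.obj a) (A.obj b)))).symm
  · rw [Fin.blockSwap_natAdd, elem_castAdd, elem_natAdd]
    exact ((Category.assoc (A.elem i) (A.inr a b) (β_ (A.obj a) (A.obj b)).hom).trans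
      (congrArg _ (MonObj.inr_braiding (A.obj a) (A.obj b)))).symm

/-- Together with `push_blockSwap` and `tensor_push` this brings structural arrows into the form
`push`, so that an equation between them becomes an equation between functions. -/
theorem eqHom_eq_push {a b : ℕ} (h : a = b) : P.eqHom h = A.push (Fin.cast h) := by
  subst h
  exact (A.push_id a).symm

theorem push_one (h : Fin 0 → Fin 1) : A.push h = A.one :=
  congrArg (fun i => @MonObj.one P.Obj _ _ _ i) A.pow_one

/-- The multiplication of a commutative monoid is a homomorphism, and along both coprojections it
restricts to the identity, as `push h` does. -/
theorem push_two (h : Fin 2 → Fin 1) : A.push h = A.mul := by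
  have hm : A.mul = μ[A.obj 1] :=
    (congrArg (fun i => @MonObj.mul P.Obj _ _ _ i) A.pow_one).symm
  rw [hm]
  refine A.hom_ext (a := 2) (b := 1) (A.isMonHom_pushObj _)
    (A.isMonHom_of_tensor (n := 1) (m := 1) (MonObj.isMonHom_mul (A.obj 1))) fun i => ?_
  have h₁ : ∀ j, A.elem (n := 1) j = 𝟙 (A.obj 1) := fun j => by
    rw [Subsingleton.elim j (Fin.last 0), elem_last]
    exact (Category.id_comp _).trans (P.tensor_id 0 1)
  have hc : MonObj.copair (𝟙 (A.obj 1)) (𝟙 (A.obj 1)) = μ[A.obj 1] := by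
    simp [MonObj.copair]
  refine (A.elem_pushObj h i).trans ((h₁ _).trans ?_)
  refine Fin.addCases (m := 1) (n := 1) (fun i => ?_) (fun i => ?_) i
  · rw [elem_castAdd, h₁, ← hc, Category.id_comp]
    exact (MonObj.inl_copair (𝟙 (A.obj 1)) (𝟙 (A.obj 1))).symm
  · rw [elem_natAdd, h₁, ← hc, Category.id_comp]
    exact (MonObj.inr_copair (𝟙 (A.obj 1)) (𝟙 (A.obj 1))).symm

end PROP.CommMonoidStr

/-! ### Functions between finite ordinals -/

namespace Fin

/-- Reduces identities between functions glued from blocks to a case distinction in arithmetic. -/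
theorem append_val {a b k : ℕ} (f : Fin a → Fin k) (g : Fin b → Fin k) (F G : ℕ → ℕ)
    (hf : ∀ i, (f i).val = F i) (hg : ∀ i, (g i).val = G i) (i : Fin (a + b)) :
    (append f g i).val = if i.val < a then F i else G (i - a) := by
  refine addCases (fun i => ?_) (fun i => ?_) i
  · rw [append_left, hf, if_pos (by simp)]; rfl
  · rw [append_right, hg, if_neg (by simp)]; simp

/-- The exchange of the two middle blocks out of four. -/
def middleSwap (a b c d : ℕ) : Fin ((a + b) + (c + d)) → Fin ((a + c) + (b + d)) :=
  append (append (fun i => castAdd (b + d) (castAdd c i)) (fun i => natAdd (a + c) (castAdd d i)))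
    (append (fun i => castAdd (b + d) (natAdd a i)) (fun i => natAdd (a + c) (natAdd b i)))

theorem cast_assoc_left {a : ℕ} (b c : ℕ) (i : Fin a) (h : a + b + c = a + (b + c)) :
    Fin.cast h (castAdd c (castAdd b i)) = castAdd (b + c) i := rfl

theorem cast_assoc_middle (a : ℕ) {b : ℕ} (c : ℕ) (i : Fin b) (h : a + b + c = a + (b + c)) :
    Fin.cast h (castAdd c (natAdd a i)) = natAdd a (castAdd c i) := rfl

theorem cast_assoc_right (a b : ℕ) {c : ℕ} (i : Fin c) (h : a + b + c = a + (b + c)) :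
    Fin.cast h (natAdd (a + b) i) = natAdd a (natAdd b i) := Fin.ext (Nat.add_assoc ..)

theorem cast_assoc_symm_left {a : ℕ} (b c : ℕ) (i : Fin a) (h : a + (b + c) = a + b + c) :
    Fin.cast h (castAdd (b + c) i) = castAdd c (castAdd b i) := rfl

theorem cast_assoc_symm_middle (a : ℕ) {b : ℕ} (c : ℕ) (i : Fin b) (h : a + (b + c) = a + b + c) :
    Fin.cast h (natAdd a (castAdd c i)) = castAdd c (natAdd a i) := rfl

theorem cast_assoc_symm_right (a b : ℕ) {c : ℕ} (i : Fin c) (h : a + (b + c) = a + b + c) :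
    Fin.cast h (natAdd a (natAdd b i)) = natAdd (a + b) i := Fin.ext (Nat.add_assoc ..).symm

/-- Functions out of a sum of finite ordinals are equal when they agree on both blocks. -/
theorem funext_add {a b : ℕ} {α : Sort*} {f g : Fin (a + b) → α}
    (hl : ∀ i, f (castAdd b i) = g (castAdd b i)) (hr : ∀ i, f (natAdd a i) = g (natAdd a i)) :
    f = g :=
  funext fun i => addCases hl hr i

/-- The function `n + 1 → n` that is the identity on the first block and `j` at the last element. -/
def insertLast {n : ℕ} (j : Fin n) : Fin (n + 1) → Fin n := append (fun i => i) (fun _ => j)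

/-- Functions between finite ordinals are generated, under composition and disjoint sums, by
the identities, the transposition of two elements, and the functions `2 → 1` and `0 → 1`. -/
theorem map_induction {C : ∀ {a b : ℕ}, (Fin a → Fin b) → Prop}
    (id : ∀ n, C (fun i : Fin n => i))
    (comp : ∀ {a b c : ℕ} {h : Fin a → Fin b} {k : Fin b → Fin c}, C h → C k → C (fun i => k (h i)))
    (sum : ∀ {a b c d : ℕ} {h : Fin a → Fin b} {k : Fin c → Fin d}, C h → C k → C (sumMap h k))
    (swap : C (blockSwap 1 1)) (mul : ∀ h : Fin 2 → Fin 1, C h) (unit : ∀ h : Fin 0 → Fin 1, C h)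
    {a b : ℕ} (h : Fin a → Fin b) : C h := by
  -- If `j` is the last point of the first block, this is `2 → 1` beside an identity. Otherwise the
  -- last two points are exchanged, the first block and its new last point are handled by induction,
  -- and the final point is kept.
  have hins : ∀ {n : ℕ} (j : Fin n), C (insertLast j) := by
    intro n j
    induction n with
    | zero => exact j.elim0
    | succ n ih =>
      refine lastCases ?_ (fun j => ?_) j
      · have e : insertLast (last n) = sumMap (fun i : Fin n => i) (fun _ : Fin 2 => (0 : Fin 1)) := by
          refine funext fun i => Fin.ext ?_
          rw [insertLast, append_val (fun i => i) (fun _ => last n) (fun i => i) (fun _ => n)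
            (fun _ => rfl) (fun _ => rfl), sumMap, append_val (fun i => castAdd 1 i)
            (fun i => natAdd n 0) (fun i => i) (fun _ => n) (fun _ => rfl) (fun _ => rfl)]
          have := i.isLt
          split_ifs <;> omega
        rw [e]
        exact sum (id n) (mul _)
      · have e : insertLast j.castSucc = fun i : Fin (n + 1 + 1) => sumMap (insertLast j) (fun i : Fin 1 => i)
            (sumMap (b := n) (fun i => i) (blockSwap 1 1) i) := by
          refine funext fun i => Fin.ext ?_
          have h₁ := append_val (k := n + 1 + 1) (fun i => castAdd 2 i) (fun i => natAdd n (blockSwap 1 1 i))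
            (fun i => i) (fun i => n + if i < 1 then 1 + i else i - 1) (fun _ => rfl)
            (fun i => congrArg (n + ·) (append_val (natAdd 1) (castAdd 1) (fun i => 1 + i)
              (fun i => i) (fun _ => rfl) (fun _ => rfl) i)) i
          have h₂ := append_val (fun i => castAdd 1 (insertLast j i)) (fun i => natAdd n i)
            (fun i => if i < n then i else j) (fun i => n + i)
            (fun i => append_val _ _ (fun i => i) (fun _ => j) (fun _ => rfl) (fun _ => rfl) i)
            (fun _ => rfl) (sumMap (b := n) (fun i => i) (blockSwap 1 1) i)
          refine Eq.trans ?_ h₂.symm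
          refine Eq.trans ?_ (congrArg (fun v => if v < n + 1 then if v < n then v else j.val
            else n + (v - (n + 1))) h₁).symm
          rw [insertLast, append_val (fun i => i) (fun _ => j.castSucc) (fun i => i) (fun _ => j)
            (fun _ => rfl) (fun _ => rfl)]
          have := i.isLt
          have := j.isLt
          split_ifs <;> omega
        rw [e]
        exact comp (sum (id n) swap) (sum (ih j) (id 1))
  have hzero : ∀ {n : ℕ} (h : Fin 0 → Fin n), C h := by
    intro n
    induction n with
    | zero =>
      intro h
      rw [show h = fun i => i from funext fun i => i.elim0]
      exact id 0
    | succ n ih =>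
      intro h
      rw [show h = sumMap (fun i => i.elim0 : Fin 0 → Fin n) (fun i => i.elim0 : Fin 0 → Fin 1) from
        funext fun i => i.elim0]
      exact sum (ih _) (unit _)
  induction a with
  | zero => exact hzero h
  | succ a ih =>
    -- The last point is first kept apart in an additional position, which is then merged with `h
    -- (last a)`.
    have e : h = fun i => insertLast (h (last a)) (sumMap (fun i => h i.castSucc)
        (fun i : Fin 1 => i) i) := by
      refine funext_add (a := a) (b := 1) (fun i => ?_) fun i => ?_
      · rw [sumMap_castAdd]
        exact (append_left (fun i => i) (fun _ => h (last a)) (h i.castSucc)).symm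
      · rw [sumMap_natAdd]
        refine Eq.trans (congrArg h ?_) (append_right (fun i => i) (fun _ => h (last a)) i).symm
        exact Fin.ext (by simp)
    rw [e]
    exact comp (sum (ih _) (id 1)) (hins _)

end Fin

/-! ### Opposite PROPs, block exchanges and special Frobenius monoids -/

namespace PROP

variable (P : PROP.{u})

/-- The data of the opposite of a PROP. -/
def opData : PROPData.{u} where
  Hom n m := P.Hom m n
  id n := P.id n
  comp f g := P.comp g f
  tensor f g := P.tensor f g
  symm n m := P.symm m n

theorem opData_eqHom {n m : ℕ} (h : n = m) : P.opData.eqHom h = P.eqHom h.symm := by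
  subst h; rfl

/-- The strict laws are squares with `eqHom` on two sides; in the opposite PROP the same square is
read with the inverse casts. -/
theorem eqHom_comp_of_comp_eqHom {a a' b b' : ℕ} (h : a = a') (h' : b = b') {f : P.Hom a b}
    {g : P.Hom a' b'} (e : P.comp f (P.eqHom h') = P.comp (P.eqHom h) g) :
    P.comp (P.eqHom h.symm) f = P.comp g (P.eqHom h'.symm) := by
  subst h h'
  rw [eqHom_rfl, eqHom_rfl, P.comp_id, P.id_comp] at e
  rw [eqHom_rfl, eqHom_rfl, P.comp_id, P.id_comp, e]

-- The opposite PROP has reversed symmetries, so its law `symm_add` is a decomposition in the second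
-- argument here. This is the other hexagon.
open MonoidalCategory in
theorem symm_add_right (k n m : ℕ) :
    P.symm k (n + m) = P.comp (P.comp (P.comp (P.comp (P.eqHom (Nat.add_assoc k n m).symm)
      (P.tensor (P.symm k n) (P.id m))) (P.eqHom (Nat.add_assoc n k m)))
        (P.tensor (P.id n) (P.symm k m))) (P.eqHom (Nat.add_assoc n m k).symm) := by
  have h := BraidedCategory.braiding_tensor_right_hom (⟨k⟩ : P.Obj) ⟨n⟩ ⟨m⟩
  simp only [← Category.assoc] at h
  exact h

/-- The opposite of a PROP. -/
def op : PROP.{u} where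
  toPROPData := P.opData
  id_comp f := P.comp_id f
  comp_id f := P.id_comp f
  comp_assoc f g h := (P.comp_assoc h g f).symm
  tensor_id := P.tensor_id
  tensor_comp f g f' g' := P.tensor_comp g f g' f'
  tensor_assoc f g h := by
    rw [opData_eqHom, opData_eqHom]
    exact P.eqHom_comp_of_comp_eqHom _ _ (P.tensor_assoc f g h)
  id_zero_tensor f := by
    rw [opData_eqHom, opData_eqHom]
    exact P.eqHom_comp_of_comp_eqHom _ _ (P.id_zero_tensor f)
  tensor_id_zero f := P.tensor_id_zero f
  symm_symm n m := P.symm_symm n m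
  symm_naturality f g := (P.symm_naturality g f).symm
  symm_add n m k := by
    rw [opData_eqHom, opData_eqHom, opData_eqHom]
    exact P.symm_add_right k n m

namespace CommMonoidStr

open MonoidalCategory

variable {P} (A : P.CommMonoidStr)

/-- Through `tensorμ` the exchange of blocks becomes natural with respect to arbitrary arrows, not
only those of the form `push`. -/
theorem push_middleSwap (a b c d : ℕ) :
    A.push (Fin.middleSwap a b c d) = tensorμ (⟨a⟩ : P.Obj) ⟨b⟩ ⟨c⟩ ⟨d⟩ := by
  change _ = P.comp (P.eqHom (Nat.add_assoc a b (c + d))) (P.comp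
    (P.tensor (P.id a) (P.eqHom (Nat.add_assoc b c d).symm))
    (P.comp (P.tensor (P.id a) (P.tensor (P.symm b c) (P.id d)))
      (P.comp (P.tensor (P.id a) (P.eqHom (Nat.add_assoc c b d)))
        (P.eqHom (Nat.add_assoc a c (b + d)).symm))))
  simp only [A.eqHom_eq_push, ← A.push_blockSwap, ← A.push_id, A.tensor_push, A.push_comp]
  congr 1
  refine Fin.funext_add (funext_iff.1 (Fin.funext_add (fun i => ?_) fun i => ?_))
    (funext_iff.1 (Fin.funext_add (fun i => ?_) fun i => ?_))
  all_goals simp only [Fin.middleSwap, Fin.append_left, Fin.append_right, Fin.cast_assoc_left,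
    Fin.cast_assoc_middle, Fin.cast_assoc_right, Fin.cast_assoc_symm_left,
    Fin.cast_assoc_symm_middle, Fin.cast_assoc_symm_right, Fin.sumMap_castAdd, Fin.sumMap_natAdd,
    Fin.blockSwap_castAdd, Fin.blockSwap_natAdd]

/-- The exchange of the two middle blocks is natural in all four blocks. -/
theorem middleSwap_naturality {a b c d a' b' c' d' : ℕ} (f : P.Hom a a') (g : P.Hom b b')
    (h : P.Hom c c') (k : P.Hom d d') :
    P.comp (P.tensor (P.tensor f g) (P.tensor h k)) (A.push (Fin.middleSwap a' b' c' d')) =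
      P.comp (A.push (Fin.middleSwap a b c d)) (P.tensor (P.tensor f h) (P.tensor g k)) := by
  rw [push_middleSwap, push_middleSwap]
  exact tensorμ_natural (X₁ := (⟨a⟩ : P.Obj)) (X₂ := (⟨b⟩ : P.Obj)) (U₁ := (⟨c⟩ : P.Obj))
    (U₂ := (⟨d⟩ : P.Obj)) (Y₁ := (⟨a'⟩ : P.Obj)) (Y₂ := (⟨b'⟩ : P.Obj)) (V₁ := (⟨c'⟩ : P.Obj))
    (V₂ := (⟨d'⟩ : P.Obj)) f g h k

end CommMonoidStr

/-- A special Frobenius monoid in a PROP, with underlying object `1`. -/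
structure FrobeniusStr where
  mul : P.Hom 2 1
  one : P.Hom 0 1
  comul : P.Hom 1 2
  counit : P.Hom 1 0
  mul_comm : P.comp (P.symm 1 1) mul = mul
  mul_assoc : P.comp (P.tensor mul (P.id 1)) mul = P.comp (P.tensor (P.id 1) mul) mul
  one_mul : P.comp (P.tensor one (P.id 1)) mul = P.id 1
  mul_one : P.comp (P.tensor (P.id 1) one) mul = P.id 1
  comul_comm : P.comp comul (P.symm 1 1) = comul
  comul_assoc : P.comp comul (P.tensor comul (P.id 1)) = P.comp comul (P.tensor (P.id 1) comul)
  counit_comul : P.comp comul (P.tensor counit (P.id 1)) = P.id 1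
  comul_counit : P.comp comul (P.tensor (P.id 1) counit) = P.id 1
  frob_left : P.comp (b := 3) (P.tensor comul (P.id 1)) (P.tensor (a := 1) (c := 2) (P.id 1) mul) =
    P.comp (a := 2) (c := 2) mul comul
  frob_right : P.comp (b := 3) (P.tensor (P.id 1) comul) (P.tensor (a := 2) (c := 1) mul (P.id 1)) =
    P.comp (a := 2) (c := 2) mul comul
  special : P.comp comul mul = P.id 1

namespace FrobeniusStr

variable {P} (A : P.FrobeniusStr)

/-- The commutative monoid of a special Frobenius monoid. -/
def monoidStr : P.CommMonoidStr where
  mul := A.mul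
  one := A.one
  one_mul := A.one_mul
  mul_one := A.mul_one
  mul_assoc := A.mul_assoc
  mul_comm := A.mul_comm

/-- The cocommutative comonoid of a special Frobenius monoid. -/
def comonoidStr : P.op.CommMonoidStr where
  mul := A.comul
  one := A.counit
  one_mul := A.counit_comul
  mul_one := A.comul_counit
  mul_assoc := A.comul_assoc
  mul_comm := A.comul_comm

/-- The arrow `a ⟶ b` given by a function `a → b`. -/
def push {a b : ℕ} (h : Fin a → Fin b) : P.Hom a b := A.monoidStr.push h

/-- The arrow `b ⟶ a` given by a function `a → b`. -/
def pull {a b : ℕ} (h : Fin a → Fin b) : P.Hom b a := A.comonoidStr.push h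

theorem push_id (n : ℕ) : A.push (fun i : Fin n => i) = P.id n := A.monoidStr.push_id n

theorem pull_id (n : ℕ) : A.pull (fun i : Fin n => i) = P.id n := A.comonoidStr.push_id n

theorem push_comp {a b c : ℕ} (h : Fin a → Fin b) (k : Fin b → Fin c) :
    P.comp (A.push h) (A.push k) = A.push (fun i => k (h i)) := A.monoidStr.push_comp h k

theorem pull_comp {a b c : ℕ} (h : Fin a → Fin b) (k : Fin b → Fin c) :
    P.comp (A.pull k) (A.pull h) = A.pull (fun i => k (h i)) := A.comonoidStr.push_comp h k

theorem tensor_push {a b c d : ℕ} (h : Fin a → Fin b) (k : Fin c → Fin d) :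
    P.tensor (A.push h) (A.push k) = A.push (Fin.sumMap h k) := A.monoidStr.tensor_push h k

theorem tensor_pull {a b c d : ℕ} (h : Fin a → Fin b) (k : Fin c → Fin d) :
    P.tensor (A.pull h) (A.pull k) = A.pull (Fin.sumMap h k) := A.comonoidStr.tensor_push h k

theorem push_blockSwap (a b : ℕ) : A.push (Fin.blockSwap a b) = P.symm a b :=
  A.monoidStr.push_blockSwap a b

theorem pull_blockSwap (a b : ℕ) : A.pull (Fin.blockSwap a b) = P.symm b a :=
  A.comonoidStr.push_blockSwap a b

theorem eqHom_eq_push {a b : ℕ} (h : a = b) : P.eqHom h = A.push (Fin.cast h) :=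
  A.monoidStr.eqHom_eq_push h

theorem eqHom_eq_pull {a b : ℕ} (h : a = b) : P.eqHom h = A.pull (Fin.cast h.symm) :=
  (P.opData_eqHom h.symm).symm.trans (A.comonoidStr.eqHom_eq_push h.symm)

theorem push_zero_one (h : Fin 0 → Fin 1) : A.push h = A.one := A.monoidStr.push_one h

theorem pull_zero_one (h : Fin 0 → Fin 1) : A.pull h = A.counit := A.comonoidStr.push_one h

theorem push_two_one (h : Fin 2 → Fin 1) : A.push h = A.mul := A.monoidStr.push_two h

theorem pull_two_one (h : Fin 2 → Fin 1) : A.pull h = A.comul := A.comonoidStr.push_two h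

theorem middleSwap_naturality {a b c d a' b' c' d' : ℕ} (f : P.Hom a a') (g : P.Hom b b')
    (h : P.Hom c c') (k : P.Hom d d') :
    P.comp (P.tensor (P.tensor f g) (P.tensor h k)) (A.push (Fin.middleSwap a' b' c' d')) =
      P.comp (A.push (Fin.middleSwap a b c d)) (P.tensor (P.tensor f h) (P.tensor g k)) :=
  A.monoidStr.middleSwap_naturality f g h k

end FrobeniusStr

end PROP

/-! ### Codiagonals, the projection formula and permutations -/

namespace Fin

/-- The codiagonal function. -/
def fold (n : ℕ) : Fin (n + n) → Fin n := append (fun i => i) (fun i => i)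

@[simp] theorem fold_castAdd {n : ℕ} (i : Fin n) : fold n (castAdd n i) = i := append_left _ _ _

@[simp] theorem fold_natAdd {n : ℕ} (i : Fin n) : fold n (natAdd n i) = i := append_right _ _ _

/-- This makes the projection formula and multiplication by states compatible with disjoint sums. -/
theorem fold_add (n m : ℕ) :
    fold (n + m) = fun i => sumMap (fold n) (fold m) (middleSwap n m n m i) := by
  refine funext_add (funext_iff.1 (funext_add (fun i => ?_) fun i => ?_))
    (funext_iff.1 (funext_add (fun i => ?_) fun i => ?_))
  all_goals simp only [fold_castAdd, fold_natAdd, middleSwap, append_left, append_right,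
    sumMap_castAdd, sumMap_natAdd]

theorem sumMap_elim0_right {a b : ℕ} (c : ℕ) (h : Fin a → Fin b) (k : Fin 0 → Fin c) :
    sumMap h k = fun i => castAdd c (h i) :=
  funext fun i => append_left _ _ i

end Fin

namespace PROP.FrobeniusStr

variable {P : PROP.{u}} (A : P.FrobeniusStr)

theorem id_tensor_id_tensor {a b : ℕ} (n m : ℕ) (f : P.Hom a b) :
    P.comp (P.tensor (P.tensor f (P.id n)) (P.id m)) (P.eqHom (Nat.add_assoc b n m)) =
      P.comp (P.eqHom (Nat.add_assoc a n m)) (P.tensor f (P.id (n + m))) := by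
  rw [P.tensor_assoc, P.tensor_id]

/-- In Sweedler notation: `(a b₁ b₂)₍₁₎ ⊗ (a b₁ b₂)₍₂₎ = a₍₁₎ b₁ ⊗ a₍₂₎ b₂`. One Frobenius law moves
`b₂` into the second leg; the other, transported by commutativity, moves `b₁` into the first. -/
theorem push_mul_comp_pull_two (h : Fin 2 → Fin 1) :
    P.comp (P.tensor (P.id 1) (A.push h)) (P.comp (A.push (Fin.fold 1)) (A.pull h)) =
      P.comp (P.tensor (A.pull h) (P.id 2)) (A.push (Fin.fold 2)) := by
  have e₁ : P.comp (P.symm 1 1) (P.tensor (P.id 1) A.comul) =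
      P.comp (P.tensor A.comul (P.id 1)) (P.symm 2 1) := (P.symm_naturality _ _).symm
  have e₂ : P.comp (a := 2) (c := 2) A.mul A.comul = P.comp (P.tensor A.comul (P.id 1))
      (P.comp (P.symm 2 1) (P.tensor (a := 2) (c := 1) A.mul (P.id 1))) := by
    rw [← P.comp_assoc, ← e₁, P.comp_assoc, A.frob_right, ← P.comp_assoc, A.mul_comm]
  have e₃ : P.comp (a := 3) (c := 2) (P.comp (P.tensor (P.id 1) A.mul) A.mul) A.comul =
      P.comp (a := 3) (P.tensor (a := 2) (c := 1) (P.comp (a := 2) (c := 2) A.mul A.comul) (P.id 1))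
        (P.tensor (a := 1) (c := 2) (P.id 1) A.mul) := by
    rw [← A.mul_assoc, P.comp_assoc]
    refine (congrArg (P.comp (a := 3) (P.tensor (a := 2) (c := 1) A.mul (P.id 1)))
      A.frob_left.symm).trans ?_
    rw [← P.comp_assoc]
    refine congrArg (fun f => P.comp (a := 3) f (P.tensor (a := 1) (c := 2) (P.id 1) A.mul)) ?_
    rw [← P.tensor_comp (a := 2) (b := 1) (c := 2), P.id_comp]
  have e₅ : P.tensor (P.tensor A.comul (P.id 1)) (P.id 1) = P.tensor A.comul (P.id 2) := by
    have := id_tensor_id_tensor 1 1 A.comul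
    rwa [P.eqHom_rfl, P.eqHom_rfl, P.comp_id, P.id_comp] at this
  have e₆ : A.push (Fin.fold 1) = A.mul := A.push_two_one _
  have e₇ : ∀ f : P.Hom 3 2, P.tensor (P.comp (b := 3) (P.tensor A.comul (P.id 1)) f) (P.id 1) =
      P.comp (P.tensor A.comul (P.id 2)) (P.tensor (a := 3) f (P.id 1)) := fun f => by
    rw [← e₅]
    refine Eq.trans ?_ (P.tensor_comp (P.tensor A.comul (P.id 1)) f (P.id 1) (P.id 1))
    rw [P.id_comp]
  rw [A.push_two_one, A.pull_two_one, e₆, ← P.comp_assoc]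
  refine e₃.trans ?_
  rw [e₂, e₇, P.comp_assoc]
  refine congrArg _ ?_
  -- What follows the comultiplication consists of multiplications and symmetries, hence is a
  -- `push`, and two functions `4 → 2` are compared value by value.
  rw [← A.push_two_one (fun _ => 0), ← A.push_blockSwap]
  simp only [← A.push_id, A.tensor_push, A.push_comp]
  refine congrArg _ (funext ?_)
  decide

/-- The projection formula: `pull h` is linear over the codomain of `h`. -/
theorem push_fold_comp_pull {a b : ℕ} (h : Fin a → Fin b) :
    P.comp (P.tensor (P.id b) (A.push h)) (P.comp (A.push (Fin.fold b)) (A.pull h)) =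
      P.comp (P.tensor (A.pull h) (P.id a)) (A.push (Fin.fold a)) := by
  -- The formula reads `h^*(y · h_* x) = h^* y · x`. It is stable under composition and disjoint
  -- sums, so only the generating functions remain, and among these only `2 → 1` requires the
  -- Frobenius laws.
  refine Fin.map_induction (C := fun {a b} h => P.comp (P.tensor (P.id b) (A.push h))
    (P.comp (A.push (Fin.fold b)) (A.pull h)) =
      P.comp (P.tensor (A.pull h) (P.id a)) (A.push (Fin.fold a))) ?_ ?_ ?_ ?_ ?_ ?_ h
  · intro n
    rw [A.push_id, A.pull_id, P.comp_id]
  · intro a b c h k hh hk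
    rw [← A.push_comp, ← A.pull_comp, ← P.comp_assoc (A.push _)]
    nth_rw 1 [← P.id_comp (P.id c)]
    rw [P.tensor_comp, P.comp_assoc, ← P.comp_assoc (P.tensor _ (A.push k)), hk, P.comp_assoc,
      ← P.comp_assoc (P.tensor (P.id c) (A.push h)), ← P.tensor_comp, P.id_comp, P.comp_id]
    rw [← P.comp_id (A.pull k), ← P.id_comp (A.push h), P.tensor_comp, P.comp_assoc, hh,
      P.comp_id, ← P.comp_assoc, ← P.tensor_comp, P.id_comp]
  · intro a b c d h k hh hk
    rw [← A.tensor_push, ← A.tensor_pull, Fin.fold_add, Fin.fold_add,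
      ← A.push_comp (Fin.middleSwap b d b d), ← A.push_comp (Fin.middleSwap a c a c),
      ← A.tensor_push, ← A.tensor_push, P.comp_assoc, ← P.tensor_comp, ← P.tensor_id,
      ← P.comp_assoc, A.middleSwap_naturality, P.comp_assoc, ← P.tensor_comp, hh, hk,
      P.tensor_comp, ← P.comp_assoc, ← A.middleSwap_naturality, P.comp_assoc, P.tensor_id]
  · rw [A.pull_blockSwap, ← A.push_blockSwap]
    simp only [← A.push_id, A.tensor_push, A.push_comp]
    refine congrArg _ (funext ?_)
    decide
  · exact A.push_mul_comp_pull_two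
  · intro h
    rw [A.push_zero_one, A.pull_zero_one, ← P.comp_assoc, A.push_two_one]
    refine Eq.trans (congrArg (fun f => P.comp f A.counit) A.mul_one) ?_
    have e : A.push (Fin.fold 0) = P.id 0 := by
      rw [← A.push_id]
      exact congrArg _ (funext fun i => i.elim0)
    rw [e, P.comp_id, P.id_comp, P.tensor_id_zero]

/-- An adjacent transposition is the symmetry of `1` with itself placed between identities, and
`push` and `pull` both send `blockSwap 1 1` to `P.symm 1 1`. -/
theorem pull_swap_succ {n : ℕ} (i : Fin n) :
    A.pull (Equiv.swap i.castSucc i.succ) = A.push (Equiv.swap i.castSucc i.succ) := by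
  induction n with
  | zero => exact i.elim0
  | succ n ih =>
    refine Fin.lastCases ?_ (fun j => ?_) i
    · have e : (Equiv.swap (Fin.last n).castSucc (Fin.last n).succ : Fin (n + 1 + 1) → _) =
          Fin.sumMap (b := n) (fun i => i) (Fin.blockSwap 1 1) := by
        refine funext fun i => Fin.ext ?_
        have h₁ := Fin.append_val (k := n + 1 + 1) (fun i => Fin.castAdd 2 i)
            (fun i => Fin.natAdd n (Fin.blockSwap 1 1 i))
            (fun i => i) (fun i => n + if i < 1 then 1 + i else i - 1) (fun _ => rfl)
            (fun i => congrArg (n + ·) (Fin.append_val (Fin.natAdd 1) (Fin.castAdd 1)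
              (fun i => 1 + i) (fun i => i) (fun _ => rfl) (fun _ => rfl) i)) i
        refine Eq.trans ?_ h₁.symm
        have := i.isLt
        rw [Equiv.swap_apply_def]
        simp only [Fin.ext_iff, Fin.val_castSucc, Fin.val_last, Fin.val_succ]
        split_ifs <;> simp <;> omega
      rw [e]
      refine (A.tensor_pull _ _).symm.trans (Eq.trans ?_ (A.tensor_push _ _))
      rw [A.pull_id, A.push_id, A.push_blockSwap, A.pull_blockSwap]
    · have e : (Equiv.swap j.castSucc.castSucc j.castSucc.succ : Fin (n + 1 + 1) → _) =
          Fin.sumMap (Equiv.swap j.castSucc j.succ) (fun i : Fin 1 => i) := by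
        refine Fin.funext_add (fun i => ?_) fun i => ?_
        · rw [Fin.sumMap_castAdd, Equiv.swap_apply_def, Equiv.swap_apply_def]
          simp only [Fin.ext_iff, Fin.val_castSucc, Fin.val_succ, Fin.val_castAdd]
          split_ifs <;> simp
        · rw [Fin.sumMap_natAdd, Equiv.swap_apply_def]
          simp only [Fin.ext_iff, Fin.val_castSucc, Fin.val_succ, Fin.val_natAdd]
          have := j.isLt
          split_ifs <;> simp <;> omega
      rw [e, ← A.tensor_pull, ← A.tensor_push, ih, A.pull_id, A.push_id]

/-- Both sides reverse composition, so it suffices to treat the adjacent transpositions, which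
generate all permutations. -/
theorem pull_perm {n : ℕ} (σ : Equiv.Perm (Fin n)) : A.pull σ = A.push σ.symm := by
  cases n with
  | zero =>
    rw [show (σ : Fin 0 → Fin 0) = fun i => i from funext fun i => i.elim0,
      show (σ.symm : Fin 0 → Fin 0) = fun i => i from funext fun i => i.elim0, A.pull_id, A.push_id]
  | succ n =>
    have h : σ ∈ Submonoid.closure (Set.range fun i : Fin n => Equiv.swap i.castSucc i.succ) := by
      rw [Equiv.Perm.mclosure_swap_castSucc_succ]; trivial
    induction h using Submonoid.closure_induction with
    | mem σ hσ =>
      obtain ⟨i, rfl⟩ := hσ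
      rw [A.pull_swap_succ, Equiv.symm_swap]
    | one => exact (A.pull_id _).trans (A.push_id _).symm
    | mul σ τ _ _ hσ hτ =>
      refine (A.pull_comp τ σ).symm.trans ?_
      rw [hσ, hτ, A.push_comp]
      rfl

/-- For a bijection the two associated arrows are mutually inverse. -/
theorem pull_equiv {n m : ℕ} (σ : Fin n ≃ Fin m) : A.pull σ = A.push σ.symm := by
  obtain rfl : n = m := by simpa using Fintype.card_congr σ
  exact A.pull_perm σ

end PROP.FrobeniusStr

namespace PROP.FrobeniusStr

variable {P : PROP.{u}} (A : P.FrobeniusStr)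

/-! ### States -/

/-- The unit state. -/
def unitState (n : ℕ) : P.Hom 0 n := A.push (fun i : Fin 0 => i.elim0)

theorem push_zero {n : ℕ} (h : Fin 0 → Fin n) : A.push h = A.unitState n :=
  congrArg A.push (funext fun i => i.elim0)

/-- The product of states. -/
def mulState {n : ℕ} (x y : P.Hom 0 n) : P.Hom 0 n :=
  P.comp (a := 0) (P.tensor x y) (A.push (Fin.fold n))

/-- States are tensored on the right because `a + 0` is `a` by computation, whereas on the left
casts along `0 + a = a` would in general appear. -/
theorem tensor_zero {a b n : ℕ} (f : P.Hom a b) (x : P.Hom 0 n) :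
    P.tensor f x = P.comp (b := b) f (P.tensor (P.id b) x) := by
  rw [← P.tensor_id_zero f, ← P.tensor_comp, P.comp_id, P.id_comp, P.tensor_id_zero]

theorem tensor_zero' {a b n : ℕ} (f : P.Hom a b) (x : P.Hom 0 n) :
    P.tensor f x = P.comp (a := a) (P.tensor (P.id a) x) (P.tensor f (P.id n)) := by
  rw [← P.tensor_comp, P.comp_id, P.id_comp]

theorem tensor_tensor_zero {a b n m : ℕ} (f : P.Hom a b) (x : P.Hom 0 n) (y : P.Hom 0 m) :
    P.comp (a := a) (P.tensor (P.tensor f x) y) (A.push (Fin.cast (Nat.add_assoc b n m))) =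
      P.tensor f (P.tensor x y) := by
  rw [← A.eqHom_eq_push, P.tensor_assoc]
  exact P.id_comp _

theorem mulState_assoc {n : ℕ} (x y z : P.Hom 0 n) :
    A.mulState (A.mulState x y) z = A.mulState x (A.mulState y z) := by
  have h₁ : P.tensor (A.mulState x y) z = P.comp (a := 0) (P.tensor (P.tensor x y) z)
      (P.tensor (A.push (Fin.fold n)) (P.id n)) := by
    refine Eq.trans ?_ (P.tensor_comp ..)
    rw [P.comp_id]; rfl
  have h₂ : P.tensor x (A.mulState y z) = P.comp (a := 0) (P.tensor x (P.tensor y z))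
      (P.tensor (P.id n) (A.push (Fin.fold n))) := by
    refine Eq.trans ?_ (P.tensor_comp ..)
    rw [P.comp_id]; rfl
  change P.comp (a := 0) (P.tensor (A.mulState x y) z) _ =
    P.comp (a := 0) (P.tensor x (A.mulState y z)) _
  rw [h₁, h₂, ← A.tensor_tensor_zero, P.comp_assoc, P.comp_assoc, P.comp_assoc]
  simp only [← A.push_id, A.tensor_push, A.push_comp]
  refine congrArg (P.comp _) (congrArg _ (Fin.funext_add (funext_iff.1 (Fin.funext_add
    (fun i => ?_) fun i => ?_)) fun i => ?_))
  all_goals simp only [Fin.cast_assoc_left, Fin.cast_assoc_middle, Fin.cast_assoc_right,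
    Fin.sumMap_castAdd, Fin.sumMap_natAdd, Fin.fold_castAdd, Fin.fold_natAdd]

theorem mulState_comm {n : ℕ} (x y : P.Hom 0 n) : A.mulState x y = A.mulState y x := by
  have h := P.symm_naturality x y
  rw [← A.push_blockSwap, ← A.push_blockSwap, A.push_zero] at h
  have e : A.unitState 0 = P.id 0 := by
    rw [← A.push_id, ← A.push_zero]
  rw [mulState, mulState, ← P.id_comp (P.tensor y x), ← e]
  refine Eq.trans ?_ (congrArg (fun f => P.comp f _) h)
  rw [P.comp_assoc, A.push_comp]
  refine congrArg (P.comp _) (congrArg _ (Fin.funext_add (fun i => ?_) fun i => ?_))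
  all_goals simp only [Fin.blockSwap_castAdd, Fin.blockSwap_natAdd, Fin.fold_castAdd,
    Fin.fold_natAdd]

/-- The action of a state on the object `n`, by multiplication. -/
def smul {n : ℕ} (x : P.Hom 0 n) : P.Hom n n :=
  P.comp (a := n) (P.tensor (P.id n) x) (A.push (Fin.fold n))

theorem comp_smul {n : ℕ} (x y : P.Hom 0 n) : P.comp x (A.smul y) = A.mulState x y := by
  rw [smul, mulState, tensor_zero x y, P.comp_assoc]

theorem smul_unitState (n : ℕ) : A.smul (A.unitState n) = P.id n := by
  rw [smul, unitState, ← A.push_id, A.tensor_push, A.push_comp, Fin.sumMap_elim0_right]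
  exact congrArg _ (funext fun i => Fin.fold_castAdd i)

theorem mulState_unitState {n : ℕ} (x : P.Hom 0 n) : A.mulState x (A.unitState n) = x := by
  rw [← comp_smul, smul_unitState, P.comp_id]

theorem smul_mul {n : ℕ} (x y : P.Hom 0 n) :
    A.smul (A.mulState x y) = P.comp (A.smul x) (A.smul y) := by
  have h₁ : P.tensor (P.id n) (A.mulState x y) = P.comp (a := n) (P.tensor (P.id n) (P.tensor x y))
      (P.tensor (P.id n) (A.push (Fin.fold n))) := by
    refine Eq.trans ?_ (P.tensor_comp (P.id n) (P.id n) (P.tensor x y) (A.push (Fin.fold n)))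
    rw [P.comp_id]; rfl
  have h₂ : P.comp (A.push (Fin.fold n)) (P.tensor (P.id n) y) =
      P.comp (a := n + n) (P.tensor (a := n + n) (c := 0) (P.id (n + n)) y) (P.tensor (A.push (Fin.fold n)) (P.id n)) := by
    rw [← tensor_zero, tensor_zero']
  rw [smul, smul, smul, P.comp_assoc, ← P.comp_assoc (A.push _), h₂, ← P.comp_assoc, ← P.comp_assoc,
    ← tensor_zero, h₁, ← A.tensor_tensor_zero, P.comp_assoc, P.comp_assoc, P.comp_assoc]
  simp only [← A.push_id, A.tensor_push, A.push_comp]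
  refine congrArg (P.comp _) (congrArg _ (Fin.funext_add (funext_iff.1 (Fin.funext_add
    (fun i => ?_) fun i => ?_)) fun i => ?_))
  all_goals simp only [Fin.cast_assoc_left, Fin.cast_assoc_middle, Fin.cast_assoc_right,
    Fin.sumMap_castAdd, Fin.sumMap_natAdd, Fin.fold_castAdd, Fin.fold_natAdd]

theorem fold_push {n m : ℕ} (h : Fin n → Fin m) :
    P.comp (A.push (Fin.fold n)) (A.push h) =
      P.comp (P.tensor (A.push h) (A.push h)) (A.push (Fin.fold m)) := by
  rw [A.tensor_push, A.push_comp, A.push_comp]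
  refine congrArg _ (Fin.funext_add (fun i => ?_) fun i => ?_)
  all_goals simp only [Fin.sumMap_castAdd, Fin.sumMap_natAdd, Fin.fold_castAdd, Fin.fold_natAdd]

theorem mulState_push {n m : ℕ} (h : Fin n → Fin m) (x y : P.Hom 0 n) :
    P.comp (A.mulState x y) (A.push h) =
      A.mulState (P.comp x (A.push h)) (P.comp y (A.push h)) := by
  rw [mulState, mulState, P.tensor_comp, P.comp_assoc, P.comp_assoc, fold_push]

theorem unitState_push {n m : ℕ} (h : Fin n → Fin m) :
    P.comp (A.unitState n) (A.push h) = A.unitState m :=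
  (A.push_comp _ _).trans (A.push_zero _)

theorem smul_push {n m : ℕ} (h : Fin n → Fin m) (x : P.Hom 0 n) :
    P.comp (A.smul x) (A.push h) = P.comp (A.push h) (A.smul (P.comp x (A.push h))) := by
  rw [smul, smul, ← P.comp_assoc, ← tensor_zero, P.comp_assoc, fold_push, ← P.comp_assoc]
  refine congrArg (fun f => P.comp f _) ?_
  refine (P.tensor_comp _ _ _ _).symm.trans ?_
  rw [P.id_comp]

/-- The projection formula with the state `x` inserted in its second argument. -/
theorem smul_push_pull {n m : ℕ} (h : Fin n → Fin m) (x : P.Hom 0 n) :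
    P.comp (A.smul (P.comp x (A.push h))) (A.pull h) = P.comp (A.pull h) (A.smul x) := by
  have h₁ : P.tensor (P.id m) (P.comp x (A.push h)) =
      P.comp (a := m) (P.tensor (P.id m) x) (P.tensor (P.id m) (A.push h)) := by
    refine Eq.trans ?_ (P.tensor_comp ..)
    rw [P.comp_id]
  rw [smul, smul, ← P.comp_assoc, ← tensor_zero, h₁, P.comp_assoc, P.comp_assoc,
    A.push_fold_comp_pull, ← P.comp_assoc, ← tensor_zero']

/-- The projection formula with the unit state in its first argument. It reduces `push h` followed
by `pull h` to a single state, which `unitState_pull_of_coequalizer` computes for coequalizers. -/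
theorem push_pull {n m : ℕ} (h : Fin n → Fin m) :
    P.comp (A.push h) (A.pull h) = A.smul (P.comp (A.unitState m) (A.pull h)) := by
  have e := congrArg (fun f => P.comp (A.push (Fin.natAdd m)) f) (A.push_fold_comp_pull h)
  rw [← A.push_id, A.tensor_push, ← P.comp_assoc, ← P.comp_assoc, A.push_comp, A.push_comp] at e
  have e₁ : (fun i => Fin.fold m (Fin.sumMap (fun i => i) h (Fin.natAdd m i))) = h := by
    funext i; rw [Fin.sumMap_natAdd, Fin.fold_natAdd]
  have e₂ : A.push (Fin.natAdd m : Fin n → Fin (m + n)) =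
      P.comp (A.push (Fin.blockSwap n 0)) (P.tensor (A.unitState m) (P.id n)) := by
    rw [unitState, ← A.push_id, A.tensor_push, A.push_comp]
    refine congrArg _ (Fin.funext_add (a := n) (b := 0) (fun i => ?_) fun i => i.elim0)
    rw [Fin.blockSwap_castAdd, Fin.sumMap_natAdd]; rfl
  have e₃ : P.comp (P.tensor (A.unitState m) (P.id n)) (P.tensor (A.pull h) (P.id n)) =
      P.tensor (P.comp (A.unitState m) (A.pull h)) (P.id n) := by
    rw [← P.tensor_comp, P.comp_id]
  have e₄ := P.symm_naturality (P.id n) (P.comp (A.unitState m) (A.pull h))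
  rw [e₁, e₂, P.comp_assoc (A.push _), ← P.comp_assoc (P.tensor _ _), e₃, A.push_blockSwap,
    ← P.comp_assoc] at e
  refine e.trans ((congrArg (fun f => P.comp f _) e₄.symm).trans ?_)
  rw [P.comp_assoc, ← A.push_blockSwap, A.push_comp, smul]
  refine congrArg (P.comp _) (congrArg _ (Fin.funext_add (fun i => ?_) fun i => ?_))
  all_goals simp only [Fin.blockSwap_castAdd, Fin.blockSwap_natAdd, Fin.fold_castAdd,
    Fin.fold_natAdd]

/-- The inverse image of states along a function is linear. -/
theorem mul_pull {n m : ℕ} (h : Fin n → Fin m) (x : P.Hom 0 n) :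
    P.comp (P.comp x (A.push h)) (A.pull h) =
      A.mulState x (P.comp (A.unitState m) (A.pull h)) := by
  rw [P.comp_assoc, A.push_pull, comp_smul]

/-- The state on `2` that connects both elements. -/
def cup : P.Hom 0 2 := P.comp A.one A.comul

/-- The state on `n` that connects two elements of `n`. -/
def link {n : ℕ} (x y : Fin n) : P.Hom 0 n := P.comp A.cup (A.push ![x, y])

theorem link_push {n m : ℕ} (h : Fin n → Fin m) (x y : Fin n) :
    P.comp (A.link x y) (A.push h) = A.link (h x) (h y) := by
  rw [link, P.comp_assoc, A.push_comp, link]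
  refine congrArg _ (congrArg _ ?_)
  refine funext fun i => ?_
  fin_cases i <;> rfl

/-- The special law enters here: comultiplying a unit and multiplying again gives back the unit.
Hence a redundant identification contributes nothing. -/
theorem link_self {n : ℕ} (x : Fin n) : A.link x x = A.unitState n := by
  have h : A.push ![x, x] = P.comp A.mul (A.push fun _ : Fin 1 => x) := by
    rw [← A.push_two_one (fun _ => 0), A.push_comp]
    refine congrArg _ (funext fun i => ?_)
    fin_cases i <;> rfl
  rw [link, cup, h, P.comp_assoc, ← P.comp_assoc A.comul, A.special, P.id_comp,
    ← A.push_zero_one Fin.elim0, A.push_comp, A.push_zero]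

/-- Two elements can be merged. -/
theorem exists_merge {n : ℕ} (x y : Fin n) : ∃ (m : ℕ) (r : Fin n → Fin m),
    Function.Surjective r ∧ r x = r y ∧
    (∀ (k : ℕ) (f : Fin n → Fin k), f x = f y → ∃ g : Fin m → Fin k, ∀ i, g (r i) = f i) ∧
    P.comp (A.unitState m) (A.pull r) = A.link x y := by
  by_cases hxy : x = y
  · subst hxy
    refine ⟨n, fun i => i, fun i => ⟨i, rfl⟩, rfl, fun k f _ => ⟨f, fun _ => rfl⟩, ?_⟩
    rw [A.pull_id, P.comp_id, A.link_self]
  obtain ⟨m, rfl⟩ : ∃ m, n = m + 2 := by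
    refine ⟨n - 2, ?_⟩
    have h₁ := x.isLt
    have h₂ := y.isLt
    have h₃ : x.val ≠ y.val := fun h => hxy (Fin.ext h)
    omega
  -- A permutation brings `x` and `y` to the last two positions, where the merge is `2 → 1` beside
  -- an identity.
  obtain ⟨σ, hx, hy⟩ : ∃ σ : Equiv.Perm (Fin (m + 2)),
      σ x = Fin.natAdd m 0 ∧ σ y = Fin.natAdd m 1 := by
    have h₁ : Fin.natAdd m (0 : Fin 2) ≠ Fin.natAdd m 1 := fun h => by simp [Fin.ext_iff] at h
    have h₂ : Fin.natAdd m (0 : Fin 2) ≠ Equiv.swap x (Fin.natAdd m 0) y := fun h => by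
      exact hxy ((Equiv.swap x (Fin.natAdd m 0)).injective
        ((Equiv.swap_apply_left _ _).trans h))
    refine ⟨(Equiv.swap x (Fin.natAdd m 0)).trans
      (Equiv.swap (Equiv.swap x (Fin.natAdd m 0) y) (Fin.natAdd m 1)), ?_, ?_⟩
    · rw [Equiv.trans_apply, Equiv.swap_apply_left, Equiv.swap_apply_of_ne_of_ne h₂ h₁]
    · rw [Equiv.trans_apply, Equiv.swap_apply_left]
  have hsum : ∀ i : Fin 2, Fin.sumMap (fun i : Fin m => i) (fun _ : Fin 2 => (0 : Fin 1))
      (Fin.natAdd m i) = Fin.natAdd m 0 := fun i => Fin.sumMap_natAdd _ _ i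
  refine ⟨m + 1, fun i => Fin.sumMap (fun i => i) (fun _ => 0) (σ i), ?_, ?_, ?_, ?_⟩
  · refine Function.Surjective.comp (fun j => ?_) σ.surjective
    refine Fin.addCases (fun j => ⟨Fin.castAdd 2 j, ?_⟩) (fun j => ⟨Fin.natAdd m 0, ?_⟩) j
    · exact Fin.sumMap_castAdd _ _ j
    · exact (hsum 0).trans (by rw [Subsingleton.elim j 0])
  · beta_reduce
    rw [hx, hy, hsum, hsum]
  · intro k f hf
    refine ⟨Fin.append (fun i => f (σ.symm (Fin.castAdd 2 i))) (fun _ => f x), fun i => ?_⟩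
    obtain ⟨i, rfl⟩ := σ.symm.surjective i
    beta_reduce
    rw [σ.apply_symm_apply]
    refine Fin.addCases (fun i => ?_) (fun i => ?_) i
    · rw [Fin.sumMap_castAdd, Fin.append_left]
    · rw [Fin.sumMap_natAdd, Fin.append_right]
      fin_cases i
      · exact congrArg f (σ.eq_symm_apply.2 hx)
      · exact hf.trans (congrArg f (σ.eq_symm_apply.2 hy))
  -- Pulling the unit back along `2 → 1` gives `cup` by definition; the permutation then only
  -- relabels the two linked positions.
  · rw [← A.pull_comp, A.pull_equiv σ, ← P.comp_assoc]
    have h₁ : A.unitState (m + 1) = P.tensor (A.unitState m) A.one := by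
      rw [← A.push_zero_one Fin.elim0, unitState, unitState, A.tensor_push]
      exact (A.push_zero _).symm
    have h₂ : A.push (Fin.natAdd m : Fin 2 → Fin (m + 2)) =
        P.tensor (A.unitState m) (P.id 2) := by
      rw [unitState, ← A.push_id, A.tensor_push]
      refine congrArg _ (funext fun i => ?_)
      refine Eq.trans ?_ (congrArg (Fin.sumMap (a := 0) _ _)
        (Fin.ext (Nat.zero_add i.val) : Fin.natAdd 0 i = i))
      exact (Fin.sumMap_natAdd (fun i : Fin 0 => i.elim0) (fun i : Fin 2 => i) i).symm
    have h₃ : P.comp (A.unitState (m + 1)) (A.pull (Fin.sumMap (fun i : Fin m => i)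
        (fun _ : Fin 2 => (0 : Fin 1)))) = A.link (Fin.natAdd m 0) (Fin.natAdd m 1) := by
      have h₄ : A.link (Fin.natAdd m 0) (Fin.natAdd m 1) =
          P.comp A.cup (A.push (Fin.natAdd m : Fin 2 → Fin (m + 2))) := by
        rw [link]
        refine congrArg _ (congrArg _ (funext fun i => ?_))
        fin_cases i <;> rfl
      rw [h₁, h₄, h₂, ← A.tensor_pull, A.pull_id, A.pull_two_one]
      refine (P.tensor_comp (A.unitState m) (P.id m) A.one A.comul).symm.trans ?_
      have h₅ : P.tensor (P.id 0) A.cup = A.cup := by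
        have := P.id_zero_tensor A.cup
        rwa [P.eqHom_rfl, P.eqHom_rfl, P.comp_id, P.id_comp] at this
      refine Eq.trans ?_ (congrArg (fun f => P.comp f _) h₅)
      refine Eq.trans ?_ (P.tensor_comp (P.id 0) (A.unitState m) A.cup (P.id 2))
      rw [P.comp_id, P.id_comp, P.comp_id]
      rfl
    rw [h₃, link_push, ← hx, ← hy, σ.symm_apply_apply, σ.symm_apply_apply]

end PROP.FrobeniusStr

/-! ### Pushout squares of functions, products of states, Beck-Chevalley property -/

/-- The commutative squares of functions between finite ordinals that are pushout squares. -/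
structure Fin.IsPushout {m v v' w : ℕ} (g : Fin m → Fin v) (f : Fin m → Fin v')
    (i : Fin v → Fin w) (j : Fin v' → Fin w) : Prop where
  comm (z : Fin m) : i (g z) = j (f z)
  cover (x : Fin w) : (∃ y, i y = x) ∨ ∃ y, j y = x
  desc {n : ℕ} (k : Fin v → Fin n) (l : Fin v' → Fin n) :
    (∀ z, k (g z) = l (f z)) → ∃ t : Fin w → Fin n, (∀ y, t (i y) = k y) ∧ ∀ y, t (j y) = l y

namespace PROP.FrobeniusStr

variable {P : PROP.{u}} (A : P.FrobeniusStr)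

/-- The states on `n`, as a type that carries the multiplication of states. -/
def State (_ : P.FrobeniusStr) (n : ℕ) : Type u := P.Hom 0 n

instance (n : ℕ) : CommMonoid (A.State n) where
  mul := A.mulState
  one := A.unitState n
  mul_assoc := A.mulState_assoc
  mul_comm := A.mulState_comm
  mul_one := A.mulState_unitState
  one_mul x := (A.mulState_comm _ _).trans (A.mulState_unitState x)

/-- The product of a finite family of states. -/
def prodState {ι : Type*} [Fintype ι] {n : ℕ} (x : ι → P.Hom 0 n) : P.Hom 0 n :=
  (∏ i, (show A.State n from x i) : A.State n)

theorem prodState_push {ι : Type*} [Fintype ι] {n m : ℕ} (h : Fin n → Fin m) (x : ι → P.Hom 0 n) :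
    P.comp (A.prodState x) (A.push h) = A.prodState fun i => P.comp (x i) (A.push h) :=
  let F : A.State n →* A.State m :=
    { toFun := fun x => P.comp (b := n) x (A.push h)
      map_one' := A.unitState_push h
      map_mul' := A.mulState_push h }
  map_prod F _ _

theorem prodState_sum {ι κ : Type*} [Fintype ι] [Fintype κ] {n : ℕ} (x : ι ⊕ κ → P.Hom 0 n) :
    A.prodState x = A.mulState (A.prodState fun i => x (.inl i)) (A.prodState fun i => x (.inr i)) :=
  Fintype.prod_sum_type (M := A.State n) x

theorem prodState_equiv {ι κ : Type*} [Fintype ι] [Fintype κ] {n : ℕ} (e : ι ≃ κ)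
    (x : κ → P.Hom 0 n) : A.prodState (fun i => x (e i)) = A.prodState x :=
  e.prod_comp (M := A.State n) x

theorem prodState_empty {ι : Type*} [Fintype ι] [IsEmpty ι] {n : ℕ} (x : ι → P.Hom 0 n) :
    A.prodState x = A.unitState n :=
  Fintype.prod_empty (M := A.State n) x

theorem prodState_unique {ι : Type*} [Fintype ι] [Unique ι] {n : ℕ} (x : ι → P.Hom 0 n) :
    A.prodState x = x default :=
  Fintype.prod_unique (M := A.State n) x

theorem prodState_succ {m n : ℕ} (x : Fin (m + 1) → P.Hom 0 n) :
    A.prodState x = A.mulState (A.prodState fun i : Fin m => x i.succ) (x 0) :=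
  (Fin.prod_univ_succ (M := A.State n) x).trans (A.mulState_comm _ _)

/-- The state that is associated with a coequalizer. -/
theorem unitState_pull_of_coequalizer {m : ℕ} : ∀ {n k : ℕ} (p p' : Fin m → Fin n)
    (q : Fin n → Fin k), Function.Surjective q → (∀ z, q (p z) = q (p' z)) →
    (∀ {l : ℕ} (f : Fin n → Fin l), (∀ z, f (p z) = f (p' z)) →
      ∃ t : Fin k → Fin l, ∀ x, t (q x) = f x) →
    P.comp (A.unitState k) (A.pull q) = A.prodState fun z => A.link (p z) (p' z) := by
  induction m with
  | zero =>
    intro n k p p' q hq _ hd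
    -- Without identifications the identity descends along `q`, so `q` is a bijection.
    obtain ⟨t, ht⟩ := hd (fun x => x) (fun z => z.elim0)
    have hb : Function.Bijective q := ⟨Function.LeftInverse.injective ht, hq⟩
    rw [prodState_empty]
    exact (congrArg (P.comp _) (A.pull_equiv (Equiv.ofBijective q hb))).trans (A.unitState_push _)
  | succ m ih =>
    intro n k p p' q hq hp hd
    -- The first pair is merged by `r`, and `q` factors through `r`. The factor `q'` is the
    -- coequalizer of the images of the remaining pairs.
    obtain ⟨l, r, hr, hr₀, hrd, hrl⟩ := A.exists_merge (p 0) (p' 0)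
    obtain ⟨q', hq'⟩ := hrd k q (hp 0)
    have e := ih (fun z => r (p z.succ)) (fun z => r (p' z.succ)) q'
      (fun y => by obtain ⟨x, rfl⟩ := hq y; exact ⟨r x, hq' x⟩)
      (fun z => by rw [hq', hq', hp])
      (fun {l'} f hf => by
        obtain ⟨t, ht⟩ := hd (fun x => f (r x)) (fun z => by
          obtain rfl | ⟨z, rfl⟩ := z.eq_zero_or_eq_succ
          · exact congrArg f hr₀
          · exact hf z)
        refine ⟨t, fun x => ?_⟩
        obtain ⟨x, rfl⟩ := hr x
        rw [hq', ht])
    have h : q = fun x => q' (r x) := funext fun x => (hq' x).symm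
    -- The remaining links are pushed along `r` from links upstairs, and by `mul_pull` pulling such
    -- a push back multiplies by `link (p 0) (p' 0)`.
    rw [h, ← A.pull_comp, ← P.comp_assoc, e, prodState_succ, ← hrl, ← A.mul_pull, prodState_push]
    simp only [link_push]

/-- The state that connects the two copies of `n` in `n + n`. -/
def cups (n : ℕ) : P.Hom 0 (n + n) := P.comp (A.unitState n) (A.pull (Fin.fold n))

/-- The codiagonal is the coequalizer of the two inclusions. -/
theorem cups_eq_prodState (n : ℕ) :
    A.cups n = A.prodState fun z => A.link (Fin.castAdd n z) (Fin.natAdd n z) := by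
  refine A.unitState_pull_of_coequalizer _ _ _ (fun x => ⟨Fin.castAdd n x, Fin.fold_castAdd x⟩)
    (fun z => by rw [Fin.fold_castAdd, Fin.fold_natAdd]) (fun f hf => ⟨fun x => f (Fin.castAdd n x),
      funext_iff.1 (Fin.funext_add (fun x => ?_) fun x => ?_)⟩)
  · rw [Fin.fold_castAdd]
  · rw [Fin.fold_natAdd]; exact hf x

/-- The triangle identity. -/
theorem push_smul_cups_pull (n : ℕ) :
    P.comp (A.push (Fin.castAdd n)) (P.comp (A.smul (A.cups n)) (A.pull (Fin.natAdd n))) =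
      P.id n := by
  rw [cups, ← A.push_pull, P.comp_assoc, ← P.comp_assoc, A.push_comp, A.pull_comp]
  simp only [Fin.fold_castAdd, Fin.fold_natAdd]
  rw [A.push_id, A.pull_id, P.comp_id]

theorem natAdd_eq_sumMap {a c : ℕ} : (Fin.natAdd a : Fin c → Fin (a + c)) =
    fun i => Fin.sumMap (fun i : Fin 0 => i.elim0) (fun i => i) (Fin.cast (Nat.zero_add c).symm i) := by
  funext i
  refine (Fin.sumMap_natAdd (fun i : Fin 0 => i.elim0) (fun i : Fin c => i) i).symm.trans
    (congrArg (Fin.sumMap (a := 0) _ _) (Fin.ext (Nat.zero_add i.val)))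

theorem pull_natAdd (a c : ℕ) : A.pull (Fin.natAdd a : Fin c → Fin (a + c)) =
    P.comp (P.tensor (A.pull fun i : Fin 0 => i.elim0) (P.id c))
      (A.push (Fin.cast (Nat.zero_add c))) := by
  rw [natAdd_eq_sumMap, ← A.pull_comp, ← A.pull_id c, A.tensor_pull, ← A.eqHom_eq_pull,
    ← A.eqHom_eq_push]

/-- The two arrows act on different blocks, so this is the interchange law. -/
theorem pull_natAdd_push (a : ℕ) {c d : ℕ} (f : Fin c → Fin d) :
    P.comp (A.pull (Fin.natAdd a)) (A.push f) =
      P.comp (A.push (Fin.sumMap (fun i => i) f)) (A.pull (Fin.natAdd a)) := by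
  rw [pull_natAdd, pull_natAdd, P.comp_assoc, A.push_comp, ← A.tensor_push, ← P.comp_assoc, ← P.tensor_comp,
    A.push_id, P.id_comp, P.comp_id]
  have h₂ : P.tensor (A.pull fun i : Fin 0 => (i.elim0 : Fin a)) (A.push f) =
      P.comp (P.tensor (A.pull fun i : Fin 0 => i.elim0) (P.id c))
        (P.tensor (P.id 0) (A.push f)) := by
    rw [← P.tensor_comp, P.id_comp, P.comp_id]
  rw [h₂, P.comp_assoc, ← A.push_id 0, A.tensor_push, A.push_comp]
  refine congrArg (P.comp _) (congrArg _ (Fin.funext_add (fun i => i.elim0) fun i => ?_))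
  rw [Fin.sumMap_natAdd]
  refine Eq.trans (congrArg f (Fin.ext (Nat.zero_add i.val))) (Fin.ext (Nat.zero_add (f i).val).symm)

theorem pull_push_castAdd {a b : ℕ} (c : ℕ) (g : Fin a → Fin b) :
    P.comp (A.pull g) (A.push (Fin.castAdd c)) =
      P.comp (A.push (Fin.castAdd c)) (A.pull (Fin.sumMap g fun i => i)) := by
  have h₁ : ∀ a, A.push (Fin.castAdd c : Fin a → Fin (a + c)) =
      P.tensor (P.id a) (A.unitState c) := by
    intro a
    rw [unitState, ← A.push_id, A.tensor_push, Fin.sumMap_elim0_right]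
  rw [h₁, h₁, ← A.tensor_pull, A.pull_id]
  refine Eq.trans ?_ (P.tensor_comp (P.id b) (A.pull g) (A.unitState c) (P.id c))
  rw [P.id_comp, P.comp_id, tensor_zero (A.pull g)]

/-- The Beck-Chevalley property of pushout squares. -/
theorem pull_push {m v v' w : ℕ} {g : Fin m → Fin v} {f : Fin m → Fin v'} {i : Fin v → Fin w}
    {j : Fin v' → Fin w} (h : Fin.IsPushout g f i j) :
    P.comp (A.pull g) (A.push f) = P.comp (A.push i) (A.pull j) := by
  -- The copairing of `i` and `j` is the coequalizer of `g` and `f` taken into `v + v'`. Its state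
  -- is therefore a product of links, namely those of `cups m` pushed along `g` and `f`.
  have hq : P.comp (A.unitState w) (A.pull (Fin.append i j)) =
      P.comp (A.cups m) (A.push (Fin.sumMap g f)) := by
    rw [cups_eq_prodState, prodState_push]
    simp only [link_push, Fin.sumMap_castAdd, Fin.sumMap_natAdd]
    refine A.unitState_pull_of_coequalizer _ _ _ (fun x => ?_) (fun z => ?_) (fun {l} k hk => ?_)
    · obtain ⟨y, rfl⟩ | ⟨y, rfl⟩ := h.cover x
      · exact ⟨Fin.castAdd v' y, Fin.append_left _ _ _⟩
      · exact ⟨Fin.natAdd v y, Fin.append_right _ _ _⟩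
    · rw [Fin.append_left, Fin.append_right, h.comm]
    · obtain ⟨t, ht₁, ht₂⟩ := h.desc (fun y => k (Fin.castAdd v' y)) (fun y => k (Fin.natAdd v y)) hk
      refine ⟨t, funext_iff.1 (Fin.funext_add (fun y => ?_) fun y => ?_)⟩
      · rw [Fin.append_left, ht₁]
      · rw [Fin.append_right, ht₂]
  have hi : A.push i = P.comp (A.push (Fin.castAdd v')) (A.push (Fin.append i j)) := by
    rw [A.push_comp]; simp only [Fin.append_left]
  have hj : A.pull j = P.comp (A.pull (Fin.append i j)) (A.pull (Fin.natAdd v)) := by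
    rw [A.pull_comp]; simp only [Fin.append_right]
  -- The push is split in two so that `g` and `f` can be moved out on opposite sides.
  have hs : P.comp (A.cups m) (A.push (Fin.sumMap g f)) =
      P.comp (P.comp (A.cups m) (A.push (Fin.sumMap (fun i => i) f)))
        (A.push (Fin.sumMap g fun i => i)) := by
    rw [P.comp_assoc, A.push_comp]
    refine congrArg _ (congrArg _ (Fin.funext_add (fun i => ?_) fun i => ?_)) <;>
    simp only [Fin.sumMap_castAdd, Fin.sumMap_natAdd]
  -- With `i` and `j` factored through their copairing, `push i ; pull j` is multiplication by the
  -- state above, between the inclusion of one block and the projection to the other.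
  rw [hi, hj, P.comp_assoc, ← P.comp_assoc (A.push (Fin.append i j)), A.push_pull, hq, hs]
  have hn : A.pull (Fin.natAdd v : Fin v' → Fin (v + v')) =
      P.comp (A.pull (Fin.sumMap g fun i => i)) (A.pull (Fin.natAdd m)) := by
    rw [A.pull_comp]; simp only [Fin.sumMap_natAdd]
  -- The projection formula moves `g` to the front, as `pull g`.
  rw [hn, ← P.comp_assoc (A.smul _), A.smul_push_pull, P.comp_assoc (A.pull _), ← P.comp_assoc,
    ← A.pull_push_castAdd, P.comp_assoc]
  refine congrArg (P.comp _) ?_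
  have hc : A.push (Fin.castAdd v' : Fin m → Fin (m + v')) =
      P.comp (A.push (Fin.castAdd m)) (A.push (Fin.sumMap (fun i => i) f)) := by
    rw [A.push_comp]; simp only [Fin.sumMap_castAdd]
  -- Multiplicativity of `push` moves `f` to the end, and the triangle identity removes `cups m`.
  rw [hc, P.comp_assoc, ← P.comp_assoc (A.push (Fin.sumMap _ _)), ← A.smul_push, P.comp_assoc,
    ← A.pull_natAdd_push, ← P.comp_assoc (A.smul _), ← P.comp_assoc, A.push_smul_cups_pull, P.id_comp]

end PROP.FrobeniusStr

/-! ### Bending arrows into states -/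

namespace PROP.FrobeniusStr

variable {P : PROP.{u}} (A : P.FrobeniusStr)

theorem tensor_eq_mulState {n m : ℕ} (x : P.Hom 0 n) (y : P.Hom 0 m) :
    P.tensor x y = A.mulState (P.comp x (A.push (Fin.castAdd m)))
      (P.comp y (A.push (Fin.natAdd n))) := by
  rw [mulState, P.tensor_comp, P.comp_assoc, A.tensor_push, A.push_comp]
  refine (P.comp_id _).symm.trans ?_
  rw [← A.push_id]
  refine congrArg (P.comp _) (congrArg _ (Fin.funext_add (fun i => ?_) fun i => ?_)) <;>
  simp only [Fin.sumMap_castAdd, Fin.sumMap_natAdd, Fin.fold_castAdd, Fin.fold_natAdd]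

/-- The codiagonals of `n`, `m` and of `n + m` differ by an exchange of middle blocks. This exchange
is natural and is undone by another one of the same kind. -/
theorem tensor_smul {n m : ℕ} (x : P.Hom 0 n) (y : P.Hom 0 m) :
    P.tensor (A.smul x) (A.smul y) = A.smul (A.mulState (P.comp x (A.push (Fin.castAdd m)))
      (P.comp y (A.push (Fin.natAdd n)))) := by
  have h := A.monoidStr.middleSwap_naturality (P.id n) x (P.id m) y
  have h₁ : A.push (Fin.middleSwap n 0 m 0) = P.id (n + m) := by
    refine (congrArg A.push (funext fun i => ?_)).trans (A.push_id (n + m))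
    refine Fin.addCases (fun i => ?_) (fun i => ?_) i
    · exact (Fin.append_left _ _ i).trans (Fin.append_left _ _ i)
    · exact (Fin.append_right (m := n) (n := m) _ _ i).trans (Fin.append_left _ _ i)
  have h₂ : A.push (Fin.fold (n + m)) = P.comp (A.push (Fin.middleSwap n m n m))
      (A.push (Fin.sumMap (Fin.fold n) (Fin.fold m))) := by
    rw [A.push_comp, ← Fin.fold_add]
  have h₃ : P.comp (A.push (Fin.middleSwap n n m m)) (A.push (Fin.middleSwap n m n m)) =
      P.id ((n + n) + (m + m)) := by
    rw [A.push_comp, ← A.push_id]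
    refine congrArg _ (Fin.funext_add (funext_iff.1 (Fin.funext_add (fun i => ?_) fun i => ?_))
      (funext_iff.1 (Fin.funext_add (fun i => ?_) fun i => ?_))) <;>
    simp only [Fin.middleSwap, Fin.append_left, Fin.append_right]
  have h₄ : P.comp (a := n + m) (P.tensor (P.tensor (P.id n) x) (P.tensor (P.id m) y))
      (A.push (Fin.middleSwap n n m m)) = P.tensor (P.id (n + m)) (P.tensor x y) := by
    refine h.trans ((congrArg (fun f => P.comp f _) h₁).trans ((P.id_comp (a := n + m) _).trans ?_))
    rw [P.tensor_id]
  rw [← tensor_eq_mulState, smul, smul, smul, P.tensor_comp, A.tensor_push, h₂, ← h₄, P.comp_assoc,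
    ← P.comp_assoc (A.push _), h₃, P.id_comp]

/-- An arrow, turned into a state. -/
def bend {k l : ℕ} (f : P.Hom k l) : P.Hom 0 (k + l) := P.comp (A.cups k) (P.tensor (P.id k) f)

/-- Isolates `y`: on the right-hand side it is followed by a fixed arrow that contracts the first
two blocks of size `k`. The states `cups k` and `bend f` can then be compared directly. -/
theorem push_smul_pull {k l : ℕ} (y : P.Hom 0 (k + l)) :
    P.comp (A.push (Fin.castAdd l)) (P.comp (A.smul y) (A.pull (Fin.natAdd k))) =
      P.comp (a := k) (P.tensor (P.id k) y) (P.comp (A.push (Fin.cast (Nat.add_assoc k k l).symm))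
        (P.comp (P.tensor (P.comp (A.push (Fin.fold k)) (A.pull fun i : Fin 0 => i.elim0)) (P.id l))
          (A.push (Fin.cast (Nat.zero_add l))))) := by
  have h₁ : P.comp (a := k) (A.push (Fin.castAdd l)) (P.tensor (c := 0) (P.id (k + l)) y) =
      P.comp (a := k) (P.tensor (P.id k) y)
        (P.tensor (A.push (Fin.castAdd l)) (P.id (k + l))) := by
    rw [← tensor_zero, tensor_zero']
  have h₂ : P.tensor (P.comp (A.push (Fin.fold k)) (A.pull fun i : Fin 0 => i.elim0)) (P.id l) =
      P.comp (P.tensor (A.push (Fin.fold k)) (P.id l))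
        (P.tensor (A.pull fun i : Fin 0 => i.elim0) (P.id l)) := by
    rw [← P.tensor_comp, P.comp_id]
  rw [smul, P.comp_assoc, ← P.comp_assoc, h₁, P.comp_assoc, pull_natAdd, h₂]
  refine congrArg (P.comp _) ?_
  rw [P.comp_assoc (P.tensor _ _), ← P.comp_assoc, ← P.comp_assoc (A.push (Fin.cast _)), ← A.push_id,
    ← A.push_id, A.tensor_push, A.tensor_push, A.push_comp, A.push_comp]
  refine congrArg (fun f => P.comp (A.push f) _) (Fin.funext_add (fun i => ?_)
    (funext_iff.1 (Fin.funext_add (fun i => ?_) fun i => ?_)))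
  all_goals simp only [Fin.cast_assoc_symm_left, Fin.cast_assoc_symm_middle,
    Fin.cast_assoc_symm_right, Fin.sumMap_castAdd, Fin.sumMap_natAdd, Fin.fold_castAdd,
    Fin.fold_natAdd]

/-- An arrow can be recovered from the state that it has been turned into. -/
theorem push_smul_bend_pull {k l : ℕ} (f : P.Hom k l) :
    P.comp (A.push (Fin.castAdd l)) (P.comp (A.smul (A.bend f)) (A.pull (Fin.natAdd k))) = f := by
  have h := A.push_smul_cups_pull k
  rw [push_smul_pull] at h ⊢
  -- `bend f` is `cups k` with `f` applied to the second block, so `f` slides past the contraction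
  -- to the end and the triangle identity remains.
  refine Eq.trans ?_ ((congrArg (fun g => P.comp g f) h).trans (P.id_comp f))
  have h₁ : P.tensor (P.id k) (A.bend f) = P.comp (a := k) (P.tensor (P.id k) (A.cups k))
      (P.tensor (P.id k) (P.tensor (P.id k) f)) := by
    refine Eq.trans ?_ (P.tensor_comp (P.id k) (P.id k) (A.cups k) (P.tensor (P.id k) f))
    rw [P.id_comp]; rfl
  have h₂ : P.comp (P.tensor (P.id k) (P.tensor (P.id k) f))
      (A.push (Fin.cast (Nat.add_assoc k k l).symm)) =
      P.comp (A.push (Fin.cast (Nat.add_assoc k k k).symm)) (P.tensor (P.id (k + k)) f) := by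
    rw [← A.eqHom_eq_push, ← A.eqHom_eq_push, ← P.tensor_id]
    exact (P.eqHom_comp_of_comp_eqHom (Nat.add_assoc k k k) (Nat.add_assoc k k l)
      (P.tensor_assoc (P.id k) (P.id k) f)).symm
  have h₃ : ∀ c : P.Hom (k + k) 0, P.comp (P.tensor (P.id (k + k)) f) (P.tensor c (P.id l)) =
      P.comp (P.tensor c (P.id k)) (P.tensor (P.id 0) f) := by
    intro c
    rw [← P.tensor_comp, ← P.tensor_comp, P.id_comp, P.comp_id, P.id_comp, P.comp_id]
  have h₄ := P.id_zero_tensor f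
  rw [A.eqHom_eq_push, A.eqHom_eq_push] at h₄
  rw [h₁, P.comp_assoc, P.comp_assoc, P.comp_assoc, P.comp_assoc, ← h₄, ← P.comp_assoc (P.tensor _ _)
    (P.tensor _ _) (A.push _), ← h₃, ← P.comp_assoc (P.tensor _ (P.tensor _ _)), h₂]
  simp only [P.comp_assoc]

end PROP.FrobeniusStr

/-! ### Explicit pushouts and disjoint unions of hypergraphs -/

namespace TypedHypergraph

variable {S : Signature.{u}}

/-- A criterion for pushout squares of hypergraphs over a discrete hypergraph. -/
theorem isPushout_of_nodes_of_edges {m : ℕ} {G H K : TypedHypergraph S} {a : disc m ⟶ G}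
    {b : disc m ⟶ H} {i : G ⟶ K} {j : H ⟶ K}
    (hV : Fin.IsPushout (m := m) a.onV b.onV i.onV j.onV)
    (hE : Function.Bijective (Sum.elim i.onE j.onE)) : IsPushout a b i j := by
  -- No hyperedges are glued over a discrete hypergraph; a map out of `K` is defined on hyperedges
  -- through this bijection.
  obtain ⟨e, he⟩ : ∃ e : Fin G.E ⊕ Fin H.E ≃ Fin K.E, ∀ x, e x = Sum.elim i.onE j.onE x :=
    ⟨Equiv.ofBijective _ hE, fun _ => rfl⟩
  have hd : ∀ s : PushoutCocone a b, ∃ t : K ⟶ s.pt, i ≫ t = s.inl ∧ j ≫ t = s.inr := by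
    intro s
    obtain ⟨t, ht₁, ht₂⟩ := hV.desc s.inl.onV s.inr.onV
      (fun z => congrArg (fun f => Hom.onV f z) s.condition)
    have hi : ∀ x, e.symm (i.onE x) = .inl x := fun x => e.symm_apply_eq.2 (he (.inl x)).symm
    have hj : ∀ x, e.symm (j.onE x) = .inr x := fun x => e.symm_apply_eq.2 (he (.inr x)).symm
    have ht₁' : s.inl.onV = t ∘ i.onV := funext fun y => (ht₁ y).symm
    have ht₂' : s.inr.onV = t ∘ j.onV := funext fun y => (ht₂ y).symm
    have key : ∀ C : Fin K.E → Prop, (∀ x, C (i.onE x)) → (∀ x, C (j.onE x)) → ∀ x, C x := by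
      intro C hC₁ hC₂ x
      obtain ⟨x | x, rfl⟩ := hE.surjective x
      exacts [hC₁ x, hC₂ x]
    refine ⟨⟨t, fun x => Sum.elim s.inl.onE s.inr.onE (e.symm x), ?_, ?_, ?_⟩, ?_, ?_⟩
    · refine key _ (fun x => ?_) (fun x => ?_)
      · rw [hi]; exact (s.inl.label_onE x).trans (i.label_onE x).symm
      · rw [hj]; exact (s.inr.label_onE x).trans (j.label_onE x).symm
    · refine key _ (fun x => ?_) (fun x => ?_)
      · rw [hi, i.source_onE, List.map_map, ← ht₁']; exact s.inl.source_onE x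
      · rw [hj, j.source_onE, List.map_map, ← ht₂']; exact s.inr.source_onE x
    · refine key _ (fun x => ?_) (fun x => ?_)
      · rw [hi, i.target_onE, List.map_map, ← ht₁']; exact s.inl.target_onE x
      · rw [hj, j.target_onE, List.map_map, ← ht₂']; exact s.inr.target_onE x
    · exact hom_ext ht₁ fun x => congrArg (Sum.elim s.inl.onE s.inr.onE) (hi x)
    · exact hom_ext ht₂ fun x => congrArg (Sum.elim s.inl.onE s.inr.onE) (hj x)
  refine ⟨⟨disc_ext hV.comm⟩, ⟨PushoutCocone.IsColimit.mk _ (fun s => (hd s).choose)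
    (fun s => (hd s).choose_spec.1) (fun s => (hd s).choose_spec.2) fun s t h₁ h₂ => ?_⟩⟩
  -- `Fin.IsPushout.desc` gives existence only. Uniqueness holds since every node and every
  -- hyperedge of `K` comes from `G` or `H`.
  have h₁' := h₁.trans (hd s).choose_spec.1.symm
  have h₂' := h₂.trans (hd s).choose_spec.2.symm
  refine hom_ext (fun x => ?_) (fun x => ?_)
  · obtain ⟨y, rfl⟩ | ⟨y, rfl⟩ := hV.cover x
    · exact congrArg (fun f => Hom.onV f y) h₁'
    · exact congrArg (fun f => Hom.onV f y) h₂'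
  · obtain ⟨y | y, rfl⟩ := hE.surjective x
    · exact congrArg (fun f => Hom.onE f y) h₁'
    · exact congrArg (fun f => Hom.onE f y) h₂'

/-- The nodes of a pushout. -/
theorem isPushout_pushoutObj_nodes {m : ℕ} {G H : TypedHypergraph S} (a : disc m ⟶ G)
    (b : disc m ⟶ H) : Fin.IsPushout (m := m) a.onV b.onV (pushoutInl a b).onV
      (pushoutInr a b).onV where
  comm := fun z => congrArg (fun f => Hom.onV f z) (pushout_condition a b)
  cover x := by
    obtain ⟨x, rfl⟩ := (numV a b).surjective x
    rcases x with ⟨x | x⟩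
    · exact .inl ⟨x, rfl⟩
    · exact .inr ⟨x, rfl⟩
  desc k l h := by
    refine ⟨fun x => Quot.lift (Sum.elim k l) (by rintro _ _ ⟨z⟩; exact h z) ((numV a b).symm x),
      fun y => ?_, fun y => ?_⟩ <;> simp [pushoutInl, pushoutInr, pushoutInlV, pushoutInrV]

/-- The hyperedges of a pushout over a discrete hypergraph. -/
theorem bijective_pushoutObj_edges {m : ℕ} {G H : TypedHypergraph S} (a : disc m ⟶ G)
    (b : disc m ⟶ H) :
    Function.Bijective (Sum.elim (pushoutInl a b).onE (pushoutInr a b).onE) := by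
  have h : Sum.elim (pushoutInl a b).onE (pushoutInr a b).onE =
      fun e => numE a b (Quot.mk _ e) := by
    funext e; rcases e with e | e <;> rfl
  rw [h]
  refine (numE a b).bijective.comp ⟨fun e e' he => ?_, Quot.mk_surjective⟩
  have hr : ∀ e e', ¬ PushoutRelE a b e e' := by rintro _ _ ⟨z⟩; exact Fin.elim0 z
  exact congrArg (Quot.lift (fun e => e) fun e e' h => (hr e e' h).elim) he

/-- The disjoint union of two hypergraphs. -/
def sum (G H : TypedHypergraph S) : TypedHypergraph S where
  V := G.V + H.V
  E := G.E + H.E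
  label := Fin.append G.label H.label
  source := Fin.append (fun e => (G.source e).map (Fin.castAdd H.V))
    (fun e => (H.source e).map (Fin.natAdd G.V))
  target := Fin.append (fun e => (G.target e).map (Fin.castAdd H.V))
    (fun e => (H.target e).map (Fin.natAdd G.V))
  source_length e := by
    refine Fin.addCases (fun e => ?_) (fun e => ?_) e
    · rw [Fin.append_left, Fin.append_left, List.length_map, G.source_length]
    · rw [Fin.append_right, Fin.append_right, List.length_map, H.source_length]
  target_length e := by
    refine Fin.addCases (fun e => ?_) (fun e => ?_) e
    · rw [Fin.append_left, Fin.append_left, List.length_map, G.target_length]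
    · rw [Fin.append_right, Fin.append_right, List.length_map, H.target_length]

/-- The first inclusion into the disjoint union. -/
def sumInl (G H : TypedHypergraph S) : G ⟶ sum G H where
  onV := Fin.castAdd H.V
  onE := Fin.castAdd H.E
  label_onE := Fin.append_left G.label H.label
  source_onE := Fin.append_left (fun e => (G.source e).map (Fin.castAdd H.V))
    (fun e => (H.source e).map (Fin.natAdd G.V))
  target_onE := Fin.append_left (fun e => (G.target e).map (Fin.castAdd H.V))
    (fun e => (H.target e).map (Fin.natAdd G.V))

/-- The second inclusion into the disjoint union. -/
def sumInr (G H : TypedHypergraph S) : H ⟶ sum G H where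
  onV := Fin.natAdd G.V
  onE := Fin.natAdd G.E
  label_onE := Fin.append_right G.label H.label
  source_onE := Fin.append_right (fun e => (G.source e).map (Fin.castAdd H.V))
    (fun e => (H.source e).map (Fin.natAdd G.V))
  target_onE := Fin.append_right (fun e => (G.target e).map (Fin.castAdd H.V))
    (fun e => (H.target e).map (Fin.natAdd G.V))

theorem bijective_sum_edges (G H : TypedHypergraph S) :
    Function.Bijective (Sum.elim (sumInl G H).onE (sumInr G H).onE) := by
  have h : Sum.elim (sumInl G H).onE (sumInr G H).onE = finSumFinEquiv := by
    funext e; rcases e with e | e <;> rfl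
  rw [h]
  exact finSumFinEquiv.bijective

theorem isPushout_sum (G H : TypedHypergraph S) (a : disc 0 ⟶ G) (b : disc 0 ⟶ H) :
    IsPushout a b (sumInl G H) (sumInr G H) :=
  isPushout_of_nodes_of_edges
    { comm := fun z => z.elim0
      cover := fun x => Fin.addCases (fun y => .inl ⟨y, rfl⟩) (fun y => .inr ⟨y, rfl⟩) x
      desc := fun k l _ => ⟨Fin.append k l, Fin.append_left k l, Fin.append_right k l⟩ }
    (bijective_sum_edges G H)

/-- The disjoint union is a coproduct. -/
noncomputable def coprodIsoSum (G H : TypedHypergraph S) : G ⨿ H ≅ sum G H where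
  hom := coprod.desc (sumInl G H) (sumInr G H)
  inv := (isPushout_sum G H (isInitialDiscZero.to G) (isInitialDiscZero.to H)).desc coprod.inl
    coprod.inr (isInitialDiscZero.hom_ext _ _)
  hom_inv_id := by
    refine coprod.hom_ext ?_ ?_
    · rw [coprod.inl_desc_assoc, IsPushout.inl_desc, Category.comp_id]
    · rw [coprod.inr_desc_assoc, IsPushout.inr_desc, Category.comp_id]
  inv_hom_id := by
    refine (isPushout_sum G H (isInitialDiscZero.to G) (isInitialDiscZero.to H)).hom_ext ?_ ?_
    · rw [IsPushout.inl_desc_assoc, coprod.inl_desc, Category.comp_id]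
    · rw [IsPushout.inr_desc_assoc, coprod.inr_desc, Category.comp_id]

end TypedHypergraph

namespace DiscCospan

open TypedHypergraph

variable {S : Signature.{u}}

/-- Replaces the chosen coproduct by one whose nodes and hyperedges are known, as evaluation
requires. -/
theorem tensor_equiv {a b c d : ℕ} (f : DiscCospan S a b) (g : DiscCospan S c d) :
    tensor f g ≈ ⟨sum f.apex g.apex,
      copair (f.left ≫ sumInl f.apex g.apex) (g.left ≫ sumInr f.apex g.apex),
      copair (f.right ≫ sumInl f.apex g.apex) (g.right ≫ sumInr f.apex g.apex)⟩ :=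
  ⟨coprodIsoSum f.apex g.apex, by simp [tensor, copair_comp, coprodIsoSum, coprod.inl_desc,
    coprod.inr_desc], by simp [tensor, copair_comp, coprodIsoSum, coprod.inl_desc,
    coprod.inr_desc]⟩

end DiscCospan

/-! ### Evaluation of cospans of hypergraphs -/

namespace PROP.FrobeniusStr

open TypedHypergraph

variable {P : PROP.{u}} (A : P.FrobeniusStr) {S : Signature.{u}} (I : ∀ n m, S n m → P.Hom n m)

/-- The state that is given by a hyperedge with given label, sources and targets. -/
def edgeState {n : ℕ} (l : Label S) (s t : List (Fin n)) (hs : s.length = l.arity)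
    (ht : t.length = l.coarity) : P.Hom 0 n :=
  P.comp (A.bend (I _ _ l.gen)) (A.push (Fin.append (fun i => s.get (i.cast hs.symm))
    (fun i => t.get (i.cast ht.symm))))

/-- The second label and lists are independent variables tied by equations, so that the dependent
length proofs never have to be rewritten. -/
theorem edgeState_push {n m : ℕ} (l : Label S) (s t : List (Fin n)) (hs : s.length = l.arity)
    (ht : t.length = l.coarity) (l' : Label S) (s' t' : List (Fin m)) (hs' : s'.length = l'.arity)
    (ht' : t'.length = l'.coarity) (h : Fin n → Fin m) (hl : l' = l) (hss : s' = s.map h)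
    (htt : t' = t.map h) :
    P.comp (A.edgeState I l s t hs ht) (A.push h) = A.edgeState I l' s' t' hs' ht' := by
  subst hl hss htt
  rw [edgeState, edgeState, P.comp_assoc, A.push_comp]
  refine congrArg _ (congrArg _ (Fin.funext_add (fun i => ?_) fun i => ?_))
  · rw [Fin.append_left, Fin.append_left]; simp
  · rw [Fin.append_right, Fin.append_right]; simp

/-- The product of the states that are given by the hyperedges of a hypergraph. -/
def edges (G : TypedHypergraph S) : P.Hom 0 G.V :=
  A.prodState fun e => A.edgeState I (G.label e) (G.source e) (G.target e) (G.source_length e)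
    (G.target_length e)

theorem edges_push {G H : TypedHypergraph S} (f : G ⟶ H) :
    P.comp (A.edges I G) (A.push f.onV) = A.prodState fun e =>
      A.edgeState I (H.label (f.onE e)) (H.source (f.onE e)) (H.target (f.onE e))
        (H.source_length _) (H.target_length _) := by
  rw [edges, prodState_push]
  exact congrArg _ (funext fun e => A.edgeState_push I _ _ _ _ _ _ _ _ _ _ _ (f.label_onE e)
    (f.source_onE e) (f.target_onE e))

theorem edges_of_bijective {G H : TypedHypergraph S} (f : G ⟶ H) (hf : Function.Bijective f.onE) :
    A.edges I H = P.comp (A.edges I G) (A.push f.onV) := by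
  rw [edges_push]
  exact (A.prodState_equiv (Equiv.ofBijective f.onE hf) _).symm

theorem edges_of_bijective_sum {G H K : TypedHypergraph S} (i : G ⟶ K) (j : H ⟶ K)
    (h : Function.Bijective (Sum.elim i.onE j.onE)) :
    A.edges I K = A.mulState (P.comp (A.edges I G) (A.push i.onV))
      (P.comp (A.edges I H) (A.push j.onV)) := by
  rw [edges_push, edges_push]
  exact (A.prodState_equiv (Equiv.ofBijective _ h) _).symm.trans (A.prodState_sum _)

theorem edges_disc (n : ℕ) : A.edges I (disc n) = A.unitState n :=
  A.prodState_empty (ι := Fin 0) _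

/-- The arrow that is given by a hypergraph with interfaces. -/
def evalGraph {n m : ℕ} (G : TypedHypergraph S) (f : Fin n → Fin G.V) (g : Fin m → Fin G.V) :
    P.Hom n m :=
  P.comp (A.push f) (P.comp (A.smul (A.edges I G)) (A.pull g))

/-- Multiplication by the edges can be moved past `push`, after which `push` and `pull` along the
bijection of nodes cancel. -/
theorem evalGraph_iso {n m : ℕ} {G H : TypedHypergraph S} (i : G ≅ H) (f : Fin n → Fin G.V)
    (g : Fin m → Fin G.V) :
    A.evalGraph I H (fun x => i.hom.onV (f x)) (fun x => i.hom.onV (g x)) = A.evalGraph I G f g := by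
  let σ : Fin G.V ≃ Fin H.V :=
    ⟨i.hom.onV, i.inv.onV, fun x => congrArg (fun f => Hom.onV f x) i.hom_inv_id,
      fun x => congrArg (fun f => Hom.onV f x) i.inv_hom_id⟩
  let τ : Fin G.E ≃ Fin H.E :=
    ⟨i.hom.onE, i.inv.onE, fun x => congrArg (fun f => Hom.onE f x) i.hom_inv_id,
      fun x => congrArg (fun f => Hom.onE f x) i.inv_hom_id⟩
  have hσ : P.comp (A.push i.hom.onV) (A.pull i.hom.onV) = P.id _ := by
    rw [← A.push_id]
    exact (congrArg (P.comp _) (A.pull_equiv σ)).trans ((A.push_comp _ _).trans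
      (congrArg _ (funext σ.symm_apply_apply)))
  rw [evalGraph, evalGraph, A.edges_of_bijective I i.hom τ.bijective, ← A.push_comp, ← A.pull_comp,
    P.comp_assoc, ← P.comp_assoc (A.push i.hom.onV), ← A.smul_push, P.comp_assoc (A.smul _),
    ← P.comp_assoc (A.push i.hom.onV), hσ, P.id_comp]

/-- The edges of `K` are those of `G` and `H`. The first are moved in front of `push i`, the second
behind `pull j`, and the Beck-Chevalley property replaces what is left between them by `pull g ;
push h`. -/
theorem evalGraph_comp {a b c : ℕ} {G H K : TypedHypergraph S} (i : G ⟶ K) (j : H ⟶ K)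
    (f : Fin a → Fin G.V) (g : Fin b → Fin G.V) (h : Fin b → Fin H.V) (k : Fin c → Fin H.V)
    (hV : Fin.IsPushout g h i.onV j.onV) (hE : Function.Bijective (Sum.elim i.onE j.onE)) :
    A.evalGraph I K (fun x => i.onV (f x)) (fun x => j.onV (k x)) =
      P.comp (A.evalGraph I G f g) (A.evalGraph I H h k) := by
  have hc : P.comp (A.push i.onV) (P.comp (A.smul (A.edges I K)) (A.pull j.onV)) =
      P.comp (A.smul (A.edges I G)) (P.comp (P.comp (A.pull g) (A.push h))
        (A.smul (A.edges I H))) := by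
    rw [A.edges_of_bijective_sum I i j hE, A.smul_mul, P.comp_assoc, A.smul_push_pull,
      ← P.comp_assoc, ← A.smul_push, P.comp_assoc, ← P.comp_assoc (A.push _), A.pull_push hV]
  have := congrArg (fun x => P.comp (A.push f) (P.comp x (A.pull k))) hc
  simp only [evalGraph]
  rw [← A.push_comp, ← A.pull_comp]
  simp only [P.comp_assoc] at this ⊢
  exact this

theorem evalGraph_sum {a b c d : ℕ} {G H : TypedHypergraph S} (f : Fin a → Fin G.V)
    (g : Fin b → Fin G.V) (h : Fin c → Fin H.V) (k : Fin d → Fin H.V) :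
    A.evalGraph I (sum G H) (Fin.sumMap f h) (Fin.sumMap g k) =
      P.tensor (A.evalGraph I G f g) (A.evalGraph I H h k) := by
  simp only [evalGraph]
  rw [P.tensor_comp, P.tensor_comp, A.tensor_push,
    A.tensor_pull, A.tensor_smul]
  have he := A.edges_of_bijective_sum I _ _ (bijective_sum_edges G H)
  exact congrArg (fun x => P.comp _ (P.comp (A.smul x) _)) he

theorem evalGraph_disc {n m k : ℕ} (f : Fin n → Fin k) (g : Fin m → Fin k) :
    A.evalGraph I (disc k) f g = P.comp (A.push f) (A.pull g) := by
  simp only [evalGraph]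
  rw [edges_disc]
  refine congrArg (P.comp (b := k) _) ?_
  exact (congrArg (fun x => P.comp x _) (A.smul_unitState k)).trans (P.id_comp _)

/-- The source and target lists together enumerate all nodes in order, so the single edge state is
`bend (I n m o)`, and the interfaces unbend it. -/
theorem evalGraph_gen {n m : ℕ} (o : S n m) :
    A.evalGraph I (genHypergraph o) (Fin.castAdd m) (Fin.natAdd n) = I n m o := by
  have h : A.edges I (genHypergraph o) = A.bend (I n m o) := by
    refine (A.prodState_unique (ι := Fin 1) _).trans ?_
    refine (congrArg (fun x => P.comp (A.bend (I n m o)) x) ?_).trans (P.comp_id _)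
    rw [← A.push_id]
    refine congrArg _ (Fin.funext_add (fun i => ?_) fun i => ?_)
    · exact (Fin.append_left _ _ i).trans (List.get_ofFn _ _)
    · exact (Fin.append_right _ _ i).trans (List.get_ofFn _ _)
  exact (congrArg (fun x => P.comp (A.push (Fin.castAdd m)) (P.comp (A.smul x)
    (A.pull (Fin.natAdd n)))) h).trans (A.push_smul_bend_pull (I n m o))

/-- The arrow that is given by a cospan. -/
def evalCospan {n m : ℕ} (c : DiscCospan S n m) : P.Hom n m :=
  A.evalGraph I c.apex c.left.onV c.right.onV

theorem evalCospan_congr {n m : ℕ} {c d : DiscCospan S n m} (h : c ≈ d) :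
    A.evalCospan I c = A.evalCospan I d := by
  obtain ⟨i, h₁, h₂⟩ := h
  rw [evalCospan, evalCospan, ← h₁, ← h₂]
  exact (A.evalGraph_iso I i _ _).symm

theorem evalCospan_comp {a b c : ℕ} (f : DiscCospan S a b) (g : DiscCospan S b c) :
    A.evalCospan I (f.comp g) = P.comp (A.evalCospan I f) (A.evalCospan I g) :=
  (A.evalCospan_congr I (f.comp_equiv g (isPushout_pushoutObj f.right g.left))).trans
    (A.evalGraph_comp I _ _ _ _ _ _ (isPushout_pushoutObj_nodes f.right g.left)
      (bijective_pushoutObj_edges f.right g.left))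

theorem evalCospan_tensor {a b c d : ℕ} (f : DiscCospan S a b) (g : DiscCospan S c d) :
    A.evalCospan I (f.tensor g) = P.tensor (A.evalCospan I f) (A.evalCospan I g) :=
  (A.evalCospan_congr I (f.tensor_equiv g)).trans (A.evalGraph_sum I _ _ _ _)

theorem evalCospan_ofHom {n m : ℕ} (f : (disc n : TypedHypergraph S) ⟶ disc m) :
    A.evalCospan I (.ofHom f) = A.push (f.onV : Fin n → Fin m) := by
  refine (A.evalGraph_disc I (f.onV : Fin n → Fin m) (fun i : Fin m => i)).trans ?_
  exact (congrArg (P.comp (b := m) _) (A.pull_id m)).trans (P.comp_id _)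

/-- The morphism of PROPs that is induced by a special Frobenius monoid and an interpretation of the
signature. -/
def eval : PROPHom (FTerm S) P where
  map := Quotient.lift (A.evalCospan I) fun _ _ => A.evalCospan_congr I
  map_id n := (A.evalCospan_ofHom I _).trans (A.push_id n)
  map_comp := by rintro a b c ⟨f⟩ ⟨g⟩; exact A.evalCospan_comp I f g
  map_tensor := by rintro a b c d ⟨f⟩ ⟨g⟩; exact A.evalCospan_tensor I f g
  map_symm n m := (A.evalCospan_ofHom I _).trans (A.push_blockSwap n m)

theorem eval_ofFun {n m k : ℕ} (f : Fin n → Fin k) (g : Fin m → Fin k) :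
    (A.eval I).map (FTerm.ofFun f g) = P.comp (A.push f) (A.pull g) :=
  A.evalGraph_disc I f g

theorem eval_gen {n m : ℕ} (o : S n m) : (A.eval I).map (FTerm.gen o) = I n m o :=
  A.evalGraph_gen I o

end PROP.FrobeniusStr

/-! ### Arrows of `FTerm` as hypergraphs with interfaces -/

theorem Fin.sumMap_id (n m : ℕ) :
    Fin.sumMap (fun i : Fin n => i) (fun i : Fin m => i) = fun i => i :=
  Fin.funext_add (fun i => Fin.sumMap_castAdd _ _ i) (fun i => Fin.sumMap_natAdd _ _ i)

theorem List.ofFn_get_cast {α : Type*} {s : List α} {n : ℕ} (h : s.length = n) :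
    List.ofFn (fun i : Fin n => s.get (i.cast h.symm)) = s := by
  subst h
  exact List.ofFn_get s

namespace TypedHypergraph

variable {S : Signature.{u}}

/-- The morphism out of a disjoint union that is given by two morphisms. -/
def sumDesc {G H K : TypedHypergraph S} (i : G ⟶ K) (j : H ⟶ K) : sum G H ⟶ K where
  onV := Fin.append i.onV j.onV
  onE := Fin.append i.onE j.onE
  label_onE e := by
    refine Fin.addCases (fun e => ?_) (fun e => ?_) e
    · rw [Fin.append_left, i.label_onE]; exact (Fin.append_left G.label H.label e).symm
    · rw [Fin.append_right, j.label_onE]; exact (Fin.append_right G.label H.label e).symm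
  source_onE e := by
    refine Fin.addCases (fun e => ?_) (fun e => ?_) e
    · rw [Fin.append_left, i.source_onE]
      refine Eq.trans ?_ (congrArg (List.map (Fin.append i.onV j.onV))
        ((sumInl G H).source_onE e)).symm
      refine Eq.trans ?_ List.map_map.symm
      exact congrArg (fun f => (G.source e).map f) (funext fun v => (Fin.append_left _ _ v).symm)
    · rw [Fin.append_right, j.source_onE]
      refine Eq.trans ?_ (congrArg (List.map (Fin.append i.onV j.onV))
        ((sumInr G H).source_onE e)).symm
      refine Eq.trans ?_ List.map_map.symm
      exact congrArg (fun f => (H.source e).map f) (funext fun v => (Fin.append_right _ _ v).symm)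
  target_onE e := by
    refine Fin.addCases (fun e => ?_) (fun e => ?_) e
    · rw [Fin.append_left, i.target_onE]
      refine Eq.trans ?_ (congrArg (List.map (Fin.append i.onV j.onV))
        ((sumInl G H).target_onE e)).symm
      refine Eq.trans ?_ List.map_map.symm
      exact congrArg (fun f => (G.target e).map f) (funext fun v => (Fin.append_left _ _ v).symm)
    · rw [Fin.append_right, j.target_onE]
      refine Eq.trans ?_ (congrArg (List.map (Fin.append i.onV j.onV))
        ((sumInr G H).target_onE e)).symm
      refine Eq.trans ?_ List.map_map.symm
      exact congrArg (fun f => (H.target e).map f) (funext fun v => (Fin.append_right _ _ v).symm)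

/-- The hypergraph with a single hyperedge. -/
def single {n : ℕ} (l : Label S) (s t : List (Fin n)) (hs : s.length = l.arity)
    (ht : t.length = l.coarity) : TypedHypergraph S where
  V := n
  E := 1
  label _ := l
  source _ := s
  target _ := t
  source_length _ := hs
  target_length _ := ht

/-- The morphism to a hypergraph with a single hyperedge that is given by the sources and targets of
the hyperedge. -/
def genToSingle {n : ℕ} (l : Label S) (s t : List (Fin n)) (hs : s.length = l.arity)
    (ht : t.length = l.coarity) : genHypergraph l.gen ⟶ single l s t hs ht where
  onV := Fin.append (fun i => s.get (i.cast hs.symm)) (fun i => t.get (i.cast ht.symm))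
  onE e := e
  label_onE _ := rfl
  source_onE e := by
    refine Eq.trans ?_ (List.map_ofFn).symm
    refine (List.ofFn_get_cast hs).symm.trans (congrArg List.ofFn (funext fun i => ?_))
    exact (Fin.append_left (fun i => s.get (i.cast hs.symm)) (fun i => t.get (i.cast ht.symm)) i).symm
  target_onE e := by
    refine Eq.trans ?_ (List.map_ofFn).symm
    refine (List.ofFn_get_cast ht).symm.trans (congrArg List.ofFn (funext fun i => ?_))
    exact (Fin.append_right (fun i => s.get (i.cast hs.symm)) (fun i => t.get (i.cast ht.symm)) i).symm

end TypedHypergraph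

namespace FTerm

open TypedHypergraph

variable {S : Signature.{u}}

/-- The arrow that is given by a hypergraph with interfaces. -/
def graph {n m : ℕ} (G : TypedHypergraph S) (f : Fin n → Fin G.V) (g : Fin m → Fin G.V) :
    (FTerm S).Hom n m := mk ⟨G, discHom f, discHom g⟩

theorem mk_eq_graph {n m : ℕ} (c : DiscCospan S n m) :
    mk c = graph c.apex c.left.onV c.right.onV := by
  obtain ⟨G, f, g⟩ := c
  exact congrArg₂ (fun f g => mk ⟨G, f, g⟩) (disc_ext fun _ => rfl) (disc_ext fun _ => rfl)

theorem graph_iso {n m : ℕ} {G H : TypedHypergraph S} (i : G ≅ H) (f : Fin n → Fin G.V)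
    (g : Fin m → Fin G.V) :
    graph H (fun x => i.hom.onV (f x)) (fun x => i.hom.onV (g x)) = graph G f g :=
  Quotient.sound (Setoid.symm ⟨i, disc_ext fun _ => rfl, disc_ext fun _ => rfl⟩)

theorem graph_comp {a b c : ℕ} {G H K : TypedHypergraph S} (i : G ⟶ K) (j : H ⟶ K)
    (f : Fin a → Fin G.V) (g : Fin b → Fin G.V) (h : Fin b → Fin H.V) (k : Fin c → Fin H.V)
    (hV : Fin.IsPushout g h i.onV j.onV) (hE : Function.Bijective (Sum.elim i.onE j.onE)) :
    (FTerm S).comp (graph G f g) (graph H h k) =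
      graph K (fun x => i.onV (f x)) (fun x => j.onV (k x)) := by
  refine Eq.trans (Quotient.sound (DiscCospan.comp_equiv ⟨G, discHom f, discHom g⟩
    ⟨H, discHom h, discHom k⟩ (isPushout_of_nodes_of_edges hV hE))) ?_
  exact mk_eq_graph _

theorem graph_sum {a b c d : ℕ} (G H : TypedHypergraph S) (f : Fin a → Fin G.V)
    (g : Fin b → Fin G.V) (h : Fin c → Fin H.V) (k : Fin d → Fin H.V) :
    (FTerm S).tensor (graph G f g) (graph H h k) =
      graph (sum G H) (Fin.sumMap f h) (Fin.sumMap g k) :=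
  (Quotient.sound (DiscCospan.tensor_equiv ⟨G, discHom f, discHom g⟩
    ⟨H, discHom h, discHom k⟩)).trans (mk_eq_graph _)

/-- A hypergraph without hyperedges is discrete. -/
def isoDisc (G : TypedHypergraph S) (h : G.E = 0) : G ≅ disc G.V where
  hom := ⟨fun v => v, fun e => e.cast h, fun e => (e.cast h).elim0, fun e => (e.cast h).elim0,
    fun e => (e.cast h).elim0⟩
  inv := discHom fun v => v
  hom_inv_id := hom_ext (fun _ => rfl) fun e => (e.cast h).elim0
  inv_hom_id := disc_ext fun _ => rfl

theorem graph_eq_ofFun {n m : ℕ} (G : TypedHypergraph S) (h : G.E = 0) (f : Fin n → Fin G.V)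
    (g : Fin m → Fin G.V) : graph G f g = ofFun f g :=
  (graph_iso (isoDisc G h) f g).symm

theorem ofFun_tensor {a b c d k l : ℕ} (f : Fin a → Fin k) (g : Fin b → Fin k) (f' : Fin c → Fin l)
    (g' : Fin d → Fin l) :
    (FTerm S).tensor (ofFun f g) (ofFun f' g') = ofFun (Fin.sumMap f f') (Fin.sumMap g g') :=
  (graph_sum (disc k) (disc l) f g f' g').trans (graph_eq_ofFun _ rfl _ _)

theorem ofFun_comp {a b c k l w : ℕ} (f : Fin a → Fin k) (g : Fin b → Fin k) (h : Fin b → Fin l)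
    (t : Fin c → Fin l) {i : Fin k → Fin w} {j : Fin l → Fin w} (hV : Fin.IsPushout g h i j) :
    (FTerm S).comp (ofFun f g) (ofFun h t) = ofFun (fun x => i (f x)) (fun x => j (t x)) := by
  refine graph_comp (K := disc w) (G := disc k) (H := disc l) (discHom (G := disc w) i)
    (discHom (G := disc w) j) f g h t hV ⟨?_, fun e => Fin.elim0 e⟩
  rintro (e | e) <;> exact Fin.elim0 e

theorem ofFun_id (n : ℕ) : ofFun (fun i : Fin n => i) (fun i => i) = (FTerm S).id n :=
  (mk_eq_graph (.ofHom (𝟙 (disc n)))).symm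

theorem ofFun_blockSwap (n m : ℕ) :
    ofFun (Fin.blockSwap n m) (fun i => i) = (FTerm S).symm n m :=
  (mk_eq_graph (.ofHom (DiscCospan.swap n m))).symm

theorem ofFun_equiv {n m k l : ℕ} (σ : Fin k ≃ Fin l) (f : Fin n → Fin k) (g : Fin m → Fin k) :
    (ofFun (fun x => σ (f x)) (fun x => σ (g x)) : (FTerm S).Hom n m) = ofFun f g :=
  graph_iso (G := disc k) (H := disc l) ⟨discHom (G := disc l) σ, discHom (G := disc k) σ.symm,
    disc_ext σ.symm_apply_apply, disc_ext σ.apply_symm_apply⟩ f g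

theorem ofFun_comp_left {a b c l : ℕ} (f : Fin a → Fin b) (h : Fin b → Fin l) (t : Fin c → Fin l) :
    (FTerm S).comp (ofFun f fun i => i) (ofFun h t) = ofFun (fun x => h (f x)) t :=
  ofFun_comp f _ h t (i := h) (j := fun i => i)
    ⟨fun _ => rfl, fun _ => .inr ⟨_, rfl⟩, fun _ l e => ⟨l, fun y => (e y).symm, fun _ => rfl⟩⟩

theorem ofFun_comp_right {a b c k : ℕ} (f : Fin a → Fin k) (g : Fin b → Fin k) (t : Fin c → Fin b) :
    (FTerm S).comp (ofFun f g) (ofFun (fun i => i) t) = ofFun f (fun x => g (t x)) :=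
  ofFun_comp f g _ t (i := fun i => i) (j := g)
    ⟨fun _ => rfl, fun x => .inl ⟨x, rfl⟩, fun k _ e => ⟨k, fun _ => rfl, e⟩⟩

/-! ### The special Frobenius monoid of discrete cospans -/

/-- If every compatible pair of functions is constant with a common value, the pushout of the nodes
is a point. Most special Frobenius laws hold because both sides are cospans over one node. -/
theorem ofFun_comp_connected {a b c k l : ℕ} (f : Fin a → Fin k) (g : Fin b → Fin k)
    (h : Fin b → Fin l) (t : Fin c → Fin l) (y₀ : Fin k)
    (hc : ∀ (n : ℕ) (p : Fin k → Fin n) (q : Fin l → Fin n), (∀ z, p (g z) = q (h z)) →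
      (∀ y, p y = p y₀) ∧ ∀ y, q y = p y₀) :
    (FTerm S).comp (ofFun f g) (ofFun h t) = ofFun (N := 1) (fun _ => 0) (fun _ => 0) :=
  ofFun_comp f g h t (i := fun _ => 0) (j := fun _ => 0)
    ⟨fun _ => rfl, fun _ => .inl ⟨y₀, Subsingleton.elim _ _⟩, fun p q e =>
      ⟨fun _ => p y₀, fun y => ((hc _ p q e).1 y).symm, fun y => ((hc _ p q e).2 y).symm⟩⟩

theorem ofFun_eq {n m : ℕ} (f f' : Fin n → Fin 1) (g g' : Fin m → Fin 1) :
    (ofFun f g : (FTerm S).Hom n m) = ofFun f' g' :=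
  congrArg₂ ofFun (Subsingleton.elim _ _) (Subsingleton.elim _ _)

theorem id_one_eq : (FTerm S).id 1 = ofFun (N := 1) (fun _ => 0) (fun _ => 0) :=
  (ofFun_id 1).symm.trans (ofFun_eq _ _ _ _)

variable (S)

/-- The special Frobenius monoid that is given by the cospans of discrete hypergraphs with a single
node. -/
def frobeniusStr : (FTerm S).FrobeniusStr where
  mul := ofFun (N := 1) (fun _ => 0) (fun _ => 0)
  one := ofFun (N := 1) (fun _ => 0) (fun _ => 0)
  comul := ofFun (N := 1) (fun _ => 0) (fun _ => 0)
  counit := ofFun (N := 1) (fun _ => 0) (fun _ => 0)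
  mul_comm := by
    rw [← ofFun_blockSwap]
    exact (ofFun_comp_left _ _ _)
  mul_assoc := by
    rw [id_one_eq, ofFun_tensor, ofFun_tensor]
    refine Eq.trans (ofFun_comp_connected _ _ _ _ 0 ?_) (ofFun_comp_connected _ _ _ _ 0 ?_).symm <;>
    · intro n p q h
      simp [Fin.forall_fin_succ, Fin.sumMap, Fin.append, Fin.addCases] at h ⊢
      grind
  one_mul := by
    rw [id_one_eq, ofFun_tensor]
    refine ofFun_comp_connected _ _ _ _ 0 ?_
    intro n p q h
    simp [Fin.forall_fin_succ, Fin.sumMap, Fin.append, Fin.addCases] at h ⊢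
    grind
  mul_one := by
    rw [id_one_eq, ofFun_tensor]
    refine ofFun_comp_connected _ _ _ _ 0 ?_
    intro n p q h
    simp [Fin.forall_fin_succ, Fin.sumMap, Fin.append, Fin.addCases] at h ⊢
    grind
  comul_comm := by
    rw [← ofFun_blockSwap]
    refine ofFun_comp_connected _ _ _ _ 0 ?_
    intro n p q h
    simp [Fin.forall_fin_succ, Fin.blockSwap, Fin.append, Fin.addCases] at h ⊢
    grind
  comul_assoc := by
    rw [id_one_eq, ofFun_tensor, ofFun_tensor]
    refine Eq.trans (ofFun_comp_connected _ _ _ _ 0 ?_) (ofFun_comp_connected _ _ _ _ 0 ?_).symm <;>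
    · intro n p q h
      simp [Fin.forall_fin_succ, Fin.sumMap, Fin.append, Fin.addCases] at h ⊢
      grind
  counit_comul := by
    rw [id_one_eq, ofFun_tensor]
    refine ofFun_comp_connected _ _ _ _ 0 ?_
    intro n p q h
    simp [Fin.forall_fin_succ, Fin.sumMap, Fin.append, Fin.addCases] at h ⊢
    grind
  comul_counit := by
    rw [id_one_eq, ofFun_tensor]
    refine ofFun_comp_connected _ _ _ _ 0 ?_
    intro n p q h
    simp [Fin.forall_fin_succ, Fin.sumMap, Fin.append, Fin.addCases] at h ⊢
    grind
  frob_left := by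
    rw [id_one_eq, ofFun_tensor, ofFun_tensor]
    refine Eq.trans (ofFun_comp_connected _ _ _ _ 0 ?_) (ofFun_comp_connected _ _ _ _ 0 ?_).symm <;>
    · intro n p q h
      simp [Fin.forall_fin_succ, Fin.sumMap, Fin.append, Fin.addCases] at h ⊢
      grind
  frob_right := by
    rw [id_one_eq, ofFun_tensor, ofFun_tensor]
    refine Eq.trans (ofFun_comp_connected _ _ _ _ 0 ?_) (ofFun_comp_connected _ _ _ _ 0 ?_).symm <;>
    · intro n p q h
      simp [Fin.forall_fin_succ, Fin.sumMap, Fin.append, Fin.addCases] at h ⊢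
      grind
  special := by
    rw [id_one_eq]
    refine ofFun_comp_connected _ _ _ _ 0 ?_
    intro n p q h
    simp [Fin.forall_fin_succ] at h ⊢
    grind

end FTerm

/-! ### Generation of `FTerm` by hyperedges and the Frobenius structure -/

namespace Fin

theorem append_id_natAdd_sumMap (k l : ℕ) : (fun x => append (fun i : Fin (k + l) => i) (natAdd k)
    (sumMap (castAdd l) (fun i : Fin l => i) x)) = fun i => i := by
  refine funext_add (fun i => ?_) fun i => ?_
  · rw [sumMap_castAdd, append_left]
  · rw [sumMap_natAdd, append_right]

theorem append_sumMap_elim0 {b k n : ℕ} (g : Fin b → Fin k) (r : Fin n → Fin k) :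
    (fun x => append (fun i : Fin k => i) r (sumMap g (Fin.elim0 : Fin 0 → Fin n) x)) = g := by
  refine funext fun i => ?_
  rw [sumMap_elim0_right]
  exact append_left _ _ _

/-- Serves to bend the targets of a hyperedge: `l` further nodes are glued to the last `l` of `k +
l` nodes. -/
theorem isPushout_fold (k l : ℕ) : IsPushout (sumMap (natAdd k : Fin l → Fin (k + l))
    (fun i : Fin l => i)) (fold l) (append (fun i => i) (natAdd k)) (natAdd k) where
  comm := by
    refine funext_iff.1 (funext_add (fun i => ?_) fun i => ?_)
    · rw [sumMap_castAdd, fold_castAdd, append_left]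
    · rw [sumMap_natAdd, fold_natAdd, append_right]
  cover x := .inl ⟨castAdd l x, append_left _ _ x⟩
  desc p q e := by
    have e₁ : ∀ z : Fin l, p (castAdd l (natAdd k z)) = q z := fun z => by
      have := e (castAdd l z)
      rwa [sumMap_castAdd, fold_castAdd] at this
    have e₂ : ∀ z : Fin l, p (natAdd (k + l) z) = q z := fun z => by
      have := e (natAdd l z)
      rwa [sumMap_natAdd, fold_natAdd] at this
    refine ⟨fun x => p (castAdd l x), funext_iff.1 (funext_add (fun i => ?_) fun i => ?_), e₁⟩
    · rw [append_left]
    · rw [append_right]; exact (e₁ i).trans (e₂ i).symm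

end Fin

namespace FTerm

open TypedHypergraph

variable {S : Signature.{u}}

/-- The arrows of `FTerm S` are generated by the hyperedges and by the cospans of discrete
hypergraphs with a single node. -/
theorem hom_induction {C : ∀ {n m : ℕ}, (FTerm S).Hom n m → Prop}
    (id : ∀ n, C ((FTerm S).id n))
    (comp : ∀ {a b c : ℕ} {f : (FTerm S).Hom a b} {g : (FTerm S).Hom b c}, C f → C g →
      C ((FTerm S).comp f g))
    (tensor : ∀ {a b c d : ℕ} {f : (FTerm S).Hom a b} {g : (FTerm S).Hom c d}, C f → C g →
      C ((FTerm S).tensor f g))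
    (symm : ∀ n m, C ((FTerm S).symm n m))
    (gen : ∀ {n m : ℕ} (o : S n m), C (FTerm.gen o))
    (mul : C (frobeniusStr S).mul) (one : C (frobeniusStr S).one)
    (comul : C (frobeniusStr S).comul) (counit : C (frobeniusStr S).counit)
    {n m : ℕ} (f : (FTerm S).Hom n m) : C f := by
  have hpush : ∀ {a b : ℕ} (h : Fin a → Fin b), C (ofFun h fun i => i) := by
    intro a b h
    induction h using Fin.map_induction with
    | id n => rw [ofFun_id]; exact id n
    | comp ih₁ ih₂ => rw [← ofFun_comp_left]; exact comp ih₁ ih₂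
    | sum ih₁ ih₂ =>
      have := tensor ih₁ ih₂
      rwa [ofFun_tensor, Fin.sumMap_id] at this
    | swap => rw [ofFun_blockSwap]; exact symm 1 1
    | mul h => rw [ofFun_eq h (fun _ => 0) _ (fun _ => 0)]; exact mul
    | unit h => rw [ofFun_eq h (fun _ => 0) _ (fun _ => 0)]; exact one
  have hpull : ∀ {a b : ℕ} (h : Fin a → Fin b), C (ofFun (fun i => i) h) := by
    intro a b h
    induction h using Fin.map_induction with
    | id n => rw [ofFun_id]; exact id n
    | comp ih₁ ih₂ => rw [← ofFun_comp_right]; exact comp ih₂ ih₁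
    | sum ih₁ ih₂ =>
      have := tensor ih₁ ih₂
      rwa [ofFun_tensor, Fin.sumMap_id] at this
    | swap =>
      -- Renumbering the nodes of the apex moves the exchange from one leg to the other.
      have h := ofFun_equiv (S := S) ⟨Fin.blockSwap 1 1, Fin.blockSwap 1 1, by decide, by decide⟩
        (Fin.blockSwap 1 1) (fun i => i)
      have h' : (fun x => Fin.blockSwap 1 1 (Fin.blockSwap 1 1 x)) = fun i => i := by decide
      rw [ofFun_blockSwap] at h
      have := symm 1 1
      rw [← h] at this
      exact h' ▸ this
    | mul h => rw [ofFun_eq _ (fun _ => 0) h (fun _ => 0)]; exact comul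
    | unit h => rw [ofFun_eq _ (fun _ => 0) h (fun _ => 0)]; exact counit
  have hfun : ∀ {a b k : ℕ} (f : Fin a → Fin k) (g : Fin b → Fin k), C (ofFun f g) := by
    intro a b k f g
    have h := ofFun_comp_left (S := S) f (fun i => i) g
    rw [← h]
    exact comp (hpush f) (hpull g)
  -- All nodes are made accessible from the left: the generator stands beside `l` identity wires,
  -- and a discrete cospan joins its targets to these wires and closes them.
  have hbent : ∀ {k l : ℕ} (o : S k l), C (graph (genHypergraph o) (fun i : Fin (k + l) => i)
      (Fin.elim0 : Fin 0 → Fin (k + l))) := by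
    intro k l o
    have h := graph_comp (K := genHypergraph o)
      (sumDesc (𝟙 (genHypergraph o)) (discHom (G := genHypergraph o) (Fin.natAdd k)))
      (discHom (G := genHypergraph o) (Fin.natAdd k : Fin l → Fin (k + l)))
      (Fin.sumMap (Fin.castAdd l) (fun i : Fin l => i)) (Fin.sumMap (Fin.natAdd k) (fun i : Fin l => i))
      (Fin.fold l) (Fin.elim0 : Fin 0 → Fin l) (Fin.isPushout_fold k l) ⟨?_, ?_⟩
    · have h₁ := Fin.append_id_natAdd_sumMap k l
      have h₂ : (fun x => (discHom (G := genHypergraph o) (Fin.natAdd k : Fin l → Fin (k + l))).onV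
          (Fin.elim0 x)) = (Fin.elim0 : Fin 0 → Fin (k + l)) := funext fun x => x.elim0
      have h₃ := graph_sum (genHypergraph o) (disc l) (Fin.castAdd l : Fin k → Fin (k + l))
        (Fin.natAdd k) (fun i : Fin l => i) (fun i => i)
      refine Eq.mp (congrArg C (h.trans (congrArg₂ (graph (genHypergraph o)) h₁ h₂))) (comp ?_ ?_)
      · exact Eq.mp (congrArg C h₃) (tensor (gen o) (Eq.mpr (congrArg C (ofFun_id l)) (id l)))
      · exact hfun (Fin.fold l) (Fin.elim0 : Fin 0 → Fin l)
    · rintro (x | x) (y | y) _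
      · exact congrArg _ (Subsingleton.elim (α := Fin 1) x y)
      · exact Fin.elim0 y
      · exact Fin.elim0 x
      · exact Fin.elim0 x
    · exact fun x => ⟨.inl (0 : Fin 1), Subsingleton.elim (α := Fin 1) _ _⟩
  -- The bent generator is placed beside `k` nodes, and the discrete cospan before it merges its
  -- nodes with the prescribed sources and targets.
  have hsingle : ∀ {b k : ℕ} (l : Label S) (s t : List (Fin k)) (hs : s.length = l.arity)
      (ht : t.length = l.coarity) (g : Fin b → Fin k),
      C (graph (single l s t hs ht) (fun i : Fin k => i) g) := by
    intro b k l s t hs ht g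
    have h := graph_comp (G := disc k) (H := sum (disc k) (genHypergraph l.gen))
      (K := single l s t hs ht) (discHom (G := single l s t hs ht) fun i : Fin k => i)
      (sumDesc (discHom (G := single l s t hs ht) fun i : Fin k => i) (genToSingle l s t hs ht))
      (fun i : Fin k => i) (Fin.append (fun i : Fin k => i) (genToSingle l s t hs ht).onV)
      (fun i => i) (Fin.sumMap g (Fin.elim0 : Fin 0 → Fin (l.arity + l.coarity)))
      ⟨fun _ => rfl, fun x => .inl ⟨x, rfl⟩, fun k _ e => ⟨k, fun _ => rfl, e⟩⟩ ⟨?_, ?_⟩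
    · have h₁ := Fin.append_sumMap_elim0 g (genToSingle l s t hs ht).onV
      have h₂ := graph_sum (disc k) (genHypergraph l.gen) (fun i : Fin k => i) g
        (fun i : Fin (l.arity + l.coarity) => i) Fin.elim0
      have h₃ := Fin.sumMap_id k (l.arity + l.coarity)
      refine Eq.mp (congrArg C (h.trans (congrArg (graph (single l s t hs ht) fun i : Fin k => i)
        h₁))) (comp (hfun _ _) ?_)
      refine Eq.mp (congrArg C (h₂.trans (congrArg (fun x => graph (sum (disc k)
        (genHypergraph l.gen)) x _) h₃))) (tensor (hfun _ _) (hbent l.gen))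
    · rintro (x | x) (y | y) _
      · exact Fin.elim0 x
      · exact Fin.elim0 x
      · exact Fin.elim0 y
      · exact congrArg _ (Subsingleton.elim (α := Fin 1) x y)
    · exact fun x => ⟨.inr (0 : Fin (0 + 1)), Subsingleton.elim (α := Fin 1) _ _⟩
  -- Induction on the number of hyperedges: hyperedge `0` is split off, and composition along all
  -- the nodes glues it back.
  have hgraph : ∀ (k : ℕ) (G : TypedHypergraph S), G.E = k →
      ∀ {a b : ℕ} (f : Fin a → Fin G.V) (g : Fin b → Fin G.V), C (graph G f g) := by
    intro k
    induction k with
    | zero => intro G hG a b f g; rw [graph_eq_ofFun G hG]; exact hfun f g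
    | succ k ih =>
      rintro ⟨v, E, label, source, target, hs, ht⟩ hG a b f g
      cases hG
      let G' : TypedHypergraph S := ⟨v, k, fun e => label e.succ, fun e => source e.succ,
        fun e => target e.succ, fun e => hs e.succ, fun e => ht e.succ⟩
      have h := graph_comp (G := G') (H := single (label 0) (source 0) (target 0) (hs 0) (ht 0))
        (K := ⟨v, k + 1, label, source, target, hs, ht⟩)
        ⟨fun i => i, Fin.succ, fun _ => rfl, fun e => (List.map_id _).symm,
          fun e => (List.map_id _).symm⟩
        ⟨fun i => i, fun _ => 0, fun _ => rfl, fun e => (List.map_id _).symm,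
          fun e => (List.map_id _).symm⟩
        f (fun i => i) (fun i => i) g
        ⟨fun _ => rfl, fun x => .inl ⟨x, rfl⟩, fun k l e => ⟨k, fun _ => rfl, e⟩⟩ ?_
      · refine Eq.mp (congrArg C h) (comp (ih G' rfl f fun i => i) (hsingle _ _ _ _ _ g))
      · refine ⟨?_, fun e => ?_⟩
        · rintro (x | x) (y | y) hxy
          · exact congrArg _ (Fin.succ_injective _ hxy)
          · exact (Fin.succ_ne_zero _ hxy).elim
          · exact (Fin.succ_ne_zero _ hxy.symm).elim
          · exact congrArg _ (Subsingleton.elim (α := Fin 1) x y)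
        · refine Fin.cases ⟨.inr (0 : Fin 1), rfl⟩ (fun e => ⟨.inl e, rfl⟩) e
  obtain ⟨c⟩ := f
  exact Eq.mpr (congrArg C (mk_eq_graph c)) (hgraph _ _ rfl _ _)

end FTerm

/-! ### Universal property of presented PROPs -/

namespace Term

variable {S : Signature.{u}} {X : PROP.{u}} (I : ∀ n m, S n m → X.Hom n m)

/-- The value of a term under an interpretation of the signature. -/
def eval : ∀ {n m : ℕ}, Term S n m → X.Hom n m
  | _, _, .gen o => I _ _ o
  | _, _, .id n => X.id n
  | _, _, .symm n m => X.symm n m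
  | _, _, .comp f g => X.comp (eval f) (eval g)
  | _, _, .tensor f g => X.tensor (eval f) (eval g)

theorem eval_eqHom {n m : ℕ} (h : n = m) : (Term.eqHom h : Term S n m).eval I = X.eqHom h := by
  subst h; rfl

theorem eval_eq_of_rel {E : ∀ n m : ℕ, Term S n m → Term S n m → Prop}
    (hE : ∀ n m s t, E n m s t → s.eval I = t.eval I) {n m : ℕ} {s t : Term S n m}
    (h : Rel E s t) : s.eval I = t.eval I := by
  induction h with
  | of_eqn h => exact hE _ _ _ _ h
  | refl t => rfl
  | symmetric _ ih => exact ih.symm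
  | trans _ _ ih₁ ih₂ => exact ih₁.trans ih₂
  | comp_congr _ _ ih₁ ih₂ => exact congrArg₂ X.comp ih₁ ih₂
  | tensor_congr _ _ ih₁ ih₂ => exact congrArg₂ X.tensor ih₁ ih₂
  | id_comp f => exact X.id_comp _
  | comp_id f => exact X.comp_id _
  | comp_assoc f g h => exact X.comp_assoc _ _ _
  | tensor_id n m => exact X.tensor_id n m
  | tensor_comp f g f' g' => exact X.tensor_comp _ _ _ _
  | tensor_assoc f g h =>
    simp only [eval, eval_eqHom]
    exact X.tensor_assoc _ _ _
  | id_zero_tensor f =>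
    simp only [eval, eval_eqHom]
    exact X.id_zero_tensor _
  | tensor_id_zero f => exact X.tensor_id_zero _
  | symm_symm n m => exact X.symm_symm n m
  | symm_naturality f g => exact X.symm_naturality _ _
  | symm_add n m k =>
    simp only [eval, eval_eqHom]
    exact X.symm_add n m k

end Term

namespace presentedPROP

variable {S : Signature.{u}} {E : ∀ n m : ℕ, Term S n m → Term S n m → Prop} {X : PROP.{u}}

/-- The morphism out of a presented PROP that is given by an interpretation of the signature. -/
def lift (I : ∀ n m, S n m → X.Hom n m) (hE : ∀ n m s t, E n m s t → s.eval I = t.eval I) :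
    presentedPROP S E ⟶ X :=
  PROPHom.mk (Quot.lift (Term.eval I) fun _ _ => Term.eval_eq_of_rel I hE) (fun _ => rfl)
    (by rintro a b c ⟨f⟩ ⟨g⟩; rfl) (by rintro a b c d ⟨f⟩ ⟨g⟩; rfl) (fun _ _ => rfl)

theorem hom_ext {F G : presentedPROP S E ⟶ X}
    (h : ∀ (n m : ℕ) (o : S n m), F.map (gen E o) = G.map (gen E o)) : F = G := by
  suffices h' : ∀ {n m : ℕ} (t : Term S n m),
      F.map (Quot.mk (Term.Rel E) t : (presentedPROP S E).Hom n m) = G.map (Quot.mk _ t) from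
    PROPHom.ext (funext fun n => funext fun m => funext fun f => by obtain ⟨t⟩ := f; exact h' t)
  intro n m t
  induction t with
  | gen o => exact h _ _ o
  | id n => exact (F.map_id n).trans (G.map_id n).symm
  | symm n m => exact (F.map_symm n m).trans (G.map_symm n m).symm
  | comp f g ih₁ ih₂ =>
    exact (F.map_comp _ _).trans ((congrArg₂ X.comp ih₁ ih₂).trans (G.map_comp _ _).symm)
  | tensor f g ih₁ ih₂ =>
    exact (F.map_tensor _ _).trans ((congrArg₂ X.tensor ih₁ ih₂).trans (G.map_tensor _ _).symm)

variable {mu : Term S 2 1} {eta : Term S 0 1} {delta : Term S 1 2} {eps : Term S 1 0}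

/-- The special Frobenius monoid in a PROP whose presentation contains the equations of special
Frobenius monoids. -/
def frobeniusStr (h : ∀ n m s t, FrobEqn mu eta delta eps n m s t → E n m s t) :
    (presentedPROP S E).FrobeniusStr where
  mul := Quot.mk _ mu
  one := Quot.mk _ eta
  comul := Quot.mk _ delta
  counit := Quot.mk _ eps
  mul_comm := Quot.sound (.of_eqn (h _ _ _ _ .comm))
  mul_assoc := Quot.sound (.of_eqn (h _ _ _ _ .assoc))
  one_mul := Quot.sound (.of_eqn (h _ _ _ _ .unit_left))
  mul_one := Quot.sound (.of_eqn (h _ _ _ _ .unit_right))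
  comul_comm := Quot.sound (.of_eqn (h _ _ _ _ .cocomm))
  comul_assoc := Quot.sound (.of_eqn (h _ _ _ _ .coassoc))
  counit_comul := Quot.sound (.of_eqn (h _ _ _ _ .counit_left))
  comul_counit := Quot.sound (.of_eqn (h _ _ _ _ .counit_right))
  frob_left := Quot.sound (.of_eqn (h _ _ _ _ .frob_left))
  frob_right := Quot.sound (.of_eqn (h _ _ _ _ .frob_right))
  special := Quot.sound (.of_eqn (h _ _ _ _ .special))

end presentedPROP

/-! ### The coproduct and the presentation -/

namespace PROP.FrobeniusStr

variable {P Q : PROP.{u}} (A : P.FrobeniusStr)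

/-- The image of a special Frobenius monoid under a morphism of PROPs. -/
def image (F : P ⟶ Q) : Q.FrobeniusStr where
  mul := F.map A.mul
  one := F.map A.one
  comul := F.map A.comul
  counit := F.map A.counit
  mul_comm := by simpa only [F.map_comp, F.map_symm] using congrArg F.map A.mul_comm
  mul_assoc := by
    simpa only [F.map_comp, F.map_tensor, F.map_id] using congrArg F.map A.mul_assoc
  one_mul := by simpa only [F.map_comp, F.map_tensor, F.map_id] using congrArg F.map A.one_mul
  mul_one := by simpa only [F.map_comp, F.map_tensor, F.map_id] using congrArg F.map A.mul_one
  comul_comm := by simpa only [F.map_comp, F.map_symm] using congrArg F.map A.comul_comm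
  comul_assoc := by
    simpa only [F.map_comp, F.map_tensor, F.map_id] using congrArg F.map A.comul_assoc
  counit_comul := by
    simpa only [F.map_comp, F.map_tensor, F.map_id] using congrArg F.map A.counit_comul
  comul_counit := by
    simpa only [F.map_comp, F.map_tensor, F.map_id] using congrArg F.map A.comul_counit
  frob_left := by
    simpa only [F.map_comp, F.map_tensor, F.map_id] using congrArg F.map A.frob_left
  frob_right := by
    simpa only [F.map_comp, F.map_tensor, F.map_id] using congrArg F.map A.frob_right
  special := by simpa only [F.map_comp, F.map_tensor, F.map_id] using congrArg F.map A.special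

/-- The interpretation of the signature of special Frobenius monoids in a special Frobenius
monoid. -/
def interp : ∀ n m, FrobGen.{u} n m → P.Hom n m
  | _, _, .mult => A.mul
  | _, _, .unit => A.one
  | _, _, .comult => A.comul
  | _, _, .counit => A.counit

/-- The equations of special Frobenius monoids hold in a special Frobenius monoid. -/
theorem eval_eq_of_frobEqn {S : Signature.{u}} (I : ∀ n m, S n m → P.Hom n m) {mu : Term S 2 1}
    {eta : Term S 0 1} {delta : Term S 1 2} {eps : Term S 1 0} (hm : mu.eval I = A.mul)
    (hu : eta.eval I = A.one) (hd : delta.eval I = A.comul) (he : eps.eval I = A.counit) {n m : ℕ}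
    {s t : Term S n m} (h : FrobEqn mu eta delta eps n m s t) : s.eval I = t.eval I := by
  cases h <;> simp only [Term.eval, hm, hu, hd, he]
  exacts [A.mul_comm, A.mul_assoc, A.one_mul, A.mul_one, A.comul_comm, A.comul_assoc,
    A.counit_comul, A.comul_counit, A.frob_left, A.frob_right, A.special]

/-- Each generator is a cospan over `1` with one leg `1 → 1`, necessarily the identity, so only one
of `push` and `pull` contributes. -/
theorem eval_frobeniusStr {S : Signature.{u}} (I : ∀ n m, S n m → P.Hom n m) {n m : ℕ}
    (o : FrobGen.{u} n m) :
    (A.eval I).map ((FTerm.frobeniusStr S).interp n m o) = A.interp n m o := by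
  have h₁ : ∀ h : Fin 1 → Fin 1, A.push h = P.id 1 := fun h =>
    (congrArg A.push (Subsingleton.elim _ _)).trans (A.push_id 1)
  have h₂ : ∀ h : Fin 1 → Fin 1, A.pull h = P.id 1 := fun h =>
    (congrArg A.pull (Subsingleton.elim _ _)).trans (A.pull_id 1)
  cases o <;> refine (A.eval_ofFun I _ _).trans ?_
  · rw [A.push_two_one, h₂, P.comp_id]; rfl
  · rw [A.push_zero_one, h₂, P.comp_id]; rfl
  · rw [A.pull_two_one, h₁, P.id_comp]; rfl
  · rw [A.pull_zero_one, h₁, P.id_comp]; rfl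

end PROP.FrobeniusStr

namespace FTerm

variable {S : Signature.{u}} {P : PROP.{u}}

theorem interp_frobeniusStr {n m : ℕ} (o : FrobGen.{u} n m) :
    (frobeniusStr S).interp n m o = ofFun (N := 1) (fun _ => 0) (fun _ => 0) := by
  cases o <;> rfl

/-- The uniqueness half of the universal properties, by `hom_induction`. -/
theorem hom_ext {F G : FTerm S ⟶ P} (h : ∀ (n m : ℕ) (o : S n m), F.map (gen o) = G.map (gen o))
    (h' : ∀ (n m : ℕ) (o : FrobGen.{u} n m), F.map ((frobeniusStr S).interp n m o) =
      G.map ((frobeniusStr S).interp n m o)) : F = G := by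
  refine PROPHom.ext (funext fun n => funext fun m => funext fun f => ?_)
  induction f using hom_induction with
  | id n => exact (F.map_id n).trans (G.map_id n).symm
  | symm n m => exact (F.map_symm n m).trans (G.map_symm n m).symm
  | comp ih₁ ih₂ =>
    exact (F.map_comp _ _).trans ((congrArg₂ P.comp ih₁ ih₂).trans (G.map_comp _ _).symm)
  | tensor ih₁ ih₂ =>
    exact (F.map_tensor _ _).trans ((congrArg₂ P.tensor ih₁ ih₂).trans (G.map_tensor _ _).symm)
  | gen o => exact h _ _ o
  | mul => exact h' _ _ .mult
  | one => exact h' _ _ .unit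
  | comul => exact h' _ _ .comult
  | counit => exact h' _ _ .counit

variable (S)

/-- The morphism that sends a generator to a hyperedge. -/
noncomputable def ofSyntax : syntaxPROP S ⟶ FTerm S :=
  presentedPROP.lift (fun _ _ o => gen o) fun _ _ _ _ h => h.elim

/-- The morphism that is given by the special Frobenius monoid of discrete cospans. -/
noncomputable def ofFrob : Frob.{u} ⟶ FTerm S :=
  presentedPROP.lift (frobeniusStr S).interp fun _ _ _ _ h =>
    (frobeniusStr S).eval_eq_of_frobEqn _ rfl rfl rfl rfl h

/-- The special Frobenius monoid that generates `Frob`. -/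
def frobStr : Frob.{u}.FrobeniusStr :=
  presentedPROP.frobeniusStr (E := frobTheory) fun _ _ _ _ h => h

/-- `FTerm S` is a coproduct. -/
noncomputable def isColimit : IsColimit (BinaryCofan.mk (ofSyntax S) (ofFrob S)) := by
  have hA : ∀ {T : PROP.{u}} (g : Frob.{u} ⟶ T) {n m : ℕ} (o : FrobGen.{u} n m),
      (frobStr.image g).interp n m o = g.map (presentedPROP.gen frobTheory o) := by
    intro T g n m o
    cases o <;> rfl
  -- A cocone amounts to a special Frobenius monoid in `T`, the image of the one in `Frob`, and an
  -- interpretation of `S`. The mediating morphism is evaluation.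
  refine BinaryCofan.IsColimit.mk _ (fun {T} f g => (frobStr.image g).eval
    fun _ _ o => f.map (presentedPROP.gen (noEqn S) o)) (fun {T} f g => ?_) (fun {T} f g => ?_)
    (fun {T} f g k h₁ h₂ => ?_)
  · exact presentedPROP.hom_ext fun n m o => (frobStr.image g).eval_gen _ o
  · exact presentedPROP.hom_ext fun n m o => ((frobStr.image g).eval_frobeniusStr _ o).trans (hA g o)
  · refine hom_ext (fun n m o => ?_) fun n m o => ?_
    · refine Eq.trans ?_ ((frobStr.image g).eval_gen _ o).symm
      exact congrArg (fun F => PROPHom.map F (presentedPROP.gen (noEqn S) o)) h₁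
    · refine Eq.trans ?_ (((frobStr.image g).eval_frobeniusStr _ o).trans (hA g o)).symm
      exact congrArg (fun F => PROPHom.map F (presentedPROP.gen frobTheory o)) h₂

/-- The special Frobenius monoid in the PROP that is presented by `S` together with a special
Frobenius monoid. -/
def withFrobStr : (presentedPROP (withFrobGen S) (withFrobTheory S)).FrobeniusStr :=
  presentedPROP.frobeniusStr (E := withFrobTheory S) fun _ _ _ _ h => h

/-- The interpretation of generators and of the special Frobenius structure in `FTerm S`. -/
noncomputable def withFrobInterp (n m : ℕ) (o : withFrobGen S n m) : (FTerm S).Hom n m :=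
  Sum.elim gen ((frobeniusStr S).interp n m) o

/-- The morphism to `FTerm S` from the PROP that is presented by `S` together with a special
Frobenius monoid. -/
noncomputable def ofPresented : presentedPROP (withFrobGen S) (withFrobTheory S) ⟶ FTerm S :=
  presentedPROP.lift (withFrobInterp S) fun _ _ _ _ h =>
    (frobeniusStr S).eval_eq_of_frobEqn _ rfl rfl rfl rfl h

/-- The presentation of `FTerm S`. -/
noncomputable def presentationIso : presentedPROP (withFrobGen S) (withFrobTheory S) ≅ FTerm S where
  hom := ofPresented S
  inv := (withFrobStr S).eval fun _ _ o => presentedPROP.gen (withFrobTheory S) (.inl o)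
  hom_inv_id := by
    -- Both composites fix all generators, and on either side a morphism is determined by its values
    -- on them.
    refine presentedPROP.hom_ext fun n m o => ?_
    rcases o with o | o
    · exact (withFrobStr S).eval_gen _ o
    · refine ((withFrobStr S).eval_frobeniusStr _ o).trans ?_
      cases o <;> rfl
  inv_hom_id := by
    refine hom_ext (fun n m o => ?_) fun n m o => ?_
    · exact congrArg (PROPHom.map (ofPresented S)) ((withFrobStr S).eval_gen _ o)
    · refine (congrArg (PROPHom.map (ofPresented S)) ((withFrobStr S).eval_frobeniusStr _ o)).trans ?_
      cases o <;> rfl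

end FTerm

theorem theorem3p3 (S : Signature.{u}) :
    -- `FTerm S`, with the evident injections, is a coproduct of `syntaxPROP S` and `Frob`
    (∃ (φ : syntaxPROP S ⟶ FTerm S) (ψ : Frob.{u} ⟶ FTerm S),
      (∀ (n m : ℕ) (o : S n m), φ.map (presentedPROP.gen (noEqn S) o) = FTerm.gen o) ∧
      ψ.map (presentedPROP.gen frobTheory .mult) = FTerm.ofFun (N := 1) (fun _ => 0) (fun _ => 0) ∧
      ψ.map (presentedPROP.gen frobTheory .unit) = FTerm.ofFun (N := 1) (fun _ => 0) (fun _ => 0) ∧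
      ψ.map (presentedPROP.gen frobTheory .comult) = FTerm.ofFun (N := 1) (fun _ => 0) (fun _ => 0) ∧
      ψ.map (presentedPROP.gen frobTheory .counit) = FTerm.ofFun (N := 1) (fun _ => 0) (fun _ => 0) ∧
      Nonempty (IsColimit (BinaryCofan.mk φ ψ))) ∧
    -- the isomorphism with the coproduct
    (∃ _ : HasBinaryCoproduct (syntaxPROP S) Frob.{u},
      Nonempty (FTerm S ≅ syntaxPROP S ⨿ Frob.{u})) ∧
    -- the presentation by generators and equations
    (∃ Φ : presentedPROP (withFrobGen S) (withFrobTheory S) ≅ FTerm S,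
      (∀ (n m : ℕ) (o : S n m),
        Φ.hom.map (presentedPROP.gen (withFrobTheory S) (.inl o)) = FTerm.gen o) ∧
      ∀ (n m : ℕ) (o : FrobGen.{u} n m),
        Φ.hom.map (presentedPROP.gen (withFrobTheory S) (.inr o)) =
          FTerm.ofFun (N := 1) (fun _ => 0) (fun _ => 0)) := by
  have h : HasBinaryCoproduct (syntaxPROP S) Frob.{u} := ⟨⟨⟨_, FTerm.isColimit S⟩⟩⟩
  exact ⟨⟨FTerm.ofSyntax S, FTerm.ofFrob S, fun _ _ _ => rfl, rfl, rfl, rfl, rfl,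
    ⟨FTerm.isColimit S⟩⟩, ⟨h, ⟨(FTerm.isColimit S).coconePointUniqueUpToIso (colimit.isColimit _)⟩⟩,
    FTerm.presentationIso S, fun _ _ _ => rfl, fun _ _ o => FTerm.interp_frobeniusStr o⟩
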